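/- Let $m,k\ge 1$ and $T>0$. Let $M_{2m}(\mathbb R)$ be the space of real $2m\times 2m$ matrices with a fixed norm $|\cdot|$, let $\mathbb J=\begin{pmatrix}0&I_m\\-I_m&0\end{pmatrix}$, let $\mathrm{Sp}(m)=\{X\in M_{2m}(\mathbb R): X^*\mathbb J X=\mathbb J\}$ be the symplectic group and $T_{I_{2m}}\mathrm{Sp}(m)=\{Y\in M_{2m}(\mathbb R): \mathbb J Y \text{ is symmetric}\}$. Put $[B,B']=BB'-B'B$. Let $\Theta$ be a set and, for every $\theta\in\Theta$, let $A^\theta:[0,T]\to M_{2m}(\mathbb R)$ be a $C^\infty$ map and $B_1^\theta,\dots,B_k^\theta\in M_{2m}(\mathbb R)$ be matrices such that $\mathbb J A^\theta(t)$ (for all $t\in[0,T]$) and $\mathbb J B_1^\theta,\dots,\mathbb J B_k^\theta$ are symmetric, and $$B_i^\theta B_j^\theta=0\qquad\text{for all } i,j=1,\dots,k .$$ Define $B_i^{\theta,0}(t)=B_i^\theta$ and $B_i^{\theta,j}(t)=\dot B_i^{\theta,j-1}(t)+B_i^{\theta,j-1}(t)A^\theta(t)-A^\theta(t)B_i^{\theta,j-1}(t)$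 for $j\ge1$, $t\in[0,T]$, and assume that for every $\theta\in\Theta$ $$[B_i^{\theta,j}(0),B_i^\theta]\in\mathrm{Span}\{B_r^{\theta,s}(0): r=1,\dots,k,\ s\ge0\}\qquad\text{for all } i=1,\dots,k \text{ and } j=1,2,$$ $$\mathrm{Span}\{B_i^{\theta,j}(0),\ [B_i^{\theta,1}(0),B_l^{\theta,1}(0)]: i,l=1,\dots,k,\ j=0,1,2\}=T_{I_{2m}}\mathrm{Sp}(m).$$ Assume moreover that the family of data $$\{(A^\theta,B_1^\theta,\dots,B_k^\theta):\theta\in\Theta\}\subset C^2([0,T];M_{2m}(\mathbb R))\times M_{2m}(\mathbb R)^k$$ is compact. For $\bar X\in \mathrm{Sp}(m)$ and a control $u:[0,T]\to\mathbb R^k$ let $E_\theta^{\bar X,T}(u)=X(T)$, where $X$ is the solution on $[0,T]$ of $$\dot X(t)=A^\theta(t)X(t)+\sum_{i=1}^k u_i(t)B_i^\theta X(t)\ \text{ for a.e. } t,\qquad X(0)=\bar X,$$ and put $\bar X^\theta(T)=E_\theta^{\bar X,T}(0)$. Then for every compact set $C\subset\mathrm{Sp}(m)$ (for example $C=\{\bar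 X\}$) there are $\mu,K>0$ such that for every $\theta\in\Theta$, every $\bar X\in C$ and every $X\in \mathrm{Sp}(m)$ with $|X-\bar X^\theta(T)|<\mu$ there is a control $u\in C^\infty([0,T];\mathbb R^k)$ with support in $(0,T)$ such that $$E_\theta^{\bar X,T}(u)=X\qquad\text{and}\qquad \|u\|_{C^2}\le K\,|X-\bar X^\theta(T)|^{1/2}.$$ -/

import Mathlib

open Set MeasureTheory
open scoped ContDiff Matrix

open scoped Matrix.Norms.L2Operator

/-- The space `M_{2m}(ℝ)` of real `2m × 2m` matrices, with rows and columns indexed by two blocks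
of size `m`. It carries the operator norm for the Euclidean norm of `ℝ^{2m}` (all norms on this
finite-dimensional space are equivalent, so that another one changes only constants). -/
abbrev Mat (m : ℕ) : Type := Matrix (Fin m ⊕ Fin m) (Fin m ⊕ Fin m) ℝ

/-- The tangent space at the identity of the symplectic group `Sp(m)`: all `Y` such that `J Y` is
symmetric (the overall sign of `J` does not matter). -/
def spTangent (m : ℕ) : Submodule ℝ (Mat m) where
  carrier := {Y | (Matrix.J (Fin m) ℝ * Y).IsSymm}
  add_mem' {Y Z} hY hZ := by
    simp only [mem_ofPred_eq, mul_add] at *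
    exact hY.add hZ
  zero_mem' := by simp
  smul_mem' c Y hY := by
    simp only [mem_ofPred_eq, Matrix.mul_smul] at *
    exact hY.smul c

/-- The sequence `B^j : [0,T] → M_{2m}(ℝ)` with `B^0 = B` and
`B^{j+1}(t) = (d/dt) B^j (t) + B^j(t) A(t) - A(t) B^j(t)`; derivatives are taken in `[0,T]`
(one-sided at the end points). Only the values at `t ∈ [0,T]` are meaningful. -/
noncomputable def bracketSeq {m : ℕ} (T : ℝ) (A : ℝ → Mat m) (B : Mat m) : ℕ → ℝ → Mat m
  | 0 => fun _ => B
  | j + 1 => fun t =>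
      derivWithin (bracketSeq T A B j) (Icc 0 T) t
        + (bracketSeq T A B j t * A t - A t * bracketSeq T A B j t)

/-- The right-hand side `A(t) X(t) + ∑ i, u_i(t) B_i X(t)` of the control system. -/
noncomputable def controlRHS {m k : ℕ} (A : ℝ → Mat m) (B : Fin k → Mat m)
    (u : ℝ → EuclideanSpace ℝ (Fin k)) (X : ℝ → Mat m) (t : ℝ) : Mat m :=
  A t * X t + ∑ i, u t i • (B i * X t)

/-- `X` solves on `[0,T]` the Cauchy problem
`Ẋ(t) = A(t) X(t) + ∑ i, u_i(t) B_i X(t)` for a.e. `t`, `X(0) = X₀`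
(Carathéodory solutions, that is absolutely continuous ones, written in integral form). -/
def IsTrajectory {m k : ℕ} (T : ℝ) (A : ℝ → Mat m) (B : Fin k → Mat m)
    (X₀ : Mat m) (u : ℝ → EuclideanSpace ℝ (Fin k)) (X : ℝ → Mat m) : Prop :=
  ContinuousOn X (Icc 0 T) ∧
  IntervalIntegrable (controlRHS A B u X) volume 0 T ∧
  ∀ t ∈ Icc 0 T, X t = X₀ + ∫ s in (0 : ℝ)..t, controlRHS A B u X s

open Classical in
/-- The End-Point mapping `u ↦ X_{X₀,u}(T)`: the value at time `T` of the solution of the Cauchy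
problem with control `u` starting from `X₀` (for continuous `A` and square integrable `u` this
solution exists and is unique on `[0,T]`; a dummy value is used when there is no solution). -/
noncomputable def endPoint {m k : ℕ} (T : ℝ) (A : ℝ → Mat m) (B : Fin k → Mat m)
    (X₀ : Mat m) (u : ℝ → EuclideanSpace ℝ (Fin k)) : Mat m :=
  if h : ∃ X, IsTrajectory T A B X₀ u X then h.choose T else 0

/-- Maps of class `C²` on `[0,T]`. The values outside of `[0,T]` are irrelevant: the topology and
the norm below do not see them. -/
structure C2Path (T : ℝ) (E : Type*) [NormedAddCommGroup E] [NormedSpace ℝ E] where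
  toFun : ℝ → E
  contDiffOn : ContDiffOn ℝ 2 toFun (Icc 0 T)

namespace C2Path

variable {T : ℝ} {E : Type*} [NormedAddCommGroup E] [NormedSpace ℝ E]

theorem continuousOn_iterDeriv (f : C2Path T E) (j : Fin 3) :
    ContinuousOn (iteratedDerivWithin j f.toFun (Icc 0 T)) (Icc 0 T) := by
  rcases lt_or_ge 0 T with hT | hT
  · refine f.contDiffOn.continuousOn_iteratedDerivWithin ?_ (uniqueDiffOn_Icc hT)
    have : (j : ℕ) ≤ 2 := by omega
    exact_mod_cast this
  · exact (subsingleton_Icc_of_ge hT).continuousOn _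

/-- The triple `(f, f', f'')` of continuous maps on `[0,T]`. -/
noncomputable def jet (f : C2Path T E) : Fin 3 → C(Icc (0 : ℝ) T, E) := fun j =>
  ⟨(Icc (0 : ℝ) T).domRestrict (iteratedDerivWithin j f.toFun (Icc 0 T)),
    (f.continuousOn_iterDeriv j).domRestrict⟩

/-- The `C²` topology: uniform convergence on `[0,T]` of `f`, `f'` and `f''`. -/
noncomputable instance : TopologicalSpace (C2Path T E) := TopologicalSpace.induced jet inferInstance

/-- The `C²` norm: the maximum of the sup norms on `[0,T]` of `f`, `f'` and `f''`. -/
noncomputable instance : Norm (C2Path T E) := ⟨fun f => ‖f.jet‖⟩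

/-- A smooth map on `[0,T]`, seen as a `C²` one. -/
def ofSmooth (f : ℝ → E) (hf : ContDiffOn ℝ ∞ f (Icc 0 T)) : C2Path T E :=
  ⟨f, hf.of_le (by norm_cast)⟩

end C2Path

/-! ### Linear differential equations in a Banach algebra -/

section LinearODE

variable {𝔸 : Type*} [NormedRing 𝔸] [NormedAlgebra ℝ 𝔸]

/-! Let S be the fundamental solution of S' = A S. A trajectory is X = S Z X̄, where Z' = (∑ u_i
b_i) Z, Z(0) = 1 and b_i = S⁻¹ B_i S (`endPoint_eq`). All factors are symplectic, so it suffices to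
reach every symplectic matrix near 1 as Z(T). Near 1 the projection `spProj` to the tangent space is
injective on the group (`eq_of_spProj_eq`), so the equation to be solved lives in a vector space.
For u = ∑ ξ_c w_c, iterated integrals give Z(T) - 1 = Lξ + K(ξ,ξ) + (Lξ)²/2 + O(|ξ|³), with K an
antisymmetrized double integral (`linearFlow_linSum_eq`).

The first order terms of all controls span a subspace that need not be the whole tangent space. It
contains every B_i^j(0), because these are the derivatives at 0 of b_i. Let π be a projection whose
kernel is this subspace. By the span hypothesis the vectors e_{il} = π[B_i^1(0), B_l^1(0)] generate
what is missing. They arise at second order from controls δ⁻² f'''(t/δ) concentrated at time 0: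
after expanding b_i to order two, the term of size δ⁻² vanishes since B_i B_l = 0, while the term of
size δ⁻¹ and the unwanted one of size 1 disappear either by orthogonality of the profiles or, for
one profile paired with itself, by the hypothesis on [B_i^j(0), B_i]. As δ → 0 only e_{il} remains,
and controls with profiles of disjoint support do not interact (`exists_concentrated_controls`).

Modulo the range of L the quadratic part is therefore almost ∑ x_i² e_i. Squares alone might not
cover a neighbourhood of 0, but e_{il} = -e_{li} gives ∑ e_i = 0. Hence x = (1,…,1) is a zero, and
the differential a ↦ 2∑ a_i e_i there is onto modulo the range of L. One obstacle remains: the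
concentrated controls have a first order term, which would dominate at scale ε. With more copies of
each control than the dimension, some unit combination of the copies has first order term exactly 0
and the same quadratic term. Looking for ξ = εV + ε²W with ε² proportional to ‖y‖ leaves a small
Lipschitz perturbation of the identity (`exists_quadratic_preimage`); this is where the exponent 1/2
comes from.

Every estimate depends only on the uniform size of the b_i and is stable under small perturbations,
so the controls built for one system steer all nearby ones with the same constants. Compactness of
the family then makes the constants uniform. -/

theorem integral_exp_decay_le {c t : ℝ} (hc : 0 < c) :
    ∫ s in (0 : ℝ)..t, Real.exp (-(c * (t - s))) ≤ 1 / c := by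
  have h : ∫ s in (0 : ℝ)..t, Real.exp (-(c * (t - s)))
      = Real.exp (-(c * (t - t))) / c - Real.exp (-(c * (t - 0))) / c := by
    refine intervalIntegral.integral_eq_sub_of_hasDerivAt
      (f := fun s => Real.exp (-(c * (t - s))) / c) (fun s _ => ?_)
      (Continuous.intervalIntegrable (by fun_prop) _ _)
    have h1 : HasDerivAt (fun s : ℝ => -(c * (t - s))) c s := by
      have := (((hasDerivAt_id s).const_sub t).const_mul c).fun_neg
      simpa only [mul_neg, mul_one, neg_neg, id_eq] using this
    have := h1.exp.div_const c
    rwa [mul_div_assoc, div_self hc.ne', mul_one] at this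
  rw [h, sub_self, mul_zero, neg_zero, Real.exp_zero]
  have := Real.exp_pos (-(c * (t - 0)))
  have : 0 ≤ Real.exp (-(c * (t - 0))) / c := by positivity
  linarith

/-- A linear differential equation with continuous coefficients has a solution on `[0,T]`. -/
theorem exists_linear_flow [CompleteSpace 𝔸] {T : ℝ} (hT : 0 ≤ T) {M : ℝ → 𝔸} (hM : Continuous M) :
    ∃ Z : ℝ → 𝔸, Continuous Z ∧ Z 0 = 1 ∧ ∀ t ∈ Icc 0 T, HasDerivAt Z (M t * Z t) t := by
  obtain ⟨C, hC⟩ := isCompact_Icc.exists_bound_of_continuousOn (hM.continuousOn (s := Icc 0 T))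
  have hC0 : 0 ≤ C := (norm_nonneg _).trans (hC 0 ⟨le_rfl, hT⟩)
  -- The unknown is W = e^{-lt} Z. For it the Picard operator has Lipschitz constant at most C/l ≤
  -- 1/2, so one contraction covers all of [0,T].
  set l : ℝ := 2 * (C + 1) with hl
  have hl0 : 0 < l := by positivity
  let q : ℝ → Icc (0 : ℝ) T := projIcc 0 T hT
  have hq : Continuous q := continuous_projIcc
  have hcont : ∀ W : C(Icc (0 : ℝ) T, 𝔸), Continuous fun s => M s * W (q s) := fun W =>
    hM.mul (W.continuous.comp hq)
  let Φ : C(Icc (0 : ℝ) T, 𝔸) → C(Icc (0 : ℝ) T, 𝔸) := fun W =>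
    ⟨fun t => Real.exp (-(l * t)) • ((1 : 𝔸) +
      ∫ s in (0 : ℝ)..t, Real.exp (l * s) • (M s * W (q s))), by
      have h1 : Continuous fun t : ℝ => ∫ s in (0 : ℝ)..t, Real.exp (l * s) • (M s * W (q s)) :=
        intervalIntegral.continuous_primitive (fun a b =>
          Continuous.intervalIntegrable (by have := hcont W; fun_prop) _ _) _
      have h2 : Continuous fun t : ℝ => Real.exp (-(l * t)) • ((1 : 𝔸) +
        ∫ s in (0 : ℝ)..t, Real.exp (l * s) • (M s * W (q s))) := by fun_prop
      exact h2.comp continuous_subtype_val⟩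
  have hΦ : ContractingWith (1 / 2) Φ := by
    refine ⟨by rw [← NNReal.coe_lt_coe]; norm_num, LipschitzWith.of_dist_le_mul fun W V => ?_⟩
    rw [ContinuousMap.dist_le (by positivity)]
    intro t
    have ht := t.2
    have hW : ∀ W : C(Icc (0 : ℝ) T, 𝔸), IntervalIntegrable
        (fun s => Real.exp (l * s) • (M s * W (q s))) volume 0 t := fun W =>
          Continuous.intervalIntegrable (by have := hcont W; fun_prop) _ _
    have e : Φ W t - Φ V t = ∫ s in (0 : ℝ)..t,
        Real.exp (-(l * (t - s))) • (M s * (W (q s) - V (q s))) := by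
      simp only [Φ, ContinuousMap.coe_mk]
      rw [← smul_sub, add_sub_add_left_eq_sub, ← intervalIntegral.integral_sub (hW W) (hW V),
        ← intervalIntegral.integral_smul]
      congr 1; ext s
      rw [← smul_sub, smul_smul, ← Real.exp_add, ← mul_sub]
      congr 2; ring
    rw [dist_eq_norm, e]
    calc _ ≤ ∫ s in (0 : ℝ)..t, Real.exp (-(l * (t - s))) * (C * dist W V) := by
          refine intervalIntegral.norm_integral_le_of_norm_le ht.1 (.of_forall fun s hs => ?_)
            (Continuous.intervalIntegrable (by fun_prop) _ _)
          rw [norm_smul, Real.norm_eq_abs, abs_of_pos (Real.exp_pos _)]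
          gcongr
          refine (norm_mul_le _ _).trans ?_
          gcongr
          · exact hC s ⟨hs.1.le, hs.2.trans ht.2⟩
          · rw [← dist_eq_norm]; exact ContinuousMap.dist_apply_le_dist _
      _ = (∫ s in (0 : ℝ)..t, Real.exp (-(l * (t - s)))) * (C * dist W V) := by
          rw [intervalIntegral.integral_mul_const]
      _ ≤ 1 / l * (C * dist W V) := by
          gcongr; exact integral_exp_decay_le hl0
      _ = (C / l) * dist W V := by ring
      _ ≤ _ := by
          have : C / l ≤ 1 / 2 := by rw [div_le_iff₀ hl0, hl]; linarith
          push_cast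
          gcongr
  obtain ⟨W, hWfix⟩ : ∃ W, Φ W = W := ⟨_, hΦ.fixedPoint_isFixedPt⟩
  let Z : ℝ → 𝔸 := fun t => 1 + ∫ s in (0 : ℝ)..t, Real.exp (l * s) • (M s * W (q s))
  have hg : Continuous fun s => Real.exp (l * s) • (M s * W (q s)) := by
    have := hcont W; fun_prop
  have hZ : ∀ t, HasDerivAt Z (Real.exp (l * t) • (M t * W (q t))) t := fun t =>
    (intervalIntegral.integral_hasDerivAt_right (hg.intervalIntegrable _ _)
      (hg.stronglyMeasurableAtFilter _ _) hg.continuousAt).const_add _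
  refine ⟨Z, continuous_iff_continuousAt.2 fun t => (hZ t).continuousAt, by simp [Z],
    fun t ht => ?_⟩
  have key : W (q t) = Real.exp (-(l * t)) • Z t := by
    have := congrArg (fun f => f (⟨t, ht⟩ : Icc (0 : ℝ) T)) hWfix
    simp only [q, projIcc_of_mem hT ht]
    exact this.symm
  have := hZ t
  rw [key, mul_smul_comm, smul_smul, ← Real.exp_add, add_neg_cancel, Real.exp_zero, one_smul] at this
  exact this

open Classical in
/-- The solution `Z` of `Z' = M Z`, `Z(0) = 1` on `[0,T]`. -/
noncomputable def linearFlow (T : ℝ) (M : ℝ → 𝔸) : ℝ → 𝔸 :=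
  if h : ∃ Z : ℝ → 𝔸, Continuous Z ∧ Z 0 = 1 ∧ ∀ t ∈ Icc 0 T, HasDerivAt Z (M t * Z t) t then
    h.choose else 0

theorem linearFlow_spec [CompleteSpace 𝔸] {T : ℝ} (hT : 0 ≤ T) {M : ℝ → 𝔸} (hM : Continuous M) :
    Continuous (linearFlow T M) ∧ linearFlow T M 0 = 1 ∧
    ∀ t ∈ Icc 0 T, HasDerivAt (linearFlow T M) (M t * linearFlow T M t) t := by
  have h := exists_linear_flow hT hM
  rw [linearFlow, dif_pos h]
  exact h.choose_spec

theorem linearFlow_eq_integral [CompleteSpace 𝔸] {T : ℝ} (hT : 0 ≤ T) {M : ℝ → 𝔸} (hM : Continuous M) {t : ℝ} (ht : t ∈ Icc 0 T) :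
    linearFlow T M t = 1 + ∫ s in (0 : ℝ)..t, M s * linearFlow T M s := by
  obtain ⟨h1, h2, h3⟩ := linearFlow_spec hT hM
  rw [intervalIntegral.integral_eq_sub_of_hasDerivAt (f := linearFlow T M), h2]
  · abel
  · intro s hs
    rw [uIcc_of_le ht.1] at hs
    exact h3 s ⟨hs.1, hs.2.trans ht.2⟩
  · exact (hM.mul h1).intervalIntegrable _ _

/-- Uniqueness for linear differential equations. -/
theorem linear_ode_unique {T : ℝ} {M : ℝ → 𝔸} (hM : Continuous M) {X Y : ℝ → 𝔸}
    (hX : ContinuousOn X (Icc 0 T)) (hY : ContinuousOn Y (Icc 0 T)) (h0 : X 0 = Y 0)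
    (hX' : ∀ t ∈ Ico 0 T, HasDerivWithinAt X (M t * X t) (Ici t) t)
    (hY' : ∀ t ∈ Ico 0 T, HasDerivWithinAt Y (M t * Y t) (Ici t) t) :
    EqOn X Y (Icc 0 T) := by
  obtain ⟨C, hC⟩ := isCompact_Icc.exists_bound_of_continuousOn (hM.continuousOn (s := Icc 0 T))
  intro t ht
  have := norm_le_gronwallBound_of_norm_deriv_right_le (f := fun t => X t - Y t)
    (f' := fun t => M t * X t - M t * Y t) (δ := 0) (K := C) (ε := 0) (hX.sub hY)
    (fun t ht => (hX' t ht).sub (hY' t ht)) (by simp [h0]) (fun t ht => by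
      rw [← mul_sub, add_zero]
      refine (norm_mul_le _ _).trans ?_
      gcongr
      exact hC t ⟨ht.1, ht.2.le⟩) t ht
  rw [gronwallBound_ε0_δ0] at this
  exact sub_eq_zero.1 (norm_le_zero_iff.1 this)

end LinearODE

/-! ### Iterated integrals and the third order remainder -/

section Dyson

variable {𝔸 : Type*} [NormedRing 𝔸] [NormedAlgebra ℝ 𝔸]

/-- The primitive of `M f` vanishing at `0`. -/
noncomputable def volterra (M f : ℝ → 𝔸) (t : ℝ) : 𝔸 := ∫ s in (0 : ℝ)..t, M s * f s

/-- The remainder of order three in the expansion of `linearFlow T M T` in iterated integrals. -/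
noncomputable def dysonRem (T : ℝ) (M : ℝ → 𝔸) : 𝔸 :=
  linearFlow T M T - 1 - volterra M 1 T - volterra M (volterra M 1) T

theorem continuous_volterra {M f : ℝ → 𝔸} (hM : Continuous M) (hf : Continuous f) :
    Continuous (volterra M f) :=
  intervalIntegral.continuous_primitive (fun _ _ => (hM.mul hf).intervalIntegrable _ _) _

theorem volterra_sub {M f g : ℝ → 𝔸} (hM : Continuous M) (hf : Continuous f) (hg : Continuous g)
    (t : ℝ) : volterra M (fun s => f s - g s) t = volterra M f t - volterra M g t := by
  simp only [volterra, mul_sub]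
  exact intervalIntegral.integral_sub ((hM.mul hf).intervalIntegrable _ _)
    ((hM.mul hg).intervalIntegrable _ _)

theorem norm_volterra_le {M f : ℝ → 𝔸} {T β F : ℝ} (hβ : 0 ≤ β)
    (hM : ∀ t ∈ Icc 0 T, ‖M t‖ ≤ β) (hf : ∀ t ∈ Icc 0 T, ‖f t‖ ≤ F) {t : ℝ} (ht : t ∈ Icc 0 T) :
    ‖volterra M f t‖ ≤ T * (β * F) := by
  have hF : 0 ≤ F := (norm_nonneg _).trans (hf t ht)
  have := intervalIntegral.norm_integral_le_of_norm_le_const (a := 0) (b := t) (C := β * F)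
    (f := fun s => M s * f s) (fun s hs => by
      rw [uIoc_of_le ht.1] at hs
      have hs' : s ∈ Icc 0 T := ⟨hs.1.le, hs.2.trans ht.2⟩
      exact (norm_mul_le _ _).trans (mul_le_mul (hM s hs') (hf s hs') (norm_nonneg _) hβ))
  refine this.trans ?_
  rw [sub_zero, abs_of_nonneg ht.1, mul_comm]
  gcongr
  exact ht.2

theorem norm_volterra_sub_volterra_le {M M' f f' : ℝ → 𝔸} {T β d F D : ℝ} (hβ : 0 ≤ β) (hd : 0 ≤ d)
    (hMc : Continuous M) (hMc' : Continuous M') (hfc : Continuous f) (hfc' : Continuous f')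
    (hM' : ∀ t ∈ Icc 0 T, ‖M' t‖ ≤ β) (hMM : ∀ t ∈ Icc 0 T, ‖M t - M' t‖ ≤ d)
    (hf : ∀ t ∈ Icc 0 T, ‖f t‖ ≤ F) (hff : ∀ t ∈ Icc 0 T, ‖f t - f' t‖ ≤ D)
    {t : ℝ} (ht : t ∈ Icc 0 T) :
    ‖volterra M f t - volterra M' f' t‖ ≤ T * (d * F + β * D) := by
  have e : volterra M f t - volterra M' f' t
      = volterra (fun s => M s - M' s) f t + volterra M' (fun s => f s - f' s) t := by
    rw [volterra_sub hMc' hfc hfc']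
    simp only [volterra, sub_mul]
    rw [intervalIntegral.integral_sub ((hMc.fun_mul hfc).intervalIntegrable _ _)
      ((hMc'.fun_mul hfc).intervalIntegrable _ _)]
    abel
  rw [e, mul_add]
  exact (norm_add_le _ _).trans
    (add_le_add (norm_volterra_le hd hMM hf ht) (norm_volterra_le hβ hM' hff ht))

variable [CompleteSpace 𝔸]

theorem linearFlow_eq_volterra {T : ℝ} (hT : 0 ≤ T) {M : ℝ → 𝔸} (hM : Continuous M) {t : ℝ}
    (ht : t ∈ Icc 0 T) : linearFlow T M t - 1 = volterra M (linearFlow T M) t := by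
  rw [linearFlow_eq_integral hT hM ht, add_sub_cancel_left]; rfl

theorem exists_max_norm {E : Type*} [NormedAddCommGroup E] {T : ℝ} (hT : 0 ≤ T) {f : ℝ → E} (hf : Continuous f) :
    ∃ t₀ ∈ Icc 0 T, ∀ t ∈ Icc 0 T, ‖f t‖ ≤ ‖f t₀‖ :=
  isCompact_Icc.exists_isMaxOn ⟨0, le_rfl, hT⟩ hf.norm.continuousOn

/-- At a time t₀ where the norm is maximal, the integral equation bounds it by ‖1‖ + Tβ‖Z(t₀)‖, and
the last term is absorbed because Tβ ≤ 1/2. The difference of two flows is treated in the same way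
below. -/
theorem norm_linearFlow_le {T β : ℝ} (hT : 0 ≤ T) {M : ℝ → 𝔸} (hM : Continuous M) (hβ : 0 ≤ β)
    (hβT : T * β ≤ 1 / 2) (hMb : ∀ t ∈ Icc 0 T, ‖M t‖ ≤ β) {t : ℝ} (ht : t ∈ Icc 0 T) :
    ‖linearFlow T M t‖ ≤ 2 * ‖(1 : 𝔸)‖ := by
  obtain ⟨hc, -, -⟩ := linearFlow_spec hT hM
  obtain ⟨t₀, ht₀, hmax⟩ := exists_max_norm hT hc
  refine (hmax t ht).trans ?_
  have h1 := norm_volterra_le hβ hMb hmax ht₀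
  rw [← linearFlow_eq_volterra hT hM ht₀] at h1
  have h2 := norm_le_norm_sub_add (linearFlow T M t₀) 1
  have h3 : T * β * ‖linearFlow T M t₀‖ ≤ 1 / 2 * ‖linearFlow T M t₀‖ := by gcongr
  linarith

theorem norm_linearFlow_sub_le {T β d : ℝ} (hT : 0 ≤ T) {M M' : ℝ → 𝔸} (hM : Continuous M)
    (hM' : Continuous M') (hβ : 0 ≤ β) (hd : 0 ≤ d) (hβT : T * β ≤ 1 / 2)
    (hMb : ∀ t ∈ Icc 0 T, ‖M t‖ ≤ β) (hMb' : ∀ t ∈ Icc 0 T, ‖M' t‖ ≤ β)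
    (hMM : ∀ t ∈ Icc 0 T, ‖M t - M' t‖ ≤ d) {t : ℝ} (ht : t ∈ Icc 0 T) :
    ‖linearFlow T M t - linearFlow T M' t‖ ≤ 4 * ‖(1 : 𝔸)‖ * T * d := by
  obtain ⟨hc, -, -⟩ := linearFlow_spec hT hM
  obtain ⟨hc', -, -⟩ := linearFlow_spec hT hM'
  obtain ⟨t₀, ht₀, hmax⟩ := exists_max_norm hT (hc.fun_sub hc')
  refine (hmax t ht).trans ?_
  have h1 := norm_volterra_sub_volterra_le hβ hd hM hM' hc hc' hMb' hMM
    (fun t ht => norm_linearFlow_le hT hM hβ hβT hMb ht) hmax ht₀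
  rw [← linearFlow_eq_volterra hT hM ht₀, ← linearFlow_eq_volterra hT hM' ht₀,
    sub_sub_sub_cancel_right] at h1
  set D := ‖linearFlow T M t₀ - linearFlow T M' t₀‖
  have h3 : T * β * D ≤ 1 / 2 * D := by gcongr
  change D ≤ _
  linarith

/-- The remainder is a threefold application of `volterra M` to the flow. Each application costs Tβ,
and comparing M with M' replaces one β by d. The resulting β²d is the cubic behaviour needed in the
fixed point argument. -/
theorem norm_dysonRem_sub_le {T β d : ℝ} (hT : 0 ≤ T) {M M' : ℝ → 𝔸} (hM : Continuous M)
    (hM' : Continuous M') (hβ : 0 ≤ β) (hd : 0 ≤ d) (hβT : T * β ≤ 1 / 2)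
    (hMb : ∀ t ∈ Icc 0 T, ‖M t‖ ≤ β) (hMb' : ∀ t ∈ Icc 0 T, ‖M' t‖ ≤ β)
    (hMM : ∀ t ∈ Icc 0 T, ‖M t - M' t‖ ≤ d) :
    ‖dysonRem T M - dysonRem T M'‖ ≤ 8 * ‖(1 : 𝔸)‖ * T ^ 3 * β ^ 2 * d := by
  have key : ∀ {M : ℝ → 𝔸}, Continuous M →
      (∀ t ∈ Icc 0 T, linearFlow T M t - 1 - volterra M 1 t
        = volterra M (fun s => linearFlow T M s - 1) t) ∧
      dysonRem T M = volterra M (fun s => linearFlow T M s - 1 - volterra M 1 s) T := by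
    intro M hM
    obtain ⟨hc, -, -⟩ := linearFlow_spec hT hM
    have h1 : ∀ t ∈ Icc 0 T, linearFlow T M t - 1 - volterra M 1 t
        = volterra M (fun s => linearFlow T M s - 1) t := fun t ht => by
      rw [linearFlow_eq_volterra hT hM ht, ← volterra_sub hM hc continuous_one]; rfl
    refine ⟨h1, ?_⟩
    rw [volterra_sub hM (hc.fun_sub continuous_const) (continuous_volterra hM continuous_one),
      ← h1 T ⟨hT, le_rfl⟩, dysonRem]
  obtain ⟨hc, -, -⟩ := linearFlow_spec hT hM
  obtain ⟨hc', -, -⟩ := linearFlow_spec hT hM'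
  have b1 : ∀ t ∈ Icc 0 T, ‖linearFlow T M t - 1‖ ≤ T * (β * (2 * ‖(1 : 𝔸)‖)) := fun t ht => by
    rw [linearFlow_eq_volterra hT hM ht]
    exact norm_volterra_le hβ hMb (fun t ht => norm_linearFlow_le hT hM hβ hβT hMb ht) ht
  have b2 : ∀ t ∈ Icc 0 T, ‖linearFlow T M t - 1 - volterra M 1 t‖
      ≤ T * (β * (T * (β * (2 * ‖(1 : 𝔸)‖)))) := fun t ht => by
    rw [(key hM).1 t ht]
    exact norm_volterra_le hβ hMb b1 ht
  have d1 : ∀ t ∈ Icc 0 T, ‖(linearFlow T M t - 1) - (linearFlow T M' t - 1)‖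
      ≤ 4 * ‖(1 : 𝔸)‖ * T * d := fun t ht => by
    rw [sub_sub_sub_cancel_right]
    exact norm_linearFlow_sub_le hT hM hM' hβ hd hβT hMb hMb' hMM ht
  have d2 : ∀ t ∈ Icc 0 T, ‖(linearFlow T M t - 1 - volterra M 1 t)
      - (linearFlow T M' t - 1 - volterra M' 1 t)‖
      ≤ T * (d * (T * (β * (2 * ‖(1 : 𝔸)‖))) + β * (4 * ‖(1 : 𝔸)‖ * T * d)) := fun t ht => by
    rw [(key hM).1 t ht, (key hM').1 t ht]
    exact norm_volterra_sub_volterra_le hβ hd hM hM' (hc.sub continuous_const)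
      (hc'.sub continuous_const) hMb' hMM b1 d1 ht
  rw [(key hM).2, (key hM').2]
  refine (norm_volterra_sub_volterra_le hβ hd hM hM'
    ((hc.sub continuous_const).sub (continuous_volterra hM continuous_one))
    ((hc'.sub continuous_const).sub (continuous_volterra hM' continuous_one))
    hMb' hMM b2 d2 ⟨hT, le_rfl⟩).trans (le_of_eq ?_)
  ring

end Dyson

/-! ### Perturbations of the identity; calculus of bounded Lipschitz maps -/

section QuadraticSurjection

/-- A `1/2`-Lipschitz perturbation of the identity covers a ball. -/
theorem surj_of_lipschitz_perturbation {F : Type*} [NormedAddCommGroup F] [NormedSpace ℝ F]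
    [CompleteSpace F] {G : F → F} {ρ : ℝ} (hρ : 0 ≤ ρ) (h0 : ‖G 0‖ ≤ ρ / 4)
    (hG : ∀ y ∈ Metric.closedBall (0 : F) ρ, ∀ y' ∈ Metric.closedBall (0 : F) ρ,
      ‖(G y - y) - (G y' - y')‖ ≤ 1 / 2 * ‖y - y'‖) {w : F} (hw : ‖w‖ ≤ ρ / 4) :
    ∃ y, ‖y‖ ≤ ρ ∧ G y = w := by
  have hA : ApproximatesLinearOn G (ContinuousLinearMap.id ℝ F) (Metric.closedBall 0 ρ)
      (1 / 2 : NNReal) := by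
    intro y hy y' hy'
    have := hG y hy y' hy'
    simp only [ContinuousLinearMap.coe_id', id_eq]
    calc _ = ‖(G y - y) - (G y' - y')‖ := by congr 1; abel
      _ ≤ _ := by simpa using this
  -- The identity has a right inverse of norm 1, so the image contains the ball of radius (1 - 1/2)ρ
  -- about G 0, and w is within ρ/4 + ρ/4 of G 0.
  let S : (ContinuousLinearMap.id ℝ F).NonlinearRightInverse := ⟨id, 1, by simp, by simp⟩
  have := hA.surjOn_closedBall_of_nonlinearRightInverse S hρ subset_rfl
  obtain ⟨y, hy, hyw⟩ := this (show w ∈ _ by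
    rw [mem_closedBall_iff_norm]
    have : ((S.nnnorm : ℝ)⁻¹ - ((1 / 2 : NNReal) : ℝ)) * ρ = ρ / 2 := by
      simp [S]; ring
    rw [this]
    exact (norm_sub_le _ _).trans (by linarith))
  exact ⟨y, by simpa using hy, hyw⟩

/-- `f` is bounded by `C` and `D`-Lipschitz on `s`. -/
def BddLip {X F : Type*} [SeminormedAddCommGroup X] [SeminormedAddCommGroup F] (s : Set X) (C D : ℝ)
    (f : X → F) : Prop :=
  (∀ y ∈ s, ‖f y‖ ≤ C) ∧ ∀ y ∈ s, ∀ y' ∈ s, ‖f y - f y'‖ ≤ D * ‖y - y'‖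

namespace BddLip

variable {X F H : Type*} [NormedAddCommGroup X] [NormedAddCommGroup F] [NormedAddCommGroup H]
  {s : Set X} {C D C' D' : ℝ} {f g : X → F}

theorem add (hf : BddLip s C D f) (hg : BddLip s C' D' g) :
    BddLip s (C + C') (D + D') (fun y => f y + g y) :=
  ⟨fun y hy => (norm_add_le _ _).trans (add_le_add (hf.1 y hy) (hg.1 y hy)), fun y hy y' hy' => by
    rw [add_sub_add_comm, add_mul]
    exact (norm_add_le _ _).trans (add_le_add (hf.2 y hy y' hy') (hg.2 y hy y' hy'))⟩

theorem sub (hf : BddLip s C D f) (hg : BddLip s C' D' g) :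
    BddLip s (C + C') (D + D') (fun y => f y - g y) :=
  ⟨fun y hy => (norm_sub_le _ _).trans (add_le_add (hf.1 y hy) (hg.1 y hy)), fun y hy y' hy' => by
    rw [sub_sub_sub_comm, add_mul]
    exact (norm_sub_le _ _).trans (add_le_add (hf.2 y hy y' hy') (hg.2 y hy y' hy'))⟩

theorem mono (hf : BddLip s C D f) (hC : C ≤ C') (hD : D ≤ D') : BddLip s C' D' f :=
  ⟨fun y hy => (hf.1 y hy).trans hC, fun y hy y' hy' => (hf.2 y hy y' hy').trans (by gcongr)⟩

/-- Composition with a map that is additive and bounded. -/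
theorem comp_bounded {φ : F → H} {c : ℝ} (hc : 0 ≤ c) (hφ : ∀ x y, φ (x - y) = φ x - φ y)
    (hb : ∀ x, ‖φ x‖ ≤ c * ‖x‖) (hf : BddLip s C D f) :
    BddLip s (c * C) (c * D) (fun y => φ (f y)) :=
  ⟨fun y hy => (hb _).trans (by gcongr; exact hf.1 y hy), fun y hy y' hy' => by
    rw [← hφ, mul_assoc]
    exact (hb _).trans (by gcongr; exact hf.2 y hy y' hy')⟩

theorem smul [NormedSpace ℝ F] (a : ℝ) (hf : BddLip s C D f) :
    BddLip s (|a| * C) (|a| * D) (fun y => a • f y) :=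
  hf.comp_bounded (abs_nonneg a) (fun x y => smul_sub a x y) (fun x => (norm_smul a x).le)

/-- A product-like map of two bounded Lipschitz maps. -/
theorem bilin {E : Type*} [NormedAddCommGroup E] {g : X → E} {β : F → E → H} {c : ℝ} (hc : 0 ≤ c)
    (h1 : ∀ x x' y, β (x - x') y = β x y - β x' y) (h2 : ∀ x y y', β x (y - y') = β x y - β x y')
    (hb : ∀ x y, ‖β x y‖ ≤ c * ‖x‖ * ‖y‖) (hC : 0 ≤ C) (hf : BddLip s C D f)
    (hg : BddLip s C' D' g) :
    BddLip s (c * C * C') (c * (D * C' + C * D')) (fun y => β (f y) (g y)) := by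
  refine ⟨fun y hy => (hb _ _).trans ?_, fun y hy y' hy' => ?_⟩
  · have := hf.1 y hy
    have := hg.1 y hy
    gcongr
  · have e : β (f y) (g y) - β (f y') (g y') = β (f y - f y') (g y) + β (f y') (g y - g y') := by
      rw [h1, h2]; abel
    have a1 := hf.2 y hy y' hy'
    have a2 := hg.2 y hy y' hy'
    have a3 := hg.1 y hy
    have a4 := hf.1 y' hy'
    rw [e]
    calc _ ≤ c * ‖f y - f y'‖ * ‖g y‖ + c * ‖f y'‖ * ‖g y - g y'‖ :=
          (norm_add_le _ _).trans (add_le_add (hb _ _) (hb _ _))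
      _ ≤ c * (D * ‖y - y'‖) * C' + c * C * (D' * ‖y - y'‖) := by
          have : 0 ≤ D * ‖y - y'‖ := (norm_nonneg _).trans a1
          gcongr
      _ = _ := by ring

end BddLip

section QuadSum

variable {β γ F : Type*} [Fintype β] [Fintype γ] [NormedAddCommGroup F] [NormedSpace ℝ F]

/-- The bilinear map with coefficients `K`. -/
def bilinSum (K : β → γ → F) (u : β → ℝ) (w : γ → ℝ) : F := ∑ b, ∑ c, (u b * w c) • K b c

/-- The linear map with coefficients `l`. -/
def linSum (l : β → F) (u : β → ℝ) : F := ∑ b, u b • l b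

theorem linSum_sub (l : β → F) (u v : β → ℝ) : linSum l (u - v) = linSum l u - linSum l v := by
  simp [linSum, sub_smul, Finset.sum_sub_distrib]

theorem norm_linSum_le {l : β → F} {c : ℝ} (hl : ∀ b, ‖l b‖ ≤ c) (u : β → ℝ) :
    ‖linSum l u‖ ≤ (Fintype.card β * c) * ‖u‖ := by
  refine (norm_sum_le _ _).trans ?_
  calc _ ≤ ∑ _b : β, ‖u‖ * c := Finset.sum_le_sum fun b _ => by
        rw [norm_smul]
        have := norm_le_pi_norm u b
        have := hl b
        gcongr
    _ = _ := by rw [Finset.sum_const, nsmul_eq_mul, Finset.card_univ]; ring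

theorem bilinSum_sub_left (K : β → γ → F) (u u' : β → ℝ) (w : γ → ℝ) :
    bilinSum K (u - u') w = bilinSum K u w - bilinSum K u' w := by
  simp [bilinSum, sub_mul, sub_smul, Finset.sum_sub_distrib]

theorem bilinSum_sub_right (K : β → γ → F) (u : β → ℝ) (w w' : γ → ℝ) :
    bilinSum K u (w - w') = bilinSum K u w - bilinSum K u w' := by
  simp [bilinSum, mul_sub, sub_smul, Finset.sum_sub_distrib]

theorem norm_bilinSum_le {K : β → γ → F} {c : ℝ} (hK : ∀ b b', ‖K b b'‖ ≤ c) (u : β → ℝ)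
    (w : γ → ℝ) :
    ‖bilinSum K u w‖ ≤ (Fintype.card β * Fintype.card γ * c) * ‖u‖ * ‖w‖ := by
  refine (norm_sum_le _ _).trans ?_
  calc _ ≤ ∑ _b : β, ∑ _c : γ, ‖u‖ * ‖w‖ * c := Finset.sum_le_sum fun b _ =>
        (norm_sum_le _ _).trans <| Finset.sum_le_sum fun b' _ => by
          rw [norm_smul, norm_mul]
          have := norm_le_pi_norm u b
          have := norm_le_pi_norm w b'
          have := hK b b'
          gcongr
    _ = _ := by
        rw [Finset.sum_const, Finset.sum_const, nsmul_eq_mul, nsmul_eq_mul, Finset.card_univ,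
          Finset.card_univ]; ring

theorem bilinSum_smul (K : β → γ → F) (r r' : ℝ) (u : β → ℝ) (w : γ → ℝ) :
    bilinSum K (r • u) (r' • w) = (r * r') • bilinSum K u w := by
  simp only [bilinSum, Finset.smul_sum, smul_smul, Pi.smul_apply, smul_eq_mul]
  refine Finset.sum_congr rfl fun b _ => Finset.sum_congr rfl fun c _ => ?_
  congr 1; ring

variable {X : Type*} [NormedAddCommGroup X] {s : Set X} {C D C' D' c : ℝ}

theorem BddLip.linSum {l : β → F} (hc : 0 ≤ c) (hl : ∀ b, ‖l b‖ ≤ c) {u : X → β → ℝ}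
    (hu : BddLip s C D u) :
    BddLip s (Fintype.card β * c * C) (Fintype.card β * c * D) (fun y => linSum l (u y)) :=
  hu.comp_bounded (by positivity) (linSum_sub l) (norm_linSum_le hl)

theorem BddLip.bilinSum {K : β → γ → F} (hc : 0 ≤ c) (hK : ∀ b b', ‖K b b'‖ ≤ c)
    {u : X → β → ℝ} {w : X → γ → ℝ} (hC : 0 ≤ C) (hu : BddLip s C D u) (hw : BddLip s C' D' w) :
    BddLip s (Fintype.card β * Fintype.card γ * c * C * C')
      (Fintype.card β * Fintype.card γ * c * (D * C' + C * D')) (fun y => bilinSum K (u y) (w y)) :=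
  BddLip.bilin (by positivity) (bilinSum_sub_left K) (bilinSum_sub_right K) (norm_bilinSum_le hK)
    hC hu hw

end QuadSum

end QuadraticSurjection

/-! ### Removing the first order term by repeated copies -/

section QuadraticSurjection

/-- More vectors than the dimension are linearly dependent; normalize the relation. It is used to
combine copies of a control so that their first order terms cancel exactly and not just
approximately. -/
theorem exists_unit_mem_ker {ν F : Type*} [Fintype ν] [NormedAddCommGroup F] [NormedSpace ℝ F]
    [FiniteDimensional ℝ F] (h : Module.finrank ℝ F < Fintype.card ν) (l : ν → F) :
    ∃ c : ν → ℝ, ∑ n, c n ^ 2 = 1 ∧ ∑ n, c n • l n = 0 := by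
  let f : (ν → ℝ) →ₗ[ℝ] F := Fintype.linearCombination ℝ l
  have hker : LinearMap.ker f ≠ ⊥ := LinearMap.ker_ne_bot_of_finrank_lt (by simpa using h)
  obtain ⟨c, hc, hc0⟩ := (Submodule.ne_bot_iff _).1 hker
  have hs : 0 < ∑ n, c n ^ 2 := by
    obtain ⟨n, hn⟩ := Function.ne_iff.1 hc0
    exact Finset.sum_pos' (fun _ _ => sq_nonneg _)
      ⟨n, Finset.mem_univ _, by have : c n ≠ 0 := hn; positivity⟩
  refine ⟨fun n => (√(∑ n, c n ^ 2))⁻¹ * c n, ?_, ?_⟩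
  · simp only [mul_pow, ← Finset.mul_sum, inv_pow]
    rw [Real.sq_sqrt hs.le, inv_mul_cancel₀ hs.ne']
  · simp only [mul_smul, ← Finset.smul_sum]
    have : ∑ n, c n • l n = 0 := by simpa [f, Fintype.linearCombination_apply] using hc
    rw [this, smul_zero]

variable {F ι ν : Type*} [NormedAddCommGroup F] [NormedSpace ℝ F]

/-- The coefficients `x_i c_{i,n}`. -/
def coefMul (c : ι → ν → ℝ) (x : ι → ℝ) : ι × ν → ℝ := fun b => x b.1 * c b.1 b.2

theorem norm_coefMul_le [Fintype ι] [Fintype ν] {c : ι → ν → ℝ} (hc : ∀ i n, |c i n| ≤ 1) (x : ι → ℝ) :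
    ‖coefMul c x‖ ≤ ‖x‖ := by
  refine (pi_norm_le_iff_of_nonneg (norm_nonneg _)).2 fun b => ?_
  rw [coefMul, norm_mul]
  calc _ ≤ ‖x‖ * 1 := by gcongr; exacts [norm_le_pi_norm x _, hc _ _]
    _ = _ := mul_one _

theorem coefMul_sub (c : ι → ν → ℝ) (x x' : ι → ℝ) :
    coefMul c (x - x') = coefMul c x - coefMul c x' := by
  ext b; simp [coefMul, sub_mul]

/-- Since each c_i is a unit vector, the copies leave no trace in a diagonal quadratic form:
whichever vectors cancel the linear part, the quadratic part is the same. -/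
theorem bilinSum_coefMul_diag [Fintype ι] [Fintype ν] [DecidableEq ι] [DecidableEq ν] {c : ι → ν → ℝ} (hc : ∀ i, ∑ n, c i n ^ 2 = 1) (e : ι → F)
    (x : ι → ℝ) :
    bilinSum (fun b b' : ι × ν => if b = b' then e b.1 else 0) (coefMul c x) (coefMul c x)
      = ∑ i, (x i ^ 2) • e i := by
  simp only [bilinSum, smul_ite, smul_zero, Finset.sum_ite_eq, Finset.mem_univ, if_true,
    Fintype.sum_prod_type, coefMul]
  refine Finset.sum_congr rfl fun i _ => ?_
  rw [← Finset.sum_smul]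
  congr 1
  calc _ = x i ^ 2 * ∑ n, c i n ^ 2 := by
        rw [Finset.mul_sum]; exact Finset.sum_congr rfl fun n _ => by ring
    _ = _ := by rw [hc, mul_one]

theorem bilinSum_diag [Fintype ι] [DecidableEq ι] (e : ι → F) (x : ι → ℝ) :
    bilinSum (fun i i' : ι => if i = i' then e i else 0) x x = ∑ i, (x i ^ 2) • e i := by
  simp [bilinSum, sq]

end QuadraticSurjection

/-! ### Covering a neighbourhood of 0 by a degenerate quadratic map -/

section QuadraticSurjection

variable {F ι ν J : Type*} [NormedAddCommGroup F] [NormedSpace ℝ F]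
  [Fintype ι] [Fintype ν] [Fintype J]

theorem linSum_elim (l : (ι × ν) ⊕ J → F) (u : ι × ν → ℝ) (w : J → ℝ) :
    linSum l (Sum.elim u w)
      = linSum (fun b => l (Sum.inl b)) u + linSum (fun j => l (Sum.inr j)) w := by
  simp [linSum, Fintype.sum_sum_type]

theorem bilinSum_elim_zero (K : (ι × ν) ⊕ J → (ι × ν) ⊕ J → F) (u : ι × ν → ℝ) :
    bilinSum K (Sum.elim u 0) (Sum.elim u 0)
      = bilinSum (fun b b' => K (Sum.inl b) (Sum.inl b')) u u := by
  simp [bilinSum, Fintype.sum_sum_type]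

/-- With the correction w at scale r², only K(u,u) survives at order r²; every term containing w
gains a factor r. -/
theorem bilinSum_add_smul (K : (ι × ν) ⊕ J → (ι × ν) ⊕ J → F) (r : ℝ) (u w : (ι × ν) ⊕ J → ℝ) :
    bilinSum K (r • u + r ^ 2 • w) (r • u + r ^ 2 • w) = r ^ 2 • (bilinSum K u u
      + (r • bilinSum K u w + r • bilinSum K w u + r ^ 2 • bilinSum K w w)) := by
  have h1 : ∀ a b c : (ι × ν) ⊕ J → ℝ, bilinSum K (a + b) c = bilinSum K a c + bilinSum K b c := by
    intro a b c; simp [bilinSum, add_mul, add_smul, Finset.sum_add_distrib]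
  have h2 : ∀ a b c : (ι × ν) ⊕ J → ℝ, bilinSum K a (b + c) = bilinSum K a b + bilinSum K a c := by
    intro a b c; simp [bilinSum, mul_add, add_smul, Finset.sum_add_distrib]
  simp only [h1, h2, bilinSum_smul, smul_add, smul_smul]
  rw [show r * r = r ^ 2 by ring, show r * r ^ 2 = r ^ 2 * r by ring,
    show r ^ 2 * r ^ 2 = r ^ 2 * r ^ 2 by ring]
  abel

theorem bilinSum_sub_coef {β : Type*} [Fintype β] (K K' : β → β → F) (u w : β → ℝ) :
    bilinSum (fun b c => K b c - K' b c) u w = bilinSum K u w - bilinSum K' u w := by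
  simp [bilinSum, smul_sub, Finset.sum_sub_distrib]

theorem linSum_sub_coef {β : Type*} [Fintype β] (l l' : β → F) (u : β → ℝ) :
    linSum (fun b => l b - l' b) u = linSum l u - linSum l' u := by
  simp [linSum, smul_sub, Finset.sum_sub_distrib]

theorem map_bilinSum {β : Type*} [Fintype β] {H : Type*} [NormedAddCommGroup H] [NormedSpace ℝ H]
    (φ : F →L[ℝ] H) (K : β → β → F) (u w : β → ℝ) :
    φ (bilinSum K u w) = bilinSum (fun b c => φ (K b c)) u w := by
  simp [bilinSum, map_sum]

theorem exists_pos_mul_le_three {p q u v w : ℝ} (hp : 0 < p) (hq : 0 < q) (hu : 0 ≤ u) (hv : 0 ≤ v)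
    (hw : 0 ≤ w) : ∃ x > (0 : ℝ), u * x ≤ 1 ∧ v * x ≤ p ∧ w * x ≤ q := by
  have hu' : 0 < u + 1 := by positivity
  have hv' : 0 < v + 1 := by positivity
  have hw' : 0 < w + 1 := by positivity
  refine ⟨min (1 / (u + 1)) (min (p / (v + 1)) (q / (w + 1))), by positivity, ?_, ?_, ?_⟩
  · calc _ ≤ (u + 1) * (1 / (u + 1)) := by gcongr; exacts [by linarith, min_le_left _ _]
      _ = _ := by field_simp
  · calc _ ≤ (v + 1) * (p / (v + 1)) := by
          gcongr; exacts [by linarith, (min_le_right _ _).trans (min_le_left _ _)]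
      _ = _ := by field_simp
  · calc _ ≤ (w + 1) * (q / (w + 1)) := by
          gcongr; exacts [by linarith, (min_le_right _ _).trans (min_le_right _ _)]
      _ = _ := by field_simp

/-- The fixed point argument behind `exists_quadratic_preimage`, with explicit constants. -/
theorem exists_quadratic_preimage_aux [DecidableEq ι] [DecidableEq ν] [FiniteDimensional ℝ F]
    (hν : Module.finrank ℝ F < Fintype.card ν) (e : ι → F) (he : ∑ i, e i = 0) (l0 : J → F)
    (π : F →L[ℝ] F) (a : F →L[ℝ] (ι → ℝ)) (m m' : F →L[ℝ] (J → ℝ))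
    (h1 : ∀ y, (2 : ℝ) • ∑ i, a y i • e i + linSum l0 (m y) = y)
    (h2 : ∀ y, linSum l0 (m' y) = y - π y) (q : F →L[ℝ] F →L[ℝ] F)
    {E ρ η₀ B η Ω Λ D c1 c2 c3 c4 ε α n0 n1 nJ nβ : ℝ} (hα : ‖a‖ = α) (hα0 : 0 ≤ α)
    (hn0 : (Fintype.card ι : ℝ) = n0) (hn1 : (Fintype.card (ι × ν) : ℝ) = n1)
    (hnJ : (Fintype.card J : ℝ) = nJ) (hnβ : (Fintype.card ((ι × ν) ⊕ J) : ℝ) = nβ)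
    (hn1' : 0 ≤ n1) (hnJ' : 0 ≤ nJ) (hnβ' : 0 ≤ nβ)
    (hE0 : 0 ≤ E) (hE : ∀ i, ‖e i‖ ≤ E)
    (hρ0 : 0 < ρ) (hρ1 : ρ ≤ 1) (hαρ : α * ρ ≤ 1) (hEρ : n0 * n0 * E * α ^ 2 * ρ ≤ 1 / 16)
    (hη₀0 : 0 ≤ η₀) (hη₀1 : n1 * n1 * η₀ * 2 * 2 ≤ ρ / 16)
    (hη₀2 : n1 * n1 * η₀ * (α * 2 + 2 * α) ≤ 1 / 8)
    (hB : 0 < B) (hΩ : ‖m‖ + ‖m'‖ * (n1 * n1 * B * 2 * 2) = Ω)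
    (hΛ : ‖m‖ + ‖m'‖ * (n1 * n1 * B * (α * 2 + 2 * α)) = Λ)
    (hη0 : 0 ≤ η) (hη1 : nJ * η * Ω + n1 * n1 * η * 2 * 2 ≤ ρ / 16)
    (hη2 : nJ * η * Λ + n1 * n1 * η * (α * 2 + 2 * α) ≤ 1 / 8)
    (hD0 : 0 < D) (hD2 : 2 ≤ D) (hDΩ : Ω ≤ D) (hDα : α ≤ D) (hDΛ : Λ ≤ D)
    (hc1 : c1 = 2 * (nβ * nβ * B * D * D)) (hc2 : c2 = nJ * B * D)
    (hc3 : c3 = ‖q‖ * (2 * (c2 * c2))) (hc4 : c4 = B * (2 * D) ^ 3)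
    (hεpos : 0 < ε) (hε1 : ε ≤ 1) (hεc : 3 * (ε * c1) + ε * c3 + ε * c4 ≤ ρ / 16)
    (hrB : ε * (2 * D) * B ≤ 1)
    (l : (ι × ν) ⊕ J → F) (K0 : ι × ν → ι × ν → F) (K : (ι × ν) ⊕ J → (ι × ν) ⊕ J → F)
    (R : ((ι × ν) ⊕ J → ℝ) → F)
    (hπ : ∀ b b', ‖π (K0 b b') - if b = b' then e b.1 else 0‖ ≤ η₀)
    (hK0 : ∀ b b', ‖K0 b b'‖ ≤ B) (hK : ∀ b b', ‖K b b'‖ ≤ B) (hl : ∀ b, ‖l b‖ ≤ B)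
    (hl0 : ∀ j, ‖l (Sum.inr j) - l0 j‖ ≤ η)
    (hKK : ∀ b b', ‖K (Sum.inl b) (Sum.inl b') - K0 b b'‖ ≤ η) (R0 : R 0 = 0)
    (hR : ∀ r ≥ (0 : ℝ), r * B ≤ 1 → ∀ u w, ‖u‖ ≤ r → ‖w‖ ≤ r →
      ‖R u - R w‖ ≤ B * r ^ 2 * ‖u - w‖)
    (y₁ : F) (hεsq : ε ^ 2 * (ρ / 4) = ‖y₁‖) :
    ∃ ξ : (ι × ν) ⊕ J → ℝ, ‖ξ‖ ≤ ε * (2 * D) ∧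
      linSum l ξ + bilinSum K ξ ξ + q (linSum l ξ) (linSum l ξ) + R ξ = y₁ := by
  have hx1 : 0 ≤ α * ρ := by positivity
  have hc1' : 0 ≤ c1 := by rw [hc1]; positivity
  have hc2' : 0 ≤ c2 := by rw [hc2]; positivity
  have hc3' : 0 ≤ c3 := by rw [hc3]; positivity
  have hc4' : 0 ≤ c4 := by rw [hc4]; positivity
  have hΩ0 : 0 ≤ Ω := by rw [← hΩ]; positivity
  have hεε2 : ε ^ 2 ≤ ε := by rw [sq]; exact mul_le_of_le_one_left hεpos.le hε1
  -- These vectors depend on l without any regularity. That is harmless, because l stays fixed while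
  -- the equation is solved.
  choose c hc1s hcker using fun i => exists_unit_mem_ker hν fun n => l (Sum.inl (i, n))
  have hcle : ∀ i n, |c i n| ≤ 1 := fun i n => by
    rw [← sq_le_one_iff_abs_le_one, ← hc1s i]
    exact Finset.single_le_sum (f := fun n => c i n ^ 2) (fun _ _ => sq_nonneg _)
      (Finset.mem_univ n)
  set s := Metric.closedBall (0 : F) ρ with hs
  -- the building blocks
  have hV : BddLip s 2 α (fun y => coefMul c (fun i => 1 + a y i)) := by
    have hx : BddLip s 2 α (fun y => (fun i => 1 + a y i : ι → ℝ)) := by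
      refine ⟨fun y hy => ?_, fun y hy y' hy' => ?_⟩
      · have hy' : ‖y‖ ≤ ρ := by simpa [hs] using hy
        refine (pi_norm_le_iff_of_nonneg (by norm_num)).2 fun i => ?_
        have b1 : ‖a y i‖ ≤ α * ρ := (norm_le_pi_norm (a y) i).trans
          ((a.le_opNorm y).trans (by rw [hα]; gcongr))
        refine (norm_add_le _ _).trans ?_
        rw [norm_one]; linarith only [b1, hαρ]
      · have : (fun i => 1 + a y i : ι → ℝ) - (fun i => 1 + a y' i) = a (y - y') := by
          ext i; simp
        rw [this, ← hα]; exact a.le_opNorm _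
    simpa using hx.comp_bounded (φ := coefMul c) (c := 1) zero_le_one (coefMul_sub c)
      (fun x => by simpa using norm_coefMul_le hcle x)
  -- Start from the zero (1,…,1) of ∑ x_i² e_i and move it by a(y).
  set V : F → ι × ν → ℝ := fun y => coefMul c (fun i => 1 + a y i) with hVdef
  have hid : BddLip s 1 1 (fun y : F => y) :=
    ⟨fun y hy => by have : ‖y‖ ≤ ρ := by simpa [hs] using hy
                    linarith only [this, hρ1], fun y _ y' _ => by simp⟩
  have hQ0 : BddLip s _ _ (fun y => bilinSum K0 (V y) (V y)) :=
    BddLip.bilinSum hB.le hK0 (by norm_num) hV hV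
  have hσ : BddLip s Ω Λ (fun y => m y - m' (bilinSum K0 (V y) (V y))) := by
    have b1 := hid.comp_bounded (norm_nonneg m) (map_sub m) m.le_opNorm
    have b2 := hQ0.comp_bounded (norm_nonneg m') (map_sub m') m'.le_opNorm
    exact (b1.sub b2).mono (by rw [← hΩ, mul_one, hn1]) (by rw [← hΛ, mul_one, hn1])
  -- The first order controls supply the part of y not produced by 2∑ a_i e_i, and they cancel (1 -
  -- π)K0(V,V), the part of the second order term lying in their own range.
  set σ : F → J → ℝ := fun y => m y - m' (bilinSum K0 (V y) (V y)) with hsdef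
  -- the three main error terms
  have T1 : BddLip s (ρ / 16) (1 / 8)
      (fun y => linSum (fun j => l (Sum.inr j) - l0 j) (σ y)
        + bilinSum (fun b b' => K (Sum.inl b) (Sum.inl b') - K0 b b') (V y) (V y)) := by
    refine ((BddLip.linSum hη0 hl0 hσ).add (BddLip.bilinSum hη0 hKK (by norm_num)
      hV hV)).mono ?_ ?_
    · rw [hnJ, hn1]; exact hη1
    · rw [hnJ, hn1]; exact hη2
  have T2 : BddLip s (ρ / 16) (1 / 8)
      (fun y => bilinSum (fun b b' => π (K0 b b') - if b = b' then e b.1 else 0) (V y) (V y)) := by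
    refine (BddLip.bilinSum hη₀0 hπ (by norm_num) hV hV).mono ?_ ?_
    · rw [hn1]; exact hη₀1
    · rw [hn1]; exact hη₀2
  -- This is the term ∑ a_i(y)² e_i left over from (1 + a_i)². It is quadratic in y, so a small
  -- radius ρ controls it.
  have T3 : BddLip s (ρ / 16) (1 / 8)
      (fun y => bilinSum (fun i i' : ι => if i = i' then e i else 0) (a y) (a y)) := by
    have ha : BddLip s (α * ρ) α (fun y => a y) :=
      ⟨fun y hy => (a.le_opNorm y).trans (by
        have : ‖y‖ ≤ ρ := by simpa [hs] using hy
        rw [hα]; gcongr), fun y _ y' _ => by rw [← map_sub, ← hα]; exact a.le_opNorm _⟩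
    refine (BddLip.bilinSum (c := E) hE0 (fun i i' => ?_) hx1 ha ha).mono ?_ ?_
    · split_ifs
      · exact hE i
      · simpa using hE0
    · rw [hn0]
      calc _ = (n0 * n0 * E * α ^ 2 * ρ) * ρ := by ring
        _ ≤ 1 / 16 * ρ := by gcongr
        _ = _ := by ring
    · rw [hn0]
      calc _ = 2 * (n0 * n0 * E * α ^ 2 * ρ) := by ring
        _ ≤ _ := by linarith only [hEρ]
  -- the higher order terms
  set A : F → (ι × ν) ⊕ J → ℝ := fun y => Sum.elim (V y) 0 with hAdef
  set W : F → (ι × ν) ⊕ J → ℝ := fun y => Sum.elim 0 (σ y) with hWdef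
  have hA : BddLip s D D A := by
    have := hV.comp_bounded (φ := fun v : ι × ν → ℝ => (Sum.elim v 0 : (ι × ν) ⊕ J → ℝ))
      (c := 1) zero_le_one (fun x y => by ext (b | b) <;> simp) (fun x => by
        rw [one_mul]
        refine (pi_norm_le_iff_of_nonneg (norm_nonneg _)).2 ?_
        rintro (b | b)
        · exact norm_le_pi_norm x b
        · simp)
    exact this.mono (by rwa [one_mul]) (by rwa [one_mul])
  have hW : BddLip s D D W := by
    have := hσ.comp_bounded (φ := fun v : J → ℝ => (Sum.elim 0 v : (ι × ν) ⊕ J → ℝ))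
      (c := 1) zero_le_one (fun x y => by ext (b | b) <;> simp) (fun x => by
        rw [one_mul]
        refine (pi_norm_le_iff_of_nonneg (norm_nonneg _)).2 ?_
        rintro (b | b)
        · simp
        · exact norm_le_pi_norm x b)
    exact this.mono (by rwa [one_mul]) (by rwa [one_mul])
  have hc1le : nβ * nβ * B * D * D ≤ c1 := by
    have : 0 ≤ nβ * nβ * B * D * D := by positivity
    rw [hc1]; linarith only [this]
  have hbil : ∀ {u w : F → (ι × ν) ⊕ J → ℝ}, BddLip s D D u → BddLip s D D w →
      BddLip s c1 c1 (fun y => bilinSum K (u y) (w y)) := fun hu hw =>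
    (BddLip.bilinSum hB.le hK hD0.le hu hw).mono (by rw [hnβ]; exact hc1le) (le_of_eq (by rw [hc1, hnβ]; ring))
  have hεabs : |ε| = ε := abs_of_pos hεpos
  have T4a : BddLip s (ε * c1 + ε * c1 + ε ^ 2 * c1) (ε * c1 + ε * c1 + ε ^ 2 * c1)
      (fun y => ε • bilinSum K (A y) (W y) + ε • bilinSum K (W y) (A y)
        + ε ^ 2 • bilinSum K (W y) (W y)) := by
    have b1 := (hbil hA hW).smul ε
    have b2 := (hbil hW hA).smul ε
    have b3 := (hbil hW hW).smul (ε ^ 2)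
    rw [hεabs] at b1 b2
    rw [abs_of_nonneg (sq_nonneg ε)] at b3
    exact (b1.add b2).add b3
  have T4b : BddLip s (ε ^ 2 * c3) (ε ^ 2 * c3)
      (fun y => ε ^ 2 • q (linSum (fun j => l (Sum.inr j)) (σ y))
        (linSum (fun j => l (Sum.inr j)) (σ y))) := by
    have b0 : BddLip s c2 c2 (fun y => linSum (fun j => l (Sum.inr j)) (σ y)) :=
      (BddLip.linSum hB.le (fun j => hl (Sum.inr j)) hσ).mono
        (by rw [hc2, hnJ]; gcongr) (by rw [hc2, hnJ]; gcongr)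
    have b1 := (BddLip.bilin (β := fun x y => q x y) (norm_nonneg q) (fun x x' y => by simp)
      (fun x y y' => by simp) (fun x y => q.le_opNorm₂ x y) hc2' b0 b0).smul (ε ^ 2)
    rw [abs_of_nonneg (sq_nonneg ε)] at b1
    refine b1.mono ?_ (le_of_eq (by rw [hc3]; ring))
    rw [hc3]
    have : 0 ≤ ‖q‖ * c2 * c2 := by positivity
    refine mul_le_mul_of_nonneg_left ?_ (sq_nonneg ε)
    linarith only [this]
  set ξ : F → (ι × ν) ⊕ J → ℝ := fun y => ε • A y + ε ^ 2 • W y with hξdef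
  have hξ : BddLip s (ε * (2 * D)) (ε * (2 * D)) ξ := by
    have b1 := hA.smul ε
    have b2 := hW.smul (ε ^ 2)
    rw [hεabs] at b1
    rw [abs_of_nonneg (sq_nonneg ε)] at b2
    have : ε ^ 2 * D ≤ ε * D := by gcongr
    exact (b1.add b2).mono (by linarith only [this]) (by linarith only [this])
  -- R is cubic and ξ has size ε, so division by ε² still leaves a factor ε.
  have T4c : BddLip s (ε * c4) (ε * c4) (fun y => (ε ^ 2)⁻¹ • R (ξ y)) := by
    have hr0 : 0 ≤ ε * (2 * D) := by positivity
    have hinv : ‖(ε ^ 2)⁻¹‖ = (ε ^ 2)⁻¹ := by rw [norm_inv, norm_pow, Real.norm_eq_abs, hεabs]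
    refine ⟨fun y hy => ?_, fun y hy y' hy' => ?_⟩
    · have b1 := hR _ hr0 hrB (ξ y) 0 (hξ.1 y hy) (by simpa using hr0)
      rw [R0, sub_zero, sub_zero] at b1
      rw [norm_smul, hinv]
      calc _ ≤ (ε ^ 2)⁻¹ * (B * (ε * (2 * D)) ^ 2 * (ε * (2 * D))) := by
            gcongr; exact b1.trans (by gcongr; exact hξ.1 y hy)
        _ = _ := by rw [hc4]; field_simp
    · have b1 := hR _ hr0 hrB (ξ y) (ξ y') (hξ.1 y hy) (hξ.1 y' hy')
      rw [← smul_sub, norm_smul, hinv]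
      calc _ ≤ (ε ^ 2)⁻¹ * (B * (ε * (2 * D)) ^ 2 * (ε * (2 * D) * ‖y - y'‖)) := by
            gcongr; exact b1.trans (by gcongr; exact hξ.2 y hy y' hy')
        _ = _ := by rw [hc4]; field_simp
  have T4 := (T4a.add T4b).add T4c
  have htot := ((T1.add T2).add T3).add T4
  -- G is the whole expression at ξ(y) divided by ε². All errors above are bounded by ρ/16 and are
  -- 1/8-Lipschitz; the four together give ρ/4 and 1/2.
  set G : F → F := fun y => linSum (fun j => l (Sum.inr j)) (σ y)
    + bilinSum (fun b b' => K (Sum.inl b) (Sum.inl b')) (V y) (V y)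
    + (ε • bilinSum K (A y) (W y) + ε • bilinSum K (W y) (A y) + ε ^ 2 • bilinSum K (W y) (W y)
      + ε ^ 2 • q (linSum (fun j => l (Sum.inr j)) (σ y)) (linSum (fun j => l (Sum.inr j)) (σ y))
      + (ε ^ 2)⁻¹ • R (ξ y)) with hG
  have key : ∀ y, G y - y = linSum (fun j => l (Sum.inr j) - l0 j) (σ y)
        + bilinSum (fun b b' => K (Sum.inl b) (Sum.inl b') - K0 b b') (V y) (V y)
      + bilinSum (fun b b' => π (K0 b b') - if b = b' then e b.1 else 0) (V y) (V y)
      + bilinSum (fun i i' : ι => if i = i' then e i else 0) (a y) (a y)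
      + (ε • bilinSum K (A y) (W y) + ε • bilinSum K (W y) (A y) + ε ^ 2 • bilinSum K (W y) (W y)
      + ε ^ 2 • q (linSum (fun j => l (Sum.inr j)) (σ y)) (linSum (fun j => l (Sum.inr j)) (σ y))
      + (ε ^ 2)⁻¹ • R (ξ y)) := by
    intro y
    have k1 : linSum l0 (σ y) = (y - (2 : ℝ) • ∑ i, a y i • e i)
        - (bilinSum K0 (V y) (V y) - π (bilinSum K0 (V y) (V y))) := by
      rw [hsdef, linSum_sub, h2]
      congr 1
      exact eq_sub_of_add_eq' (h1 y)
    -- Here ∑ e_i = 0 removes the constant term of ∑ (1 + a_i)² e_i. The linear term cancels against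
    -- the one in `k1`.
    have k2 : bilinSum (fun b b' : ι × ν => if b = b' then e b.1 else 0) (V y) (V y)
        = (2 : ℝ) • ∑ i, a y i • e i + ∑ i, (a y i ^ 2) • e i := by
      have : ∀ i, (1 + a y i) ^ 2 • e i = e i + ((2 : ℝ) • a y i • e i + (a y i ^ 2) • e i) :=
        fun i => by module
      rw [hVdef, bilinSum_coefMul_diag hc1s, Finset.sum_congr rfl fun i _ => this i,
        Finset.sum_add_distrib, he, zero_add, Finset.sum_add_distrib, Finset.smul_sum]
    rw [linSum_sub_coef, bilinSum_sub_coef, bilinSum_sub_coef, k1, ← map_bilinSum, k2,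
      bilinSum_diag]
    simp only [hG]
    generalize (ε ^ 2)⁻¹ • R (ξ y) = X
    module
  have htot' : BddLip s (ρ / 4) (1 / 2) (fun y => G y - y) := by
    have := htot.mono (C' := ρ / 4) (D' := 1 / 2) ?_ ?_
    · refine ⟨fun y hy => ?_, fun y hy y' hy' => ?_⟩
      · simp only [key]; exact this.1 y hy
      · simp only [key]; exact this.2 y hy y' hy'
    all_goals
      have b2 : ε ^ 2 * c1 ≤ ε * c1 := by gcongr
      have b3 : ε ^ 2 * c3 ≤ ε * c3 := by gcongr
      linarith only [b2, b3, hεc, hρ1]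
  have : CompleteSpace F := FiniteDimensional.complete ℝ F
  have h0s : (0 : F) ∈ s := by simp [hs, hρ0.le]
  obtain ⟨y, hy, hGy⟩ := surj_of_lipschitz_perturbation (G := G) (w := (ε ^ 2)⁻¹ • y₁) hρ0.le
    (by simpa using htot'.1 0 h0s) htot'.2 (by
      rw [norm_smul, norm_inv, norm_pow, Real.norm_eq_abs, hεabs, ← hεsq]
      refine le_of_eq ?_; field_simp)
  have hys : y ∈ s := by simpa [hs] using hy
  refine ⟨ξ y, hξ.1 y hys, ?_⟩
  -- The choice of c leaves no term of order ε, so division by ε² was legitimate.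
  have hker : linSum (fun b => l (Sum.inl b)) (V y) = 0 := by
    simp only [linSum, Fintype.sum_prod_type, hVdef, coefMul, mul_smul, ← Finset.smul_sum, hcker,
      smul_zero, Finset.sum_const_zero]
  have hlin : linSum l (ξ y) = ε ^ 2 • linSum (fun j => l (Sum.inr j)) (σ y) := by
    have : ξ y = Sum.elim (ε • V y) (ε ^ 2 • σ y) := by
      ext (b | b) <;> simp [hξdef, hAdef, hWdef]
    rw [this, linSum_elim]
    have h3 : ∀ {β : Type _} [Fintype β] (l : β → F) (r : ℝ) (u : β → ℝ),
        linSum l (r • u) = r • linSum l u := by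
      intro β _ l r u; simp [linSum, Finset.smul_sum, smul_smul]
    rw [h3, hker, smul_zero, zero_add]
    simp [linSum, Finset.smul_sum, smul_smul]
  have hfin : linSum l (ξ y) + bilinSum K (ξ y) (ξ y) + q (linSum l (ξ y)) (linSum l (ξ y)) + R (ξ y)
      = ε ^ 2 • G y := by
    rw [hlin, show bilinSum K (ξ y) (ξ y) = _ from bilinSum_add_smul K ε (A y) (W y),
      show bilinSum K (A y) (A y) = _ from bilinSum_elim_zero K (V y)]
    simp only [hG, map_smul, smul_apply, smul_add]
    rw [smul_smul (ε ^ 2) (ε ^ 2)⁻¹, mul_inv_cancel₀ (by positivity), one_smul]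
    abel
  rw [hfin, hGy, smul_smul, mul_inv_cancel₀ (by positivity), one_smul]

/-- A quadratic map that is, up to small errors, diagonal modulo the range of its linear part with
diagonal values `e_i` of sum zero covers a neighbourhood of `0`, with a square root bound. -/
theorem exists_quadratic_preimage [DecidableEq ι] [DecidableEq ν] [FiniteDimensional ℝ F]
    (hν : Module.finrank ℝ F < Fintype.card ν) (e : ι → F) (he : ∑ i, e i = 0) (l0 : J → F)
    (π : F →L[ℝ] F) (a : F →L[ℝ] (ι → ℝ)) (m m' : F →L[ℝ] (J → ℝ))
    (h1 : ∀ y, (2 : ℝ) • ∑ i, a y i • e i + linSum l0 (m y) = y)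
    (h2 : ∀ y, linSum l0 (m' y) = y - π y) (q : F →L[ℝ] F →L[ℝ] F) :
    ∃ η₀ > (0 : ℝ), ∀ B > (0 : ℝ), ∃ η > (0 : ℝ), ∃ μ > (0 : ℝ), ∃ C > (0 : ℝ),
      ∀ (l : (ι × ν) ⊕ J → F) (K0 : ι × ν → ι × ν → F) (K : (ι × ν) ⊕ J → (ι × ν) ⊕ J → F)
        (R : ((ι × ν) ⊕ J → ℝ) → F),
        (∀ b b', ‖π (K0 b b') - if b = b' then e b.1 else 0‖ ≤ η₀) →
        (∀ b b', ‖K0 b b'‖ ≤ B) → (∀ b b', ‖K b b'‖ ≤ B) → (∀ b, ‖l b‖ ≤ B) →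
        (∀ j, ‖l (Sum.inr j) - l0 j‖ ≤ η) →
        (∀ b b', ‖K (Sum.inl b) (Sum.inl b') - K0 b b'‖ ≤ η) →
        R 0 = 0 →
        (∀ r ≥ (0 : ℝ), r * B ≤ 1 → ∀ u w, ‖u‖ ≤ r → ‖w‖ ≤ r →
          ‖R u - R w‖ ≤ B * r ^ 2 * ‖u - w‖) →
        ∀ y : F, ‖y‖ ≤ μ → ∃ ξ : (ι × ν) ⊕ J → ℝ, ‖ξ‖ ≤ C * √‖y‖ ∧
          linSum l ξ + bilinSum K ξ ξ + q (linSum l ξ) (linSum l ξ) + R ξ = y := by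
  obtain ⟨E, hE0, hE⟩ : ∃ E : ℝ, 0 ≤ E ∧ ∀ i, ‖e i‖ ≤ E :=
    ⟨‖e‖, norm_nonneg _, fun i => norm_le_pi_norm e i⟩
  obtain ⟨α, hα⟩ : ∃ x, ‖a‖ = x := ⟨_, rfl⟩
  have hα0 : 0 ≤ α := hα ▸ norm_nonneg _
  obtain ⟨n0, hn0⟩ : ∃ x : ℝ, (Fintype.card ι : ℝ) = x := ⟨_, rfl⟩
  obtain ⟨n1, hn1⟩ : ∃ x : ℝ, (Fintype.card (ι × ν) : ℝ) = x := ⟨_, rfl⟩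
  obtain ⟨nJ, hnJ⟩ : ∃ x : ℝ, (Fintype.card J : ℝ) = x := ⟨_, rfl⟩
  obtain ⟨nβ, hnβ⟩ : ∃ x : ℝ, (Fintype.card ((ι × ν) ⊕ J) : ℝ) = x := ⟨_, rfl⟩
  have hn0' : 0 ≤ n0 := hn0 ▸ Nat.cast_nonneg _
  have hn1' : 0 ≤ n1 := hn1 ▸ Nat.cast_nonneg _
  have hnJ' : 0 ≤ nJ := hnJ ▸ Nat.cast_nonneg _
  have hnβ' : 0 ≤ nβ := hnβ ▸ Nat.cast_nonneg _
  obtain ⟨ρ, hρ0, hρ1, hαρ, hEρ⟩ : ∃ ρ : ℝ, 0 < ρ ∧ ρ ≤ 1 ∧ α * ρ ≤ 1 ∧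
      n0 * n0 * E * α ^ 2 * ρ ≤ 1 / 16 := by
    have h := exists_pos_mul_le_three one_pos (by positivity : (0 : ℝ) < 1 / 16) zero_le_one hα0
      (by positivity : 0 ≤ n0 * n0 * E * α ^ 2)
    obtain ⟨ρ, h0, h1, h2, h3⟩ := h
    exact ⟨ρ, h0, by linarith only [h1], h2, h3⟩
  obtain ⟨η₀, hη₀0, -, hη₀1, hη₀2⟩ := exists_pos_mul_le_three
    (by positivity : 0 < ρ / 16) (by norm_num : (0 : ℝ) < 1 / 8) zero_le_one
    (by positivity : 0 ≤ n1 * n1 * 2 * 2) (by positivity : 0 ≤ n1 * n1 * (α * 2 + 2 * α))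
  -- The diagonal tolerance η₀ must be fixed before B: controls that are diagonal up to η₀ may have
  -- to be very large, and B bounds their integrals.
  refine ⟨η₀, hη₀0, fun B hB => ?_⟩
  obtain ⟨Ω, hΩ⟩ : ∃ x, ‖m‖ + ‖m'‖ * (n1 * n1 * B * 2 * 2) = x := ⟨_, rfl⟩
  obtain ⟨Λ, hΛ⟩ : ∃ x, ‖m‖ + ‖m'‖ * (n1 * n1 * B * (α * 2 + 2 * α)) = x := ⟨_, rfl⟩
  have hΩ0 : 0 ≤ Ω := by rw [← hΩ]; positivity
  have hΛ0 : 0 ≤ Λ := by rw [← hΛ]; positivity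
  obtain ⟨η, hη0, -, hη1, hη2⟩ := exists_pos_mul_le_three
    (by positivity : 0 < ρ / 16) (by norm_num : (0 : ℝ) < 1 / 8) zero_le_one
    (by positivity : 0 ≤ nJ * Ω + n1 * n1 * 2 * 2)
    (by positivity : 0 ≤ nJ * Λ + n1 * n1 * (α * 2 + 2 * α))
  obtain ⟨D, hD⟩ : ∃ x, 2 + Ω + α + Λ = x := ⟨_, rfl⟩
  have hD0 : 0 < D := by rw [← hD]; positivity
  obtain ⟨c1, hc1⟩ : ∃ x, x = 2 * (nβ * nβ * B * D * D) := ⟨_, rfl⟩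
  obtain ⟨c2, hc2⟩ : ∃ x, x = nJ * B * D := ⟨_, rfl⟩
  obtain ⟨c3, hc3⟩ : ∃ x, x = ‖q‖ * (2 * (c2 * c2)) := ⟨_, rfl⟩
  obtain ⟨c4, hc4⟩ : ∃ x, x = B * (2 * D) ^ 3 := ⟨_, rfl⟩
  have hc1' : 0 ≤ c1 := by rw [hc1]; positivity
  have hc2' : 0 ≤ c2 := by rw [hc2]; positivity
  have hc3' : 0 ≤ c3 := by rw [hc3]; positivity
  have hc4' : 0 ≤ c4 := by rw [hc4]; positivity
  obtain ⟨ε₀, hε₀0, hε₀1, hε₀2, hε₀3⟩ := exists_pos_mul_le_three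
    (by positivity : 0 < ρ / 16) (by norm_num : (0 : ℝ) < 1) zero_le_one
    (by positivity : 0 ≤ 3 * c1 + c3 + c4) (by positivity : 0 ≤ 2 * D * B)
  refine ⟨η, hη0, ε₀ ^ 2 * (ρ / 4), by positivity, 2 * D * √(4 / ρ), by positivity, ?_⟩
  intro l K0 K R hπ hK0 hK hl hl0 hKK R0 hR y₁ hy₁
  rcases eq_or_ne y₁ 0 with rfl | hne
  · refine ⟨0, by simp, ?_⟩
    simp [linSum, bilinSum, R0]
  have hy₁0 : 0 < ‖y₁‖ := norm_pos_iff.2 hne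
  -- With this scale the rescaled target ε⁻²y₁ has norm exactly ρ/4, the radius that is covered.
  set ε : ℝ := √(4 / ρ) * √‖y₁‖ with hε
  have hεpos : 0 < ε := by positivity
  have hεsq : ε ^ 2 * (ρ / 4) = ‖y₁‖ := by
    rw [hε, mul_pow, Real.sq_sqrt (by positivity), Real.sq_sqrt hy₁0.le]; field_simp
  have hεε : ε ≤ ε₀ := by
    refine le_of_sq_le_sq ?_ hε₀0.le
    have : ε ^ 2 * (ρ / 4) ≤ ε₀ ^ 2 * (ρ / 4) := by rw [hεsq]; exact hy₁
    exact le_of_mul_le_mul_right this (by positivity)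
  obtain ⟨ξ, hξ, hξ'⟩ := exists_quadratic_preimage_aux hν e he l0 π a m m' h1 h2 q hα hα0 hn0 hn1 hnJ
    hnβ hn1' hnJ' hnβ' hE0 hE hρ0 hρ1 hαρ hEρ hη₀0.le (le_of_eq_of_le (by ring) hη₀1)
    (le_of_eq_of_le (by ring) hη₀2) hB hΩ hΛ hη0.le (le_of_eq_of_le (by ring) hη1)
    (le_of_eq_of_le (by ring) hη2) hD0 (by linarith only [hD, hΩ0, hΛ0, hα0])
    (by linarith only [hD, hΛ0, hα0]) (by linarith only [hD, hΩ0, hΛ0])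
    (by linarith only [hD, hΩ0, hα0]) hc1 hc2 hc3 hc4 hεpos
    (hεε.trans (by linarith only [hε₀1]))
    (le_trans (le_of_eq_of_le (by ring) (mul_le_mul_of_nonneg_left hεε
      (by positivity : 0 ≤ 3 * c1 + c3 + c4))) hε₀2)
    (le_trans (le_of_eq_of_le (by ring) (mul_le_mul_of_nonneg_left hεε
      (by positivity : 0 ≤ 2 * D * B))) hε₀3) l K0 K R hπ hK0 hK hl hl0 hKK R0 hR y₁ hεsq
  exact ⟨ξ, hξ.trans (le_of_eq (by rw [hε]; ring)), hξ'⟩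

end QuadraticSurjection

/-! ### Second order expansion of the flow of a finite family -/

section FlowExpansion

variable {𝔸 : Type*} [NormedRing 𝔸] [NormedAlgebra ℝ 𝔸]

/-- The antisymmetrized second iterated integral
`1/2 ∫_0^T [g(t), ∫_0^t h] dt`. -/
noncomputable def commInt (T : ℝ) (g h : ℝ → 𝔸) : 𝔸 :=
  (1 / 2 : ℝ) • (volterra g (volterra h 1) T - volterra (volterra h 1) g T)

theorem volterra_one_apply (g : ℝ → 𝔸) (t : ℝ) : volterra g 1 t = ∫ s in (0 : ℝ)..t, g s := by
  simp [volterra]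

theorem volterra_linSum_one {β : Type*} [Fintype β] {g : β → ℝ → 𝔸} (hg : ∀ c, Continuous (g c))
    (ξ : β → ℝ) (t : ℝ) :
    volterra (fun s => linSum (fun c => g c s) ξ) 1 t = linSum (fun c => volterra (g c) 1 t) ξ := by
  simp only [volterra_one_apply, linSum]
  rw [intervalIntegral.integral_finsetSum fun c _ =>
    ((hg c).fun_const_smul (ξ c)).intervalIntegrable _ _]
  simp only [intervalIntegral.integral_smul]

theorem volterra_linSum {β γ : Type*} [Fintype β] [Fintype γ] {g : β → ℝ → 𝔸} {h : γ → ℝ → 𝔸}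
    (hg : ∀ c, Continuous (g c)) (hh : ∀ c, Continuous (h c)) (ξ : β → ℝ) (ζ : γ → ℝ) (t : ℝ) :
    volterra (fun s => linSum (fun c => g c s) ξ) (fun s => linSum (fun c => h c s) ζ) t
      = bilinSum (fun c d => volterra (g c) (h d) t) ξ ζ := by
  simp only [volterra, linSum, bilinSum, Finset.sum_mul_sum, smul_mul_smul_comm]
  rw [intervalIntegral.integral_finsetSum]
  · refine Finset.sum_congr rfl fun c _ => ?_
    rw [intervalIntegral.integral_finsetSum]
    · simp only [intervalIntegral.integral_smul]
    · exact fun d _ => Continuous.intervalIntegrable (by fun_prop) _ _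
  · exact fun d _ => Continuous.intervalIntegrable (by fun_prop) _ _

/-- The symmetric part of the double integral is a product of first order integrals. It is thus
controlled by the linear term, and only the antisymmetric part `commInt` carries new directions. -/
theorem volterra_by_parts [CompleteSpace 𝔸] {g h : ℝ → 𝔸} (hg : Continuous g) (hh : Continuous h) (t : ℝ) :
    volterra g (volterra h 1) t + volterra (volterra g 1) h t
      = volterra g 1 t * volterra h 1 t := by
  have hd : ∀ {g : ℝ → 𝔸}, Continuous g → ∀ s, HasDerivAt (volterra g 1) (g s) s := by
    intro g hg s
    have := intervalIntegral.integral_hasDerivAt_right (hg.intervalIntegrable (μ := volume) 0 s)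
      (hg.stronglyMeasurableAtFilter _ _) hg.continuousAt
    exact this.congr_of_eventuallyEq (.of_forall fun t => volterra_one_apply g t)
  have c1 := continuous_volterra hg (continuous_one (X := ℝ) (M := 𝔸))
  have c2 := continuous_volterra hh (continuous_one (X := ℝ) (M := 𝔸))
  have := intervalIntegral.integral_eq_sub_of_hasDerivAt (a := 0) (b := t)
    (f := fun s => volterra g 1 s * volterra h 1 s)
    (f' := fun s => g s * volterra h 1 s + volterra g 1 s * h s)
    (fun s _ => (hd hg s).mul (hd hh s)) (Continuous.intervalIntegrable (by fun_prop) _ _)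
  rw [intervalIntegral.integral_add ((hg.fun_mul c2).intervalIntegrable _ _)
    ((c1.fun_mul hh).intervalIntegrable _ _)] at this
  have h0 : volterra g 1 0 = 0 := by simp [volterra]
  simpa [volterra, h0] using this

/-- The expansion of the flow of `∑ ξ_c g_c` to second order. -/
theorem linearFlow_linSum_eq [CompleteSpace 𝔸] {β : Type*} [Fintype β] {T : ℝ} {g : β → ℝ → 𝔸}
    (hg : ∀ c, Continuous (g c)) (ξ : β → ℝ) :
    linearFlow T (fun s => linSum (fun c => g c s) ξ) T - 1
      = linSum (fun c => volterra (g c) 1 T) ξ + bilinSum (fun c d => commInt T (g c) (g d)) ξ ξ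
        + (1 / 2 : ℝ) • (linSum (fun c => volterra (g c) 1 T) ξ
            * linSum (fun c => volterra (g c) 1 T) ξ)
        + dysonRem T (fun s => linSum (fun c => g c s) ξ) := by
  have hV : ∀ c, Continuous (volterra (g c) 1) := fun c => continuous_volterra (hg c) continuous_one
  have h1 : volterra (fun s => linSum (fun c => g c s) ξ)
      (volterra (fun s => linSum (fun c => g c s) ξ) 1) T
      = bilinSum (fun c d => volterra (g c) (volterra (g d) 1) T) ξ ξ := by
    rw [← volterra_linSum hg hV]
    congr 1; ext s
    exact volterra_linSum_one hg ξ s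
  have h2 : bilinSum (fun c d => commInt T (g c) (g d)) ξ ξ
      + (1 / 2 : ℝ) • (linSum (fun c => volterra (g c) 1 T) ξ
            * linSum (fun c => volterra (g c) 1 T) ξ)
      = bilinSum (fun c d => volterra (g c) (volterra (g d) 1) T) ξ ξ := by
    have e1 : linSum (fun c => volterra (g c) 1 T) ξ * linSum (fun c => volterra (g c) 1 T) ξ
        = bilinSum (fun c d => volterra (g c) (volterra (g d) 1) T
          + volterra (volterra (g c) 1) (g d) T) ξ ξ := by
      simp only [linSum, bilinSum, Finset.sum_mul_sum, smul_mul_smul_comm,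
        volterra_by_parts (hg _) (hg _)]
    have e2 : bilinSum (fun c d => volterra (volterra (g d) 1) (g c) T) ξ ξ
        = bilinSum (fun c d => volterra (volterra (g c) 1) (g d) T) ξ ξ := by
      simp only [bilinSum]
      rw [Finset.sum_comm]
      simp only [mul_comm]
    have e3 : bilinSum (fun c d => commInt T (g c) (g d)) ξ ξ
        = (1 / 2 : ℝ) • (bilinSum (fun c d => volterra (g c) (volterra (g d) 1) T) ξ ξ
          - bilinSum (fun c d => volterra (volterra (g d) 1) (g c) T) ξ ξ) := by
      rw [← bilinSum_sub_coef]
      simp only [bilinSum, commInt, Finset.smul_sum, smul_smul]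
      simp only [mul_comm]
    have e4 : bilinSum (fun c d => volterra (g c) (volterra (g d) 1) T
          + volterra (volterra (g c) 1) (g d) T) ξ ξ
        = bilinSum (fun c d => volterra (g c) (volterra (g d) 1) T) ξ ξ
          + bilinSum (fun c d => volterra (volterra (g c) 1) (g d) T) ξ ξ := by
      simp [bilinSum, smul_add, Finset.sum_add_distrib]
    rw [e1, e3, e2, e4]
    module
  rw [add_assoc (linSum _ _), h2, ← h1, ← volterra_linSum_one hg, dysonRem]
  abel

theorem norm_commInt_le {T G : ℝ} (hT : 0 ≤ T) (hG : 0 ≤ G) {g h : ℝ → 𝔸}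
    (hg : ∀ t ∈ Icc 0 T, ‖g t‖ ≤ G) (hh : ∀ t ∈ Icc 0 T, ‖h t‖ ≤ G) :
    ‖commInt T g h‖ ≤ T ^ 2 * G ^ 2 * ‖(1 : 𝔸)‖ := by
  have hTT : T ∈ Icc 0 T := ⟨hT, le_rfl⟩
  have h1 : ∀ t ∈ Icc 0 T, ‖volterra h 1 t‖ ≤ T * (G * ‖(1 : 𝔸)‖) := fun t ht =>
    norm_volterra_le hG hh (fun _ _ => le_rfl) ht
  have h2 := norm_volterra_le hG hg h1 hTT
  have h3 := norm_volterra_le (by positivity) h1 hg hTT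
  rw [commInt, norm_smul, Real.norm_of_nonneg (by norm_num)]
  have h4 := norm_sub_le (volterra g (volterra h 1) T) (volterra (volterra h 1) g T)
  nlinarith

theorem norm_commInt_sub_le {T G d : ℝ} (hT : 0 ≤ T) (hG : 0 ≤ G) (hd : 0 ≤ d) {g h g' h' : ℝ → 𝔸}
    (cg : Continuous g) (ch : Continuous h) (cg' : Continuous g') (ch' : Continuous h')
    (hg : ∀ t ∈ Icc 0 T, ‖g t‖ ≤ G) (hh : ∀ t ∈ Icc 0 T, ‖h t‖ ≤ G)
    (hg' : ∀ t ∈ Icc 0 T, ‖g' t‖ ≤ G) (hh' : ∀ t ∈ Icc 0 T, ‖h' t‖ ≤ G)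
    (hgg : ∀ t ∈ Icc 0 T, ‖g t - g' t‖ ≤ d) (hhh : ∀ t ∈ Icc 0 T, ‖h t - h' t‖ ≤ d) :
    ‖commInt T g h - commInt T g' h'‖ ≤ 2 * T ^ 2 * G * ‖(1 : 𝔸)‖ * d := by
  have hTT : T ∈ Icc 0 T := ⟨hT, le_rfl⟩
  have c1 := continuous_volterra ch (continuous_one (X := ℝ) (M := 𝔸))
  have c2 := continuous_volterra ch' (continuous_one (X := ℝ) (M := 𝔸))
  have h1 : ∀ t ∈ Icc 0 T, ‖volterra h 1 t‖ ≤ T * (G * ‖(1 : 𝔸)‖) := fun t ht =>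
    norm_volterra_le hG hh (fun _ _ => le_rfl) ht
  have h1' : ∀ t ∈ Icc 0 T, ‖volterra h' 1 t‖ ≤ T * (G * ‖(1 : 𝔸)‖) := fun t ht =>
    norm_volterra_le hG hh' (fun _ _ => le_rfl) ht
  have h2 : ∀ t ∈ Icc 0 T, ‖volterra h 1 t - volterra h' 1 t‖ ≤ T * (d * ‖(1 : 𝔸)‖) := fun t ht => by
    have := norm_volterra_sub_volterra_le (F := ‖(1 : 𝔸)‖) (D := 0) hG hd ch ch'
      (continuous_one (X := ℝ) (M := 𝔸)) continuous_one hh' hhh (fun _ _ => le_rfl) (by simp) ht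
    simpa using this
  have a1 := norm_volterra_sub_volterra_le hG hd cg cg' c1 c2 hg' hgg h1 h2 hTT
  have a2 := norm_volterra_sub_volterra_le (β := T * (G * ‖(1 : 𝔸)‖)) (d := T * (d * ‖(1 : 𝔸)‖))
    (by positivity) (by positivity) c1 c2 cg cg' h1' h2 hg hgg hTT
  have e : commInt T g h - commInt T g' h'
      = (1 / 2 : ℝ) • ((volterra g (volterra h 1) T - volterra g' (volterra h' 1) T)
        - (volterra (volterra h 1) g T - volterra (volterra h' 1) g' T)) := by
    rw [commInt, commInt, ← smul_sub]; congr 1; abel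
  rw [e, norm_smul, Real.norm_of_nonneg (by norm_num)]
  have h4 := norm_sub_le (volterra g (volterra h 1) T - volterra g' (volterra h' 1) T)
    (volterra (volterra h 1) g T - volterra (volterra h' 1) g' T)
  nlinarith

end FlowExpansion

/-! ### From the abstract quadratic map to the flow -/

section FlowPreimage

variable {𝔸 : Type*} [NormedRing 𝔸] [NormedAlgebra ℝ 𝔸]

/-- The integrand is fixed by the projection P, which commutes with the integral. -/
theorem volterra_one_mem [CompleteSpace 𝔸] {S : Submodule ℝ 𝔸} {P : 𝔸 →L[ℝ] S}
    (hP : ∀ y : S, P y = y) {g : ℝ → 𝔸} {t : ℝ} (ht : 0 ≤ t) (hg : ∀ s ∈ Icc 0 t, g s ∈ S)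
    (hgc : Continuous g) :
    volterra g 1 t ∈ S := by
  have hcont : IntervalIntegrable g volume 0 t := hgc.intervalIntegrable _ _
  have h1 : volterra g 1 t = ∫ s in (0 : ℝ)..t, S.subtypeL (P (g s)) := by
    rw [volterra_one_apply]
    refine intervalIntegral.integral_congr fun s hs => ?_
    rw [uIcc_of_le ht] at hs
    exact (congrArg Subtype.val (hP ⟨g s, hg s hs⟩)).symm
  have h2 := ContinuousLinearMap.intervalIntegral_comp_comm (S.subtypeL.comp P) hcont
  simp only [ContinuousLinearMap.comp_apply] at h2
  rw [h1, h2]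
  exact Subtype.mem _

/-- Half the product, projected to a subspace. -/
noncomputable def projMul (S : Submodule ℝ 𝔸) (P : 𝔸 →L[ℝ] S) : S →L[ℝ] S →L[ℝ] S :=
  LinearMap.mkContinuous₂ (LinearMap.mk₂ ℝ (fun x y : S => (1 / 2 : ℝ) • P (x * y))
    (fun x y z => by simp [add_mul]) (fun c x y => by
      simp only [Submodule.coe_smul, smul_mul_assoc, map_smul]; exact smul_comm _ _ _)
    (fun x y z => by simp [mul_add]) (fun c x y => by
      simp only [Submodule.coe_smul, mul_smul_comm, map_smul]; exact smul_comm _ _ _)) ‖P‖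
    (fun x y => by
      simp only [LinearMap.mk₂_apply]
      rw [norm_smul, Real.norm_of_nonneg (by norm_num)]
      have h1 := P.le_opNorm (x * y)
      have h2 : ‖(x : 𝔸) * y‖ ≤ ‖x‖ * ‖y‖ := norm_mul_le _ _
      have h3 : ‖P‖ * ‖(x : 𝔸) * y‖ ≤ ‖P‖ * (‖x‖ * ‖y‖) := by gcongr
      have h4 : 0 ≤ ‖P (x * y)‖ := norm_nonneg _
      nlinarith)

theorem projMul_apply (S : Submodule ℝ 𝔸) (P : 𝔸 →L[ℝ] S) (x y : S) :
    projMul S P x y = (1 / 2 : ℝ) • P (x * y) := rfl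

theorem dysonRem_zero [CompleteSpace 𝔸] {T : ℝ} (hT : 0 ≤ T) : dysonRem T (0 : ℝ → 𝔸) = 0 := by
  have h := linearFlow_eq_volterra hT (M := (0 : ℝ → 𝔸)) continuous_zero (t := T) ⟨hT, le_rfl⟩
  rw [dysonRem, h]
  simp [volterra]

variable {ι ν J : Type*} [Fintype ι] [Fintype ν] [Fintype J] [DecidableEq ι] [DecidableEq ν]

/-- The projected expansion of the flow has the form treated by `exists_quadratic_preimage`. The
reference family g0 fixes l0 and K0, and the constants found for it serve every g uniformly close to
it: this is the source of uniformity in the parameter. -/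
theorem exists_flow_preimage [FiniteDimensional ℝ 𝔸] [CompleteSpace 𝔸] {S : Submodule ℝ 𝔸}
    {P : 𝔸 →L[ℝ] S} (hP : ∀ y : S, P y = y)
    {T : ℝ} (hT : 0 ≤ T) (hν : Module.finrank ℝ S < Fintype.card ν) (e : ι → S) (he : ∑ i, e i = 0) (l0 : J → S)
    (π : S →L[ℝ] S) (a : S →L[ℝ] (ι → ℝ)) (m m' : S →L[ℝ] (J → ℝ))
    (h1 : ∀ y, (2 : ℝ) • ∑ i, a y i • e i + linSum l0 (m y) = y)
    (h2 : ∀ y, linSum l0 (m' y) = y - π y) :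
    ∃ η₀ > (0 : ℝ), ∀ g0 : (ι × ν) ⊕ J → ℝ → 𝔸, (∀ c, Continuous (g0 c)) →
      (∀ j, P (volterra (g0 (Sum.inr j)) 1 T) = l0 j) →
      (∀ b b' : ι × ν, ‖π (P (commInt T (g0 (Sum.inl b)) (g0 (Sum.inl b'))))
        - if b = b' then e b.1 else 0‖ ≤ η₀) →
      ∃ η > (0 : ℝ), ∃ μ > (0 : ℝ), ∃ C > (0 : ℝ), ∀ g : (ι × ν) ⊕ J → ℝ → 𝔸,
        (∀ c, Continuous (g c)) → (∀ c, ∀ t ∈ Icc 0 T, g c t ∈ S) →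
        (∀ c, ∀ t ∈ Icc 0 T, ‖g c t - g0 c t‖ ≤ η) →
        ∀ y : S, ‖y‖ ≤ μ → ∃ ξ : (ι × ν) ⊕ J → ℝ, ‖ξ‖ ≤ C * √‖y‖ ∧
          P (linearFlow T (fun s => linSum (fun c => g c s) ξ) T - 1) = y := by
  obtain ⟨η₀, hη₀, H⟩ := exists_quadratic_preimage hν e he l0 π a m m' h1 h2 (projMul S P)
  refine ⟨η₀, hη₀, fun g0 cg0 hl0 hK0 => ?_⟩
  have hTT : T ∈ Icc 0 T := ⟨hT, le_rfl⟩
  -- The margin 1 makes G a bound for the perturbed g as well, since η' below is at most 1.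
  obtain ⟨G, hG0, hG⟩ : ∃ G : ℝ, 0 ≤ G ∧ ∀ c, ∀ t ∈ Icc 0 T, ‖g0 c t‖ + 1 ≤ G := by
    choose G hG using fun c => isCompact_Icc.exists_bound_of_continuousOn
      ((cg0 c).continuousOn (s := Icc 0 T))
    refine ⟨‖G‖ + 1, by positivity, fun c t ht => ?_⟩
    have := (le_abs_self _).trans (norm_le_pi_norm G c)
    linarith [hG c t ht]
  set o := ‖(1 : 𝔸)‖ with ho
  set nβ : ℝ := (Fintype.card ((ι × ν) ⊕ J) : ℝ) with hnβ
  have hnβ0 : 0 ≤ nβ := Nat.cast_nonneg _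
  -- B1 bounds the second order coefficients, B2 the first order ones and B4 the cubic remainder; B3
  -- turns r B ≤ 1 into the smallness condition Tβ ≤ 1/2 of the flow estimates.
  obtain ⟨B1, hB1⟩ : ∃ x, ‖P‖ * (T ^ 2 * G ^ 2 * o) = x := ⟨_, rfl⟩
  obtain ⟨B2, hB2⟩ : ∃ x, ‖P‖ * (T * (G * o)) = x := ⟨_, rfl⟩
  obtain ⟨B3, hB3⟩ : ∃ x, 2 * T * (nβ * G) = x := ⟨_, rfl⟩
  obtain ⟨B4, hB4⟩ : ∃ x, ‖P‖ * (8 * o * T ^ 3 * (nβ * G) ^ 3) = x := ⟨_, rfl⟩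
  have hB1' : 0 ≤ B1 := by rw [← hB1]; positivity
  have hB2' : 0 ≤ B2 := by rw [← hB2]; positivity
  have hB3' : 0 ≤ B3 := by rw [← hB3]; positivity
  have hB4' : 0 ≤ B4 := by rw [← hB4]; positivity
  obtain ⟨η, hη, μ, hμ, C, hC, H⟩ := H (1 + B1 + B2 + B3 + B4) (by positivity)
  obtain ⟨η', hη', hη1, hη2, hη3⟩ := exists_pos_mul_le_three hη hη zero_le_one
    (by positivity : 0 ≤ ‖P‖ * (T * o)) (by positivity : 0 ≤ ‖P‖ * (2 * T ^ 2 * G * o))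
  rw [one_mul] at hη1
  refine ⟨η', hη', μ, hμ, C, hC, fun g cg hgS hgg y hy => ?_⟩
  have hG0' : ∀ c, ∀ t ∈ Icc 0 T, ‖g0 c t‖ ≤ G := fun c t ht => by linarith [hG c t ht]
  have hGg : ∀ c, ∀ t ∈ Icc 0 T, ‖g c t‖ ≤ G := fun c t ht => by
    have := norm_le_norm_sub_add (g c t) (g0 c t)
    linarith [hG c t ht, hgg c t ht]
  have cL : ∀ ξ : (ι × ν) ⊕ J → ℝ, Continuous (fun s => linSum (fun c => g c s) ξ) := fun ξ => by
    unfold linSum; fun_prop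
  have hPop : ∀ {x : 𝔸} {c : ℝ}, ‖x‖ ≤ c → ‖P x‖ ≤ ‖P‖ * c := fun h =>
    (P.le_opNorm _).trans (by gcongr)
  obtain ⟨ξ, hξ, hξ'⟩ := H (fun c => P (volterra (g c) 1 T))
    (fun b b' => P (commInt T (g0 (Sum.inl b)) (g0 (Sum.inl b'))))
    (fun c d => P (commInt T (g c) (g d)))
    (fun ξ => P (dysonRem T (fun s => linSum (fun c => g c s) ξ))) hK0
    (fun b b' => (hPop (norm_commInt_le hT hG0 (hG0' _) (hG0' _))).trans (by
      rw [hB1]; linarith only [hB1', hB2', hB3', hB4']))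
    (fun b b' => (hPop (norm_commInt_le hT hG0 (hGg _) (hGg _))).trans (by
      rw [hB1]; linarith only [hB1', hB2', hB3', hB4']))
    (fun b => (hPop (norm_volterra_le hG0 (hGg b) (fun _ _ => le_rfl) hTT)).trans (by
      change ‖P‖ * (T * (G * o)) ≤ _
      rw [hB2]; linarith only [hB1', hB2', hB3', hB4']))
    (fun j => by
      rw [← hl0 j, ← map_sub]
      have := norm_volterra_sub_volterra_le (F := o) (D := 0) hG0 hη'.le (cg (Sum.inr j))
        (cg0 (Sum.inr j)) (continuous_one (X := ℝ) (M := 𝔸)) continuous_one (hG0' _) (hgg _)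
        (fun _ _ => le_rfl) (by simp) hTT
      exact (hPop this).trans (le_of_eq_of_le (by ring) hη2))
    (fun b b' => by
      rw [← map_sub]
      exact (hPop (norm_commInt_sub_le hT hG0 hη'.le (cg _) (cg _) (cg0 _) (cg0 _) (hGg _) (hGg _)
        (hG0' _) (hG0' _) (hgg _) (hgg _))).trans (le_of_eq_of_le (by ring) hη3))
    (by
      have : (fun s => linSum (fun c => g c s) (0 : (ι × ν) ⊕ J → ℝ)) = 0 := by
        ext s; simp [linSum]
      rw [this, dysonRem_zero hT, map_zero])
    (fun r hr hrB u w hu hw => by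
      rw [← map_sub]
      have b0 : ∀ u : (ι × ν) ⊕ J → ℝ, ∀ t ∈ Icc 0 T, ‖linSum (fun c => g c t) u‖
          ≤ nβ * G * ‖u‖ := fun u t ht => norm_linSum_le (fun c => hGg c t ht) u
      have b1 : T * (nβ * G * r) ≤ 1 / 2 := by
        have : 2 * (T * (nβ * G * r)) ≤ r * (1 + B1 + B2 + B3 + B4) := by
          rw [← hB3]; nlinarith only [hr, hB1', hB2', hB4', mul_nonneg hr hB1',
            mul_nonneg hr hB2', mul_nonneg hr hB4']
        linarith only [this, hrB]
      have := norm_dysonRem_sub_le (β := nβ * G * r) (d := nβ * G * ‖u - w‖) hT (cL u) (cL w)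
        (by positivity) (by positivity) b1
        (fun t ht => (b0 u t ht).trans (by gcongr)) (fun t ht => (b0 w t ht).trans (by gcongr))
        (fun t ht => by rw [← linSum_sub]; exact b0 (u - w) t ht)
      refine (hPop this).trans ?_
      calc _ = B4 * (r ^ 2 * ‖u - w‖) := by rw [← hB4]; ring
        _ ≤ (1 + B1 + B2 + B3 + B4) * (r ^ 2 * ‖u - w‖) := by
          gcongr; linarith only [hB1', hB2', hB3', hB4']
        _ = _ := by ring) y hy
  refine ⟨ξ, hξ, ?_⟩
  have hcoe : ∀ x : S, ((P x : S) : 𝔸) = x := fun x => congrArg _ (hP x)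
  have hL : linSum (fun c => P (volterra (g c) 1 T)) ξ
      = P (linSum (fun c => volterra (g c) 1 T) ξ) := by
    simp [linSum, map_sum]
  have hLS : linSum (fun c => volterra (g c) 1 T) ξ ∈ S :=
    S.sum_mem fun c _ => S.smul_mem _ (volterra_one_mem hP hT (hgS c) (cg c))
  rw [← hξ', linearFlow_linSum_eq cg, map_add, map_add, map_add, map_bilinSum, projMul_apply, hL,
    map_smul]
  congr 4
  rw [hcoe ⟨_, hLS⟩]

end FlowPreimage

/-! ### The symplectic group near the identity -/

section Symplectic

variable {m : ℕ}

/-- Transposition as a continuous linear map. -/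
noncomputable def transposeL (m : ℕ) : Mat m →L[ℝ] Mat m :=
  LinearMap.toContinuousLinearMap
    (Matrix.transposeLinearEquiv (Fin m ⊕ Fin m) (Fin m ⊕ Fin m) ℝ ℝ).toLinearMap

/-- The map `X ↦ -J Xᵀ J`, which is the inverse on the symplectic group. -/
noncomputable def sympInv (m : ℕ) : Mat m →L[ℝ] Mat m :=
  -((ContinuousLinearMap.mul ℝ (Mat m) (Matrix.J (Fin m) ℝ)).comp
    (((ContinuousLinearMap.mul ℝ (Mat m)).flip (Matrix.J (Fin m) ℝ)).comp (transposeL m)))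

theorem sympInv_apply (X : Mat m) :
    sympInv m X = -(Matrix.J (Fin m) ℝ * (Xᵀ * Matrix.J (Fin m) ℝ)) := rfl

theorem sympInv_mul_self {X : Mat m} (hX : X ∈ Matrix.symplecticGroup (Fin m) ℝ) :
    sympInv m X * X = 1 := by
  rw [SymplecticGroup.mem_iff'] at hX
  rw [sympInv_apply, neg_mul, mul_assoc, hX, Matrix.J_squared, neg_neg]

theorem self_mul_sympInv {X : Mat m} (hX : X ∈ Matrix.symplecticGroup (Fin m) ℝ) :
    X * sympInv m X = 1 := mul_eq_one_comm.1 (sympInv_mul_self hX)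

theorem sympInv_mem {X : Mat m} (hX : X ∈ Matrix.symplecticGroup (Fin m) ℝ) :
    sympInv m X ∈ Matrix.symplecticGroup (Fin m) ℝ := by
  have h1 := SymplecticGroup.J_mem (l := Fin m) (R := ℝ)
  have := SymplecticGroup.neg_mem
    (mul_mem h1 (mul_mem (SymplecticGroup.transpose_mem hX) h1))
  rwa [sympInv_apply]

theorem mem_spTangent {Y : Mat m} : Y ∈ spTangent m ↔ (Matrix.J (Fin m) ℝ * Y).IsSymm := Iff.rfl

theorem transpose_mul_J {Y : Mat m} (hY : Y ∈ spTangent m) :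
    Yᵀ * Matrix.J (Fin m) ℝ = -(Matrix.J (Fin m) ℝ * Y) := by
  have : (Matrix.J (Fin m) ℝ * Y)ᵀ = Matrix.J (Fin m) ℝ * Y := hY
  rw [Matrix.transpose_mul, Matrix.J_transpose, mul_neg] at this
  rw [← this, neg_neg]

/-- With `sympInv` in the role of the inverse, J times the conjugate is the congruence Xᵀ(JY)X,
which preserves symmetry for every matrix X. -/
theorem sympInv_conj_mem {X Y : Mat m}
    (hY : Y ∈ spTangent m) : sympInv m X * Y * X ∈ spTangent m := by
  have e : Matrix.J (Fin m) ℝ * (sympInv m X * Y * X) = Xᵀ * (Matrix.J (Fin m) ℝ * Y) * X := by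
    rw [sympInv_apply]
    simp only [neg_mul, mul_neg, ← mul_assoc, Matrix.J_squared, one_mul, neg_neg]
  rw [mem_spTangent, e, Matrix.IsSymm, Matrix.transpose_mul, Matrix.transpose_mul,
    Matrix.transpose_transpose, hY, ← mul_assoc]

/-- The derivative of ZᵀJZ is Zᵀ(MᵀJ + JM)Z, and MᵀJ = -JM on the tangent space. -/
theorem linearFlow_mem_symplectic {T : ℝ} (hT : 0 ≤ T) {M : ℝ → Mat m} (hM : Continuous M)
    (hMS : ∀ t ∈ Icc 0 T, M t ∈ spTangent m) {t : ℝ} (ht : t ∈ Icc 0 T) :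
    linearFlow T M t ∈ Matrix.symplecticGroup (Fin m) ℝ := by
  obtain ⟨hc, h0, hd⟩ := linearFlow_spec hT hM
  set Z := linearFlow T M
  rw [SymplecticGroup.mem_iff']
  have hd2 : ∀ s ∈ Ico 0 T, HasDerivWithinAt (fun s => (Z s)ᵀ * Matrix.J (Fin m) ℝ * Z s) 0
      (Ici s) s := by
    intro s hs
    have hs' : s ∈ Icc 0 T := ⟨hs.1, hs.2.le⟩
    have h1 : HasDerivAt (fun s => (Z s)ᵀ) (M s * Z s)ᵀ s :=
      (transposeL m).hasFDerivAt.comp_hasDerivAt s (hd s hs')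
    have h2 := (h1.mul_const (Matrix.J (Fin m) ℝ)).fun_mul (hd s hs')
    refine (h2.congr_deriv ?_).hasDerivWithinAt
    have := transpose_mul_J (hMS s hs')
    rw [Matrix.transpose_mul, mul_assoc (Z s)ᵀ, this]
    noncomm_ring
  have hcont : Continuous (fun s => (Z s)ᵀ * Matrix.J (Fin m) ℝ * Z s) :=
    (((transposeL m).continuous.comp hc).mul continuous_const).mul hc
  have := constant_of_has_deriv_right_zero hcont.continuousOn hd2 t ht
  simp only [h0, Matrix.transpose_one, one_mul, mul_one] at this
  exact this

/-- The projection of matrices onto `spTangent m` along the `Y` with `J Y` antisymmetric. -/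
noncomputable def spProj (m : ℕ) : Mat m →L[ℝ] spTangent m :=
  ((1 / 2 : ℝ) • (ContinuousLinearMap.id ℝ (Mat m) - sympInv m)).codRestrict (spTangent m) (by
    intro Y
    have e : Matrix.J (Fin m) ℝ * (((1 / 2 : ℝ) • (ContinuousLinearMap.id ℝ (Mat m) - sympInv m)) Y)
        = (1 / 2 : ℝ) • (Matrix.J (Fin m) ℝ * Y + (Matrix.J (Fin m) ℝ * Y)ᵀ) := by
      simp only [smul_apply, sub_apply, ContinuousLinearMap.id_apply,
        sympInv_apply, Matrix.mul_smul, Matrix.transpose_mul, Matrix.J_transpose]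
      congr 1
      simp only [sub_neg_eq_add, mul_add, mul_neg, ← mul_assoc, Matrix.J_squared, neg_mul, one_mul]
    rw [mem_spTangent, e, Matrix.IsSymm, Matrix.transpose_smul, Matrix.transpose_add,
      Matrix.transpose_transpose, add_comm])

theorem coe_spProj (Y : Mat m) : (spProj m Y : Mat m) = (1 / 2 : ℝ) • (Y - sympInv m Y) := rfl

theorem spProj_coe (Y : spTangent m) : spProj m Y = Y := by
  ext1
  have h : sympInv m Y = -(Y : Mat m) := by
    rw [sympInv_apply, transpose_mul_J Y.2, mul_neg, neg_neg, ← mul_assoc, Matrix.J_squared, neg_mul,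
      one_mul]
  rw [coe_spProj, h, sub_neg_eq_add, ← two_smul ℝ (Y : Mat m), smul_smul]
  norm_num

/-- Two symplectic matrices close to the identity with the same projection are equal. -/
theorem eq_of_spProj_eq (m : ℕ) : ∃ r > (0 : ℝ), ∀ X X' : Mat m,
    X ∈ Matrix.symplecticGroup (Fin m) ℝ → X' ∈ Matrix.symplecticGroup (Fin m) ℝ →
    ‖X - 1‖ < r → ‖X' - 1‖ < r → spProj m (X - 1) = spProj m (X' - 1) → X = X' := by
  obtain ⟨N, hN, hNb⟩ : ∃ N > (0 : ℝ), ∀ Y : Mat m, ‖Yᵀ‖ ≤ N * ‖Y‖ :=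
    ⟨‖transposeL m‖ + 1, by positivity, fun Y => ((transposeL m).le_opNorm Y).trans (by gcongr; simp)⟩
  refine ⟨1 / (N + 3), by positivity, fun X X' hX hX' h1 h2 h => ?_⟩
  set r := 1 / (N + 3)
  have hr : N * r + 3 * r = 1 := by simp only [r]; field_simp
  have hr0 : 0 < r := by simp only [r]; positivity
  set D := X - X' with hD
  have hDs : D = sympInv m D := by
    have h3 : (spProj m D : Mat m) = 0 := by
      have : spProj m D = 0 := by
        rw [show D = (X - 1) - (X' - 1) by simp [hD], map_sub, h, sub_self]
      simp [this]
    rw [coe_spProj, smul_eq_zero] at h3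
    exact sub_eq_zero.1 (h3.resolve_left (by norm_num))
  set K := Matrix.J (Fin m) ℝ * D with hK
  have hKD : Dᵀ * Matrix.J (Fin m) ℝ = K := by
    conv_rhs => rw [hK, hDs, sympInv_apply]
    rw [mul_neg, ← mul_assoc, Matrix.J_squared, neg_mul, one_mul, neg_neg]
  rw [SymplecticGroup.mem_iff'] at hX hX'
  have hXD : X = X' + D := by simp [hD]
  -- Equal projections make K = JD antisymmetric. This relation is the difference of the two
  -- symplectic identities.
  have key : X'ᵀ * K + K * X' + K * D = 0 := by
    have e : Xᵀ * Matrix.J (Fin m) ℝ * X = X'ᵀ * Matrix.J (Fin m) ℝ * X' + (X'ᵀ * K + K * X' + K * D) := by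
      rw [hXD, Matrix.transpose_add, add_mul, hKD, hK]
      noncomm_ring
    rw [hX, hX'] at e
    simpa using e
  -- Near the identity the relation reads 2K = (small)·K. The radius is chosen so that the
  -- coefficients on the right add up to at most 1, which forces K = 0.
  have key2 : (2 : ℝ) • K = -((X' - 1)ᵀ * K + K * (X' - 1) + K * D) := by
    rw [two_smul, Matrix.transpose_sub, Matrix.transpose_one, eq_neg_iff_add_eq_zero, ← key]
    noncomm_ring
  have hDn : ‖D‖ ≤ 2 * r := by
    rw [show D = (X - 1) - (X' - 1) by simp [hD]]
    exact (norm_sub_le _ _).trans (by linarith)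
  have hn : 2 * ‖K‖ ≤ (N * r + 3 * r) * ‖K‖ := by
    calc 2 * ‖K‖ = ‖(2 : ℝ) • K‖ := by rw [norm_smul]; simp
      _ ≤ ‖(X' - 1)ᵀ‖ * ‖K‖ + ‖K‖ * ‖X' - 1‖ + ‖K‖ * ‖D‖ := by
        rw [key2, norm_neg]
        refine (norm_add₃_le).trans ?_
        gcongr <;> exact norm_mul_le _ _
      _ ≤ (N * r) * ‖K‖ + ‖K‖ * r + ‖K‖ * (2 * r) := by
        have := hNb (X' - 1)
        gcongr
        exact this.trans (by gcongr)
      _ = _ := by ring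
  rw [hr, one_mul] at hn
  have hK0 : K = 0 := norm_le_zero_iff.1 (by linarith [norm_nonneg K])
  have : D = 0 := by
    have e : Matrix.J (Fin m) ℝ * K = -D := by
      rw [hK, ← mul_assoc, Matrix.J_squared, neg_mul, one_mul]
    rw [hK0, mul_zero] at e
    exact neg_eq_zero.1 e.symm
  exact sub_eq_zero.1 this

end Symplectic

/-! ### Trajectories, the end-point map and variation of constants -/

section ControlSystem

/-- Extension of a map on `[0,T]` to the real line by its values at the end points. -/
def clampFun {E : Type*} (T : ℝ) (A : ℝ → E) (t : ℝ) : E := A (max 0 (min T t))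

theorem clampFun_of_mem {E : Type*} {T : ℝ} (A : ℝ → E) {t : ℝ} (ht : t ∈ Icc 0 T) :
    clampFun T A t = A t := by
  rw [clampFun, min_eq_right ht.2, max_eq_right ht.1]

theorem continuous_clampFun {E : Type*} [TopologicalSpace E] {T : ℝ} (hT : 0 ≤ T) {A : ℝ → E}
    (hA : ContinuousOn A (Icc 0 T)) : Continuous (clampFun T A) :=
  hA.comp_continuous (by fun_prop) fun t => ⟨le_max_left _ _, max_le hT (min_le_left _ _)⟩

theorem Icc_mem_nhdsGE_of_mem_Ico {T t : ℝ} (ht : t ∈ Ico 0 T) : Icc 0 T ∈ nhdsWithin t (Ici t) :=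
  Filter.mem_of_superset (Icc_mem_nhdsGE ht.2) (Icc_subset_Icc_left ht.1)

variable {m k : ℕ} {T : ℝ} {A : ℝ → Mat m} {B : Fin k → Mat m}
  {u : ℝ → EuclideanSpace ℝ (Fin k)} {X₀ : Mat m}

theorem IsTrajectory.hasDerivWithinAt {X : ℝ → Mat m} (hT : 0 ≤ T) (hA : ContinuousOn A (Icc 0 T))
    (hu : Continuous u) (hX : IsTrajectory T A B X₀ u X) {t : ℝ} (ht : t ∈ Icc 0 T) :
    HasDerivWithinAt X (controlRHS A B u X t) (Icc 0 T) t := by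
  obtain ⟨hXc, -, hXi⟩ := hX
  have hF : ContinuousOn (controlRHS A B u X) (Icc 0 T) := by
    unfold controlRHS
    refine (hA.mul hXc).add (continuousOn_finsetSum _ fun i _ => ?_)
    exact ContinuousOn.smul (f := fun t => u t i) (by fun_prop) (continuousOn_const.mul hXc)
  have hG := continuous_clampFun hT hF
  have h1 : HasDerivAt (fun t => X₀ + ∫ s in (0 : ℝ)..t, clampFun T (controlRHS A B u X) s)
      (clampFun T (controlRHS A B u X) t) t :=
    (intervalIntegral.integral_hasDerivAt_right (hG.intervalIntegrable _ _)
      (hG.stronglyMeasurableAtFilter _ _) hG.continuousAt).const_add _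
  rw [clampFun_of_mem _ ht] at h1
  have h2 : ∀ s ∈ Icc 0 T, X s = X₀ + ∫ r in (0 : ℝ)..s, clampFun T (controlRHS A B u X) r := by
    intro s hs
    rw [hXi s hs]
    congr 1
    refine intervalIntegral.integral_congr fun r hr => ?_
    rw [uIcc_of_le hs.1] at hr
    exact (clampFun_of_mem _ ⟨hr.1, hr.2.trans hs.2⟩).symm
  exact h1.hasDerivWithinAt.congr h2 (h2 t ht)

theorem controlRHS_eq_mul (X : ℝ → Mat m) (t : ℝ) :
    controlRHS A B u X t = (A t + ∑ i, u t i • B i) * X t := by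
  simp [controlRHS, add_mul, Finset.sum_mul]

/-- `endPoint` picks an unspecified trajectory; uniqueness for the linear equation makes the choice
immaterial. -/
theorem endPoint_eq_of_isTrajectory (hT : 0 ≤ T) (hA : ContinuousOn A (Icc 0 T))
    (hu : Continuous u) {X : ℝ → Mat m} (hX : IsTrajectory T A B X₀ u X) :
    endPoint T A B X₀ u = X T := by
  have hex : ∃ X, IsTrajectory T A B X₀ u X := ⟨X, hX⟩
  rw [endPoint, dif_pos hex]
  have hM : Continuous (fun t => clampFun T A t + ∑ i, u t i • B i) :=
    (continuous_clampFun hT hA).add (by fun_prop)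
  have h0 : ∀ {Y}, IsTrajectory T A B X₀ u Y → Y 0 = X₀ := fun h => by
    rw [h.2.2 0 ⟨le_rfl, hT⟩]; simp
  have hd : ∀ {Y}, IsTrajectory T A B X₀ u Y → ∀ t ∈ Ico 0 T,
      HasDerivWithinAt Y ((clampFun T A t + ∑ i, u t i • B i) * Y t) (Ici t) t := by
    intro Y hY t ht
    have ht' : t ∈ Icc 0 T := ⟨ht.1, ht.2.le⟩
    rw [clampFun_of_mem _ ht', ← controlRHS_eq_mul]
    exact (hY.hasDerivWithinAt hT hA hu ht').mono_of_mem_nhdsWithin (Icc_mem_nhdsGE_of_mem_Ico ht)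
  exact linear_ode_unique hM hex.choose_spec.1 hX.1 ((h0 hex.choose_spec).trans (h0 hX).symm)
    (hd hex.choose_spec) (hd hX) ⟨hT, le_rfl⟩

/-- The fundamental solution of `S' = A S` on `[0,T]`. -/
noncomputable def fundSol (T : ℝ) (A : ℝ → Mat m) : ℝ → Mat m := linearFlow T (clampFun T A)

/-- The matrix `S(t)⁻¹ B S(t)`, with `S` the fundamental solution. -/
noncomputable def conjCtrl (T : ℝ) (A : ℝ → Mat m) (B : Mat m) (t : ℝ) : Mat m :=
  sympInv m (fundSol T A t) * B * fundSol T A t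

theorem continuous_fundSol (hT : 0 ≤ T) (hA : ContinuousOn A (Icc 0 T)) :
    Continuous (fundSol T A) :=
  (linearFlow_spec hT (continuous_clampFun hT hA)).1

theorem continuous_conjCtrl (hT : 0 ≤ T) (hA : ContinuousOn A (Icc 0 T)) (B : Mat m) :
    Continuous (conjCtrl T A B) := by
  have := continuous_fundSol hT hA
  unfold conjCtrl
  fun_prop

theorem conjCtrl_mem {B : Mat m} (hB : B ∈ spTangent m) (t : ℝ) : conjCtrl T A B t ∈ spTangent m :=
  sympInv_conj_mem hB

theorem fundSol_mem (hT : 0 ≤ T) (hA : ContinuousOn A (Icc 0 T))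
    (hAS : ∀ t ∈ Icc 0 T, A t ∈ spTangent m) {t : ℝ} (ht : t ∈ Icc 0 T) :
    fundSol T A t ∈ Matrix.symplecticGroup (Fin m) ℝ :=
  linearFlow_mem_symplectic hT (continuous_clampFun hT hA)
    (fun s hs => by rw [clampFun_of_mem _ hs]; exact hAS s hs) ht

theorem hasDerivAt_fundSol (hT : 0 ≤ T) (hA : ContinuousOn A (Icc 0 T)) {t : ℝ}
    (ht : t ∈ Icc 0 T) : HasDerivAt (fundSol T A) (A t * fundSol T A t) t := by
  have := (linearFlow_spec hT (continuous_clampFun hT hA)).2.2 t ht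
  rwa [clampFun_of_mem _ ht] at this

theorem fundSol_zero (hT : 0 ≤ T) (hA : ContinuousOn A (Icc 0 T)) : fundSol T A 0 = 1 :=
  (linearFlow_spec hT (continuous_clampFun hT hA)).2.1

/-- Variation of constants: S Z X₀ solves the controlled equation because S·(S⁻¹B_iS) = B_iS. The
drift and the initial point become fixed outer factors, and the control acts only through Z. -/
theorem endPoint_eq (hT : 0 ≤ T) (hA : ContinuousOn A (Icc 0 T))
    (hAS : ∀ t ∈ Icc 0 T, A t ∈ spTangent m) (hu : Continuous u) :
    endPoint T A B X₀ u
      = fundSol T A T * linearFlow T (fun t => ∑ i, u t i • conjCtrl T A (B i) t) T * X₀ := by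
  have hcS := continuous_fundSol hT hA
  have hcb := fun i => continuous_conjCtrl hT hA (B i)
  have hM : Continuous (fun t => ∑ i, u t i • conjCtrl T A (B i) t) := by fun_prop
  obtain ⟨hcZ, hZ0, hZd⟩ := linearFlow_spec hT hM
  set Z := linearFlow T (fun t => ∑ i, u t i • conjCtrl T A (B i) t)
  set S := fundSol T A
  have hXc : Continuous (fun t => S t * Z t * X₀) := (hcS.mul hcZ).mul continuous_const
  have hd : ∀ t ∈ Icc 0 T, HasDerivAt (fun t => S t * Z t * X₀)
      (controlRHS A B u (fun t => S t * Z t * X₀) t) t := by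
    intro t ht
    refine (((hasDerivAt_fundSol hT hA ht).fun_mul (hZd t ht)).mul_const X₀).congr_deriv ?_
    have hinv : S t * sympInv m (S t) = 1 := self_mul_sympInv (fundSol_mem hT hA hAS ht)
    have e : S t * ((∑ i, u t i • conjCtrl T A (B i) t) * Z t)
        = (∑ i, u t i • B i) * (S t * Z t) := by
      have e' : S t * (∑ i, u t i • conjCtrl T A (B i) t) = (∑ i, u t i • B i) * S t := by
        simp only [Finset.mul_sum, Finset.sum_mul]
        refine Finset.sum_congr rfl fun i _ => ?_
        rw [mul_smul_comm, smul_mul_assoc]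
        congr 1
        change S t * (sympInv m (S t) * B i * S t) = _
        rw [← mul_assoc, ← mul_assoc, hinv, one_mul]
      rw [← mul_assoc, e', mul_assoc]
    rw [controlRHS_eq_mul, e]
    noncomm_ring
  have hF : ContinuousOn (controlRHS A B u (fun t => S t * Z t * X₀)) (Icc 0 T) := by
    unfold controlRHS
    refine (hA.mul hXc.continuousOn).add (Continuous.continuousOn ?_)
    fun_prop
  refine endPoint_eq_of_isTrajectory hT hA hu ⟨hXc.continuousOn, ?_, fun t ht => ?_⟩
  · exact ContinuousOn.intervalIntegrable (by rwa [uIcc_of_le hT])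
  · rw [intervalIntegral.integral_eq_sub_of_hasDerivAt (f := fun t => S t * Z t * X₀)]
    · simp [S, fundSol_zero hT hA, hZ0]
    · intro s hs
      rw [uIcc_of_le ht.1] at hs
      exact hd s ⟨hs.1, hs.2.trans ht.2⟩
    · refine ContinuousOn.intervalIntegrable (hF.mono ?_)
      rw [uIcc_of_le ht.1]
      exact Icc_subset_Icc_right ht.2

theorem endPoint_zero (hT : 0 ≤ T) (hA : ContinuousOn A (Icc 0 T))
    (hAS : ∀ t ∈ Icc 0 T, A t ∈ spTangent m) :
    endPoint T A B X₀ 0 = fundSol T A T * X₀ := by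
  rw [endPoint_eq hT hA hAS continuous_zero]
  have h := linearFlow_eq_volterra hT (M := (fun _ => 0 : ℝ → Mat m)) continuous_const (t := T)
    ⟨hT, le_rfl⟩
  have h2 : linearFlow T (fun _ => 0 : ℝ → Mat m) T = 1 := by
    rw [← sub_eq_zero, h]; simp [volterra]
  simp [h2]

/-- The fundamental solution depends Lipschitz continuously on the coefficients. -/
theorem exists_norm_fundSol_sub_le (hT : 0 ≤ T) (hA : ContinuousOn A (Icc 0 T)) :
    ∃ L ≥ (0 : ℝ), ∀ A' : ℝ → Mat m, ContinuousOn A' (Icc 0 T) → ∀ η ≥ (0 : ℝ), η ≤ 1 →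
      (∀ t ∈ Icc 0 T, ‖A' t - A t‖ ≤ η) →
      ∀ t ∈ Icc 0 T, ‖fundSol T A' t - fundSol T A t‖ ≤ L * η := by
  obtain ⟨a, ha⟩ := isCompact_Icc.exists_bound_of_continuousOn hA
  have ha0 : 0 ≤ a := (norm_nonneg _).trans (ha 0 ⟨le_rfl, hT⟩)
  obtain ⟨s, hs⟩ := isCompact_Icc.exists_bound_of_continuousOn
    (continuous_fundSol hT hA).continuousOn (s := Icc 0 T)
  have hs0 : 0 ≤ s := (norm_nonneg _).trans (hs 0 ⟨le_rfl, hT⟩)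
  have hK : (a + 1) ≠ 0 := by positivity
  refine ⟨s / (a + 1) * Real.exp ((a + 1) * T), by positivity, fun A' hA' η hη hη1 hAA t ht => ?_⟩
  -- The difference of the fundamental solutions vanishes at 0 and satisfies a linear inequality
  -- with rate a + 1 (a bound for A', as η ≤ 1) and forcing ηs.
  have h := norm_le_gronwallBound_of_norm_deriv_right_le
    (f := fun t => fundSol T A' t - fundSol T A t)
    (f' := fun t => A' t * fundSol T A' t - A t * fundSol T A t) (δ := 0) (K := a + 1)
    (ε := η * s) (a := 0) (b := T)
    ((continuous_fundSol hT hA').sub (continuous_fundSol hT hA)).continuousOn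
    (fun t ht => ((hasDerivAt_fundSol hT hA' ⟨ht.1, ht.2.le⟩).sub
      (hasDerivAt_fundSol hT hA ⟨ht.1, ht.2.le⟩)).hasDerivWithinAt)
    (by simp [fundSol_zero hT hA, fundSol_zero hT hA'])
    (fun t ht => by
      have ht' : t ∈ Icc 0 T := ⟨ht.1, ht.2.le⟩
      have e : A' t * fundSol T A' t - A t * fundSol T A t
          = A' t * (fundSol T A' t - fundSol T A t) + (A' t - A t) * fundSol T A t := by
        noncomm_ring
      have h1 : ‖A' t‖ ≤ a + 1 := by
        have := norm_le_norm_sub_add (A' t) (A t)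
        linarith [hAA t ht', ha t ht']
      rw [e]
      refine (norm_add_le _ _).trans (add_le_add ((norm_mul_le _ _).trans ?_)
        ((norm_mul_le _ _).trans ?_))
      · gcongr
      · have := hAA t ht'
        have := hs t ht'
        gcongr) t ht
  refine h.trans ?_
  simp only [gronwallBound_of_K_ne_0 hK, zero_mul, zero_add, sub_zero]
  have h3 : Real.exp ((a + 1) * t) ≤ Real.exp ((a + 1) * T) := by
    gcongr; exact ht.2
  calc η * s / (a + 1) * (Real.exp ((a + 1) * t) - 1)
      ≤ η * s / (a + 1) * Real.exp ((a + 1) * T) := by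
        gcongr; linarith
    _ = _ := by ring

/-- The conjugated control matrices depend Lipschitz continuously on the data. -/
theorem exists_norm_conjCtrl_sub_le (hT : 0 ≤ T) (hA : ContinuousOn A (Icc 0 T)) (B : Fin k → Mat m) :
    ∃ L ≥ (0 : ℝ), ∀ (A' : ℝ → Mat m) (B' : Fin k → Mat m), ContinuousOn A' (Icc 0 T) →
      ∀ η ≥ (0 : ℝ), η ≤ 1 → (∀ t ∈ Icc 0 T, ‖A' t - A t‖ ≤ η) → (∀ i, ‖B' i - B i‖ ≤ η) →
      ∀ i, ∀ t ∈ Icc 0 T, ‖conjCtrl T A' (B' i) t - conjCtrl T A (B i) t‖ ≤ L * η := by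
  obtain ⟨L, hL, hS⟩ := exists_norm_fundSol_sub_le hT hA
  obtain ⟨s, hs⟩ := isCompact_Icc.exists_bound_of_continuousOn
    (continuous_fundSol hT hA).continuousOn (s := Icc 0 T)
  have hs0 : 0 ≤ s := (norm_nonneg _).trans (hs 0 ⟨le_rfl, hT⟩)
  set j := ‖sympInv m‖
  have hj : 0 ≤ j := norm_nonneg (sympInv m)
  set b := ‖B‖
  have hb : 0 ≤ b := norm_nonneg B
  refine ⟨(j * L) * (b + 1) * (s + L) + j * s * (s + L) + j * s * b * L, by positivity,
    fun A' B' hA' η hη hη1 hAA hBB i t ht => ?_⟩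
  have hd := hS A' hA' η hη hη1 hAA t ht
  have h1 := hs t ht
  have h2 : ‖fundSol T A' t‖ ≤ s + L := by
    have := norm_le_norm_sub_add (fundSol T A' t) (fundSol T A t)
    nlinarith
  have hBi : ‖B i‖ ≤ b := norm_le_pi_norm B i
  have hB'i : ‖B' i‖ ≤ b + 1 := by
    have := norm_le_norm_sub_add (B' i) (B i)
    linarith [hBB i]
  have e : conjCtrl T A' (B' i) t - conjCtrl T A (B i) t
      = sympInv m (fundSol T A' t - fundSol T A t) * B' i * fundSol T A' t
        + sympInv m (fundSol T A t) * (B' i - B i) * fundSol T A' t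
        + sympInv m (fundSol T A t) * B i * (fundSol T A' t - fundSol T A t) := by
    rw [map_sub, conjCtrl, conjCtrl]; noncomm_ring
  have h3 : ‖sympInv m (fundSol T A' t - fundSol T A t)‖ ≤ j * (L * η) :=
    ((sympInv m).le_opNorm _).trans (by gcongr)
  have h4 : ‖sympInv m (fundSol T A t)‖ ≤ j * s :=
    ((sympInv m).le_opNorm _).trans (by gcongr)
  rw [e]
  have n3 : ∀ x y z : Mat m, ‖x * y * z‖ ≤ ‖x‖ * ‖y‖ * ‖z‖ := fun x y z =>
    (norm_mul_le _ _).trans (by gcongr; exact norm_mul_le _ _)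
  calc _ ≤ j * (L * η) * (b + 1) * (s + L) + j * s * η * (s + L) + j * s * b * (L * η) := by
        refine norm_add₃_le.trans (add_le_add (add_le_add ?_ ?_) ?_)
        · exact (n3 _ _ _).trans (by gcongr)
        · have := hBB i
          exact (n3 _ _ _).trans (by gcongr)
        · exact (n3 _ _ _).trans (by gcongr)
    _ = _ := by ring

end ControlSystem

/-! ### The brackets as derivatives of the conjugated control matrices -/

section BracketDerivatives

variable {m : ℕ} {T : ℝ} {A : ℝ → Mat m}

theorem contDiffOn_bracketSeq (hT : 0 < T) (hA : ContDiffOn ℝ ∞ A (Icc 0 T)) (B : Mat m) (j : ℕ) :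
    ContDiffOn ℝ ∞ (bracketSeq T A B j) (Icc 0 T) := by
  induction j with
  | zero => exact contDiffOn_const
  | succ j ih =>
    have h1 : ContDiffOn ℝ ∞ (derivWithin (bracketSeq T A B j) (Icc 0 T)) (Icc 0 T) :=
      ih.derivWithin (uniqueDiffOn_Icc hT) (by norm_cast)
    exact h1.add ((ih.mul hA).sub (hA.mul ih))

/-- The matrices `S(t)⁻¹ B^j(t) S(t)`. -/
noncomputable def conjSeq (T : ℝ) (A : ℝ → Mat m) (B : Mat m) (j : ℕ) (t : ℝ) : Mat m :=
  sympInv m (fundSol T A t) * bracketSeq T A B j t * fundSol T A t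

/-- From S' = AS and (S⁻¹)' = -S⁻¹A one gets (S⁻¹CS)' = S⁻¹(C' + CA - AC)S, which is the recursion
defining `bracketSeq`. -/
theorem hasDerivWithinAt_conjSeq (hT : 0 < T) (hA : ContDiffOn ℝ ∞ A (Icc 0 T))
    (hAS : ∀ t ∈ Icc 0 T, A t ∈ spTangent m) (B : Mat m) (j : ℕ) {t : ℝ} (ht : t ∈ Icc 0 T) :
    HasDerivWithinAt (conjSeq T A B j) (conjSeq T A B (j + 1) t) (Icc 0 T) t := by
  have hS := (hasDerivAt_fundSol hT.le hA.continuousOn ht).hasDerivWithinAt (s := Icc 0 T)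
  have hR : HasDerivWithinAt (fun t => sympInv m (fundSol T A t))
      (sympInv m (A t * fundSol T A t)) (Icc 0 T) t :=
    (sympInv m).hasFDerivAt.comp_hasDerivWithinAt t hS
  have hb : HasDerivWithinAt (bracketSeq T A B j) (derivWithin (bracketSeq T A B j) (Icc 0 T) t)
      (Icc 0 T) t :=
    (((contDiffOn_bracketSeq hT hA B j).differentiableOn (by simp)) t ht).hasDerivWithinAt
  refine ((hR.fun_mul hb).fun_mul hS).congr_deriv ?_
  have e : sympInv m (A t * fundSol T A t) = -(sympInv m (fundSol T A t) * A t) := by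
    rw [sympInv_apply, sympInv_apply, Matrix.transpose_mul, mul_assoc, transpose_mul_J (hAS t ht)]
    noncomm_ring
  rw [e, conjSeq, bracketSeq]
  noncomm_ring

theorem contDiffOn_conjSeq (hT : 0 < T) (hA : ContDiffOn ℝ ∞ A (Icc 0 T))
    (hAS : ∀ t ∈ Icc 0 T, A t ∈ spTangent m) (B : Mat m) (n j : ℕ) :
    ContDiffOn ℝ n (conjSeq T A B j) (Icc 0 T) := by
  induction n generalizing j with
  | zero =>
    exact contDiffOn_zero.2 fun t ht =>
      (hasDerivWithinAt_conjSeq hT hA hAS B j ht).continuousWithinAt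
  | succ n ih =>
    push_cast
    refine (contDiffOn_succ_iff_derivWithin (uniqueDiffOn_Icc hT)).2 ⟨fun t ht =>
      (hasDerivWithinAt_conjSeq hT hA hAS B j ht).differentiableWithinAt, by simp, ?_⟩
    exact (ih (j + 1)).congr fun t ht =>
      (hasDerivWithinAt_conjSeq hT hA hAS B j ht).derivWithin (uniqueDiffOn_Icc hT t ht)

theorem iteratedDerivWithin_conjCtrl (hT : 0 < T) (hA : ContDiffOn ℝ ∞ A (Icc 0 T))
    (hAS : ∀ t ∈ Icc 0 T, A t ∈ spTangent m) (B : Mat m) (j : ℕ) {t : ℝ} (ht : t ∈ Icc 0 T) :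
    iteratedDerivWithin j (conjCtrl T A B) (Icc 0 T) t = conjSeq T A B j t := by
  induction j generalizing t with
  | zero => rw [iteratedDerivWithin_zero]; rfl
  | succ j ih =>
    rw [iteratedDerivWithin_succ, derivWithin_congr (fun s hs => ih hs) (ih ht)]
    exact (hasDerivWithinAt_conjSeq hT hA hAS B j ht).derivWithin (uniqueDiffOn_Icc hT t ht)

theorem conjSeq_zero (hT : 0 < T) (hA : ContDiffOn ℝ ∞ A (Icc 0 T)) (B : Mat m) (j : ℕ) :
    conjSeq T A B j 0 = bracketSeq T A B j 0 := by
  have : sympInv m 1 = 1 := by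
    rw [sympInv_apply, Matrix.transpose_one, one_mul, Matrix.J_squared, neg_neg]
  rw [conjSeq, fundSol_zero hT.le hA.continuousOn, this, one_mul, mul_one]

/-- As S(0) = 1, the Taylor coefficients of S⁻¹BS at 0 are the brackets themselves. Order two
suffices: controls concentrated at scale δ carry a factor that the error t³ outweighs. -/
theorem exists_conjCtrl_taylor (hT : 0 < T) (hA : ContDiffOn ℝ ∞ A (Icc 0 T))
    (hAS : ∀ t ∈ Icc 0 T, A t ∈ spTangent m) (B : Mat m) :
    ∃ C, ∀ t ∈ Icc 0 T, ‖conjCtrl T A B t - (B + t • bracketSeq T A B 1 0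
      + (t ^ 2 / 2) • bracketSeq T A B 2 0)‖ ≤ C * t ^ 3 := by
  obtain ⟨C, hC⟩ := exists_taylor_mean_remainder_bound (f := conjCtrl T A B) (n := 2) hT.le
    (contDiffOn_conjSeq hT hA hAS B (2 + 1) 0)
  refine ⟨C, fun t ht => ?_⟩
  have h0 : (0 : ℝ) ∈ Icc 0 T := ⟨le_rfl, hT.le⟩
  have := hC t ht
  rw [sub_zero, taylorWithinEval_succ, taylorWithinEval_succ, taylor_within_zero_eval,
    iteratedDerivWithin_conjCtrl hT hA hAS B _ h0, iteratedDerivWithin_conjCtrl hT hA hAS B _ h0,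
    conjSeq_zero hT hA, conjSeq_zero hT hA] at this
  have e : conjCtrl T A B 0 = B := conjSeq_zero hT hA B 0
  rw [e] at this
  have c1 : ((((0 : ℕ) : ℝ) + 1) * ((Nat.factorial 0 : ℕ) : ℝ))⁻¹ * (t - 0) ^ (0 + 1) = t := by simp
  have c2 : ((((1 : ℕ) : ℝ) + 1) * ((Nat.factorial 1 : ℕ) : ℝ))⁻¹ * (t - 0) ^ (1 + 1) = t ^ 2 / 2 := by
    rw [Nat.factorial_one]; push_cast; ring
  rwa [c1, c2] at this

/-- All matrices `B^j(0)` are in the closed span of the values of `S⁻¹ B S`: linear maps vanishing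
on the latter vanish on the former. -/
theorem map_bracketSeq_eq_zero (hT : 0 < T) (hA : ContDiffOn ℝ ∞ A (Icc 0 T))
    (hAS : ∀ t ∈ Icc 0 T, A t ∈ spTangent m) (B : Mat m) {F : Type*} [NormedAddCommGroup F]
    [NormedSpace ℝ F] (φ : Mat m →L[ℝ] F) (hφ : ∀ t ∈ Icc 0 T, φ (conjCtrl T A B t) = 0) (j : ℕ) :
    φ (bracketSeq T A B j 0) = 0 := by
  have h : ∀ t ∈ Icc 0 T, φ (conjSeq T A B j t) = 0 := by
    induction j with
    | zero => exact hφ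
    | succ j ih =>
      intro t ht
      have h1 : HasDerivWithinAt (fun t => φ (conjSeq T A B j t)) (φ (conjSeq T A B (j + 1) t))
          (Icc 0 T) t :=
        φ.hasFDerivAt.comp_hasDerivWithinAt t (hasDerivWithinAt_conjSeq hT hA hAS B j ht)
      have h2 : HasDerivWithinAt (fun t => φ (conjSeq T A B j t)) 0 (Icc 0 T) t :=
        (hasDerivWithinAt_const t (Icc 0 T) (0 : F)).congr (fun s hs => ih s hs) (ih t ht)
      exact (uniqueDiffOn_Icc hT t ht).eq_deriv _ h1 h2
  rw [← conjSeq_zero hT hA]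
  exact h 0 ⟨le_rfl, hT.le⟩

end BracketDerivatives

/-! ### Scalar profiles and their orthogonality relations -/

section Profiles

/-- Smooth functions with support in the open interval `(p,q)`. -/
def IsProfile (p q : ℝ) (f : ℝ → ℝ) : Prop := ContDiff ℝ ∞ f ∧ tsupport f ⊆ Ioo p q

namespace IsProfile

variable {p q : ℝ} {f g : ℝ → ℝ}

theorem mono {p' q' : ℝ} (hf : IsProfile p q f) (h1 : p' ≤ p) (h2 : q ≤ q') : IsProfile p' q' f :=
  ⟨hf.1, hf.2.trans (Ioo_subset_Ioo h1 h2)⟩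

theorem deriv (hf : IsProfile p q f) : IsProfile p q (deriv f) :=
  ⟨(contDiff_infty_iff_deriv.1 hf.1).2,
    (closure_minimal support_deriv_subset (isClosed_tsupport f)).trans hf.2⟩

theorem add (hf : IsProfile p q f) (hg : IsProfile p q g) : IsProfile p q (fun x => f x + g x) :=
  ⟨hf.1.add hg.1, (tsupport_add f g).trans (union_subset hf.2 hg.2)⟩

theorem const_mul (c : ℝ) (hf : IsProfile p q f) : IsProfile p q (fun x => c * f x) :=
  ⟨contDiff_const.mul hf.1, (tsupport_mul_subset_right (f := fun _ => c)).trans hf.2⟩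

theorem eq_zero (hf : IsProfile p q f) {x : ℝ} (hx : x ∉ Ioo p q) : f x = 0 :=
  image_eq_zero_of_notMem_tsupport fun h => hx (hf.2 h)

theorem continuous (hf : IsProfile p q f) : Continuous f := hf.1.continuous

theorem hasDerivAt (hf : IsProfile p q f) (x : ℝ) : HasDerivAt f (_root_.deriv f x) x :=
  ((hf.1.differentiable (by simp)) x).hasDerivAt

theorem by_parts (hf : IsProfile p q f) (hg : IsProfile p q g) :
    ∫ x in p..q, _root_.deriv f x * g x = -∫ x in p..q, f x * _root_.deriv g x := by
  have hc1 := hf.continuous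
  have hc2 := hg.continuous
  have hc3 := hf.deriv.continuous
  have hc4 := hg.deriv.continuous
  have h := intervalIntegral.integral_eq_sub_of_hasDerivAt (a := p) (b := q)
    (fun x _ => (hf.hasDerivAt x).fun_mul (hg.hasDerivAt x))
    (Continuous.intervalIntegrable (by fun_prop) _ _)
  rw [intervalIntegral.integral_add (Continuous.intervalIntegrable (by fun_prop) _ _)
    (Continuous.intervalIntegrable (by fun_prop) _ _), hf.eq_zero (x := q) (by simp),
    hf.eq_zero (x := p) (by simp)] at h
  linarith

theorem by_parts_mul (hf : IsProfile p q f) (hg : IsProfile p q g) :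
    ∫ x in p..q, x * (_root_.deriv f x * g x)
      = -(∫ x in p..q, f x * g x) - ∫ x in p..q, x * (f x * _root_.deriv g x) := by
  have hc1 := hf.continuous
  have hc2 := hg.continuous
  have hc3 := hf.deriv.continuous
  have hc4 := hg.deriv.continuous
  have h := intervalIntegral.integral_eq_sub_of_hasDerivAt (a := p) (b := q)
    (fun x _ => (hasDerivAt_id x).fun_mul ((hf.hasDerivAt x).fun_mul (hg.hasDerivAt x)))
    (Continuous.intervalIntegrable (by fun_prop) _ _)
  simp only [id_eq, one_mul, mul_add] at h
  rw [intervalIntegral.integral_add (Continuous.intervalIntegrable (by fun_prop) _ _)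
    (Continuous.intervalIntegrable (by fun_prop) _ _),
    intervalIntegral.integral_add (Continuous.intervalIntegrable (by fun_prop) _ _)
    (Continuous.intervalIntegrable (by fun_prop) _ _), hf.eq_zero (x := q) (by simp),
    hf.eq_zero (x := p) (by simp)] at h
  linarith

theorem deriv_ne_zero (hf : IsProfile p q f) (h : ∃ x, f x ≠ 0) : ∃ x, _root_.deriv f x ≠ 0 := by
  by_contra! h0
  obtain ⟨x, hx⟩ := h
  refine hx ?_
  rw [is_const_of_deriv_eq_zero (hf.1.differentiable (by simp)) h0 x p]
  exact hf.eq_zero (by simp)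

theorem integral_sq_pos (hf : IsProfile p q f) (h : ∃ x, f x ≠ 0) :
    0 < ∫ x in p..q, f x * f x := by
  obtain ⟨x, hx⟩ := h
  have hx' : x ∈ Ioo p q := by by_contra hn; exact hx (hf.eq_zero hn)
  refine intervalIntegral.integral_pos (hx'.1.trans hx'.2)
    (hf.continuous.mul hf.continuous).continuousOn (fun x _ => mul_self_nonneg _)
    ⟨x, ⟨hx'.1.le, hx'.2.le⟩, mul_self_pos.2 hx⟩

end IsProfile

theorem exists_isProfile {p q : ℝ} (h : p < q) : ∃ f, IsProfile p q f ∧ ∃ x, f x ≠ 0 := by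
  let f : ContDiffBump ((p + q) / 2) := ⟨(q - p) / 8, (q - p) / 4, by linarith, by linarith⟩
  refine ⟨f, ⟨f.contDiff, ?_⟩, (p + q) / 2, ?_⟩
  · rw [f.tsupport_eq, Real.closedBall_eq_Icc]
    intro x hx
    simp only [f] at hx
    exact ⟨by linarith [hx.1], by linarith [hx.2]⟩
  · rw [f.one_of_mem_closedBall (Metric.mem_closedBall_self (by simp only [f]; linarith))]
    norm_num

/-- A pair of profiles for which the leading terms of the second order expansion cancel. -/
theorem exists_profile_pair {p q : ℝ} (hpq : p < q) : ∃ f h : ℝ → ℝ, IsProfile p q f ∧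
    IsProfile p q h ∧
    ∫ x in p..q, deriv (deriv f) x * deriv (deriv h) x = 0 ∧
    ∫ x in p..q, x * (deriv (deriv f) x * deriv (deriv h) x) = 0 ∧
    ∫ x in p..q, deriv (deriv f) x * deriv h x = 1 := by
  obtain ⟨f, hf, hf0⟩ := exists_isProfile hpq
  have hf2 := hf.deriv.deriv
  have hf3 := hf2.deriv
  have hf4 := hf3.deriv
  have hf5 := hf4.deriv
  have ha := hf2.integral_sq_pos (hf.deriv.deriv_ne_zero (hf.deriv_ne_zero hf0))
  have hb := hf3.integral_sq_pos (hf2.deriv_ne_zero (hf.deriv.deriv_ne_zero (hf.deriv_ne_zero hf0)))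
  set g := deriv (deriv f) with hg
  set a := ∫ x in p..q, g x * g x with ha'
  set b := ∫ x in p..q, deriv g x * deriv g x with hb'
  -- With g = f'', a = ∫g² and b = ∫g'², try h = c(f' + al·f'''). The integral of g h'' vanishes for
  -- any al, since ∫gg' = ∫gg''' = 0. The moment ∫x g h'' = c(-a/2 + 3·al·b/2) vanishes for al =
  -- a/(3b). Then ∫g h' = c(a - al·b) = 2ac/3, which fixes c.
  set c := 3 / (2 * a) with hc
  set al := a / (3 * b) with hal
  have hh : ∀ x, HasDerivAt (fun x => c * (deriv f x + al * deriv g x))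
      (c * (g x + al * deriv (deriv g) x)) x := fun x =>
    ((hf.deriv.hasDerivAt x).add ((hf3.hasDerivAt x).const_mul al)).const_mul c
  have hh1 : deriv (fun x => c * (deriv f x + al * deriv g x))
      = fun x => c * (g x + al * deriv (deriv g) x) := funext fun x => (hh x).deriv
  have hh2 : deriv (deriv (fun x => c * (deriv f x + al * deriv g x)))
      = fun x => c * (deriv g x + al * deriv (deriv (deriv g)) x) := by
    rw [hh1]
    exact funext fun x =>
      (((hf2.hasDerivAt x).add ((hf4.hasDerivAt x).const_mul al)).const_mul c).deriv
  have c2 := hf2.continuous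
  have c3 := hf3.continuous
  have c4 := hf4.continuous
  have c5 := hf5.continuous
  have i1 : ∫ x in p..q, g x * deriv g x = 0 := by
    have := hf2.by_parts hf2
    have e : ∫ x in p..q, deriv g x * g x = ∫ x in p..q, g x * deriv g x := by simp only [mul_comm]
    linarith
  have i2 : ∫ x in p..q, g x * deriv (deriv (deriv g)) x = 0 := by
    have h1 := hf2.by_parts hf4
    have h2 := hf3.by_parts hf3
    have e : ∫ x in p..q, deriv (deriv g) x * deriv g x
        = ∫ x in p..q, deriv g x * deriv (deriv g) x := by simp only [mul_comm]
    linarith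
  have i3 : ∫ x in p..q, g x * deriv (deriv g) x = -b := by
    have h1 := hf2.by_parts hf3
    linarith
  have i4 : ∫ x in p..q, x * (g x * deriv g x) = -(a / 2) := by
    have h1 := hf2.by_parts_mul hf2
    have e : ∫ x in p..q, x * (deriv g x * g x) = ∫ x in p..q, x * (g x * deriv g x) := by
      simp only [mul_comm]
    linarith
  have i5 : ∫ x in p..q, x * (deriv g x * deriv (deriv g) x) = -(b / 2) := by
    have h1 := hf3.by_parts_mul hf3
    have e : ∫ x in p..q, x * (deriv (deriv g) x * deriv g x)
        = ∫ x in p..q, x * (deriv g x * deriv (deriv g) x) := by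
      simp only [mul_comm]
    linarith
  have i6 : ∫ x in p..q, x * (g x * deriv (deriv (deriv g)) x) = 3 * b / 2 := by
    have h1 := hf2.by_parts_mul hf4
    linarith
  refine ⟨f, fun x => c * (deriv f x + al * deriv g x), hf,
    (hf.deriv.add (hf3.const_mul al)).const_mul c, ?_, ?_, ?_⟩
  · rw [hh2]
    have e : (fun x => g x * (c * (deriv g x + al * deriv (deriv (deriv g)) x)))
        = fun x => c * (g x * deriv g x) + c * al * (g x * deriv (deriv (deriv g)) x) := by
      ext x; ring
    simp only [← hg] at *
    rw [e, intervalIntegral.integral_add (Continuous.intervalIntegrable (by fun_prop) _ _)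
      (Continuous.intervalIntegrable (by fun_prop) _ _), intervalIntegral.integral_const_mul,
      intervalIntegral.integral_const_mul, i1, i2]
    ring
  · rw [hh2]
    have e : (fun x => x * (g x * (c * (deriv g x + al * deriv (deriv (deriv g)) x))))
        = fun x => c * (x * (g x * deriv g x))
          + c * al * (x * (g x * deriv (deriv (deriv g)) x)) := by
      ext x; ring
    rw [e, intervalIntegral.integral_add (Continuous.intervalIntegrable (by fun_prop) _ _)
      (Continuous.intervalIntegrable (by fun_prop) _ _), intervalIntegral.integral_const_mul,
      intervalIntegral.integral_const_mul, i4, i6, hal]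
    field_simp
    ring
  · rw [hh1]
    have e : (fun x => g x * (c * (g x + al * deriv (deriv g) x)))
        = fun x => c * (g x * g x) + c * al * (g x * deriv (deriv g) x) := by
      ext x; ring
    rw [e, intervalIntegral.integral_add (Continuous.intervalIntegrable (by fun_prop) _ _)
      (Continuous.intervalIntegrable (by fun_prop) _ _), intervalIntegral.integral_const_mul,
      intervalIntegral.integral_const_mul, i3, ← ha', hal, hc]
    field_simp
    ring

end Profiles

/-! ### Second order terms of rescaled profiles -/

section ConcentratedControls

variable {𝔸 : Type*} [NormedRing 𝔸] [NormedAlgebra ℝ 𝔸]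

theorem commInt_linSum {β γ : Type*} [Fintype β] [Fintype γ] {T : ℝ} {g : β → ℝ → 𝔸}
    {h : γ → ℝ → 𝔸} (hg : ∀ c, Continuous (g c)) (hh : ∀ c, Continuous (h c)) (ξ : β → ℝ)
    (ζ : γ → ℝ) :
    commInt T (fun s => linSum (fun c => g c s) ξ) (fun s => linSum (fun c => h c s) ζ)
      = bilinSum (fun c d => commInt T (g c) (h d)) ξ ζ := by
  have hV : ∀ c, Continuous (volterra (h c) 1) := fun c => continuous_volterra (hh c) continuous_one
  have e0 : volterra (fun s => linSum (fun c => h c s) ζ) 1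
      = fun t => linSum (fun c => volterra (h c) 1 t) ζ := funext fun t => volterra_linSum_one hh ζ t
  have e1 : bilinSum (fun d c => volterra (volterra (h d) 1) (g c) T) ζ ξ
      = bilinSum (fun c d => volterra (volterra (h d) 1) (g c) T) ξ ζ := by
    simp only [bilinSum]
    rw [Finset.sum_comm]
    simp only [mul_comm]
  rw [commInt, e0, volterra_linSum hg hV, volterra_linSum hV hg, e1]
  simp only [bilinSum, commInt, ← Finset.sum_sub_distrib, Finset.smul_sum, ← smul_sub]
  refine Finset.sum_congr rfl fun c _ => Finset.sum_congr rfl fun d _ => ?_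
  exact smul_comm _ _ _

theorem commInt_smul_const [CompleteSpace 𝔸] {T : ℝ} {a b : ℝ → ℝ} (x y : 𝔸) :
    commInt T (fun s => a s • x) (fun s => b s • y)
      = (1 / 2 * ∫ t in (0 : ℝ)..T, a t * ∫ s in (0 : ℝ)..t, b s) • (x * y - y * x) := by
  simp only [commInt, volterra, Pi.one_apply, mul_one, intervalIntegral.integral_smul_const,
    smul_mul_smul_comm]
  simp only [mul_comm]
  module

theorem volterra_comp_div {g h : ℝ → 𝔸} {δ : ℝ} (hδ : δ ≠ 0) (t : ℝ) :
    volterra (fun s => g (s / δ)) (fun s => h (s / δ)) t = δ • volterra g h (t / δ) := by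
  simp only [volterra]
  rw [intervalIntegral.integral_comp_div (fun s => g s * h s) hδ, zero_div]

theorem commInt_comp_div {T : ℝ} {g h : ℝ → 𝔸} {δ : ℝ} (hδ : δ ≠ 0) :
    commInt T (fun s => g (s / δ)) (fun s => h (s / δ)) = δ ^ 2 • commInt (T / δ) g h := by
  have e : volterra (fun s => h (s / δ)) 1 = fun t => (δ • volterra h 1) (t / δ) :=
    funext fun t => volterra_comp_div (h := 1) hδ t
  have e1 : ∀ t, volterra g (δ • volterra h 1) t = δ • volterra g (volterra h 1) t := fun t => by
    simp [volterra]
  have e2 : ∀ t, volterra (δ • volterra h 1) g t = δ • volterra (volterra h 1) g t := fun t => by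
    simp [volterra]
  rw [commInt, commInt, e, volterra_comp_div hδ, volterra_comp_div hδ, e1, e2]
  module

theorem commInt_eq_of_eq_zero {M X : ℝ} (hMX : M ≤ X) {g h : ℝ → 𝔸} (hg : Continuous g)
    (hh : Continuous h) (h0 : ∀ t ∈ Icc M X, g t = 0) : commInt X g h = commInt M g h := by
  have hV := continuous_volterra hh (continuous_one (X := ℝ) (M := 𝔸))
  have key : ∀ {F : ℝ → 𝔸}, Continuous F → (∀ t ∈ Icc M X, F t = 0) →
      ∫ t in (0 : ℝ)..X, F t = ∫ t in (0 : ℝ)..M, F t := by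
    intro F hF hF0
    rw [← intervalIntegral.integral_add_adjacent_intervals (hF.intervalIntegrable 0 M)
      (hF.intervalIntegrable M X), intervalIntegral.integral_congr (a := M) (b := X) (g := fun _ => 0)
      (fun t ht => hF0 t (by rwa [uIcc_of_le hMX] at ht))]
    simp
  simp only [commInt]
  congr 2
  · exact key (hg.mul hV) fun t ht => by simp [h0 t ht]
  · exact key (hV.mul hg) fun t ht => by simp [h0 t ht]

namespace IsProfile

variable {M : ℝ} {f g : ℝ → ℝ}

theorem eq_zero_left (hf : IsProfile 0 M f) : f 0 = 0 := hf.eq_zero (by simp)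

theorem integral_deriv (hg : IsProfile 0 M g) (t : ℝ) :
    ∫ s in (0 : ℝ)..t, _root_.deriv g s = g t := by
  rw [intervalIntegral.integral_eq_sub_of_hasDerivAt (fun x _ => hg.hasDerivAt x)
    (hg.deriv.continuous.intervalIntegrable _ _), hg.eq_zero_left, sub_zero]

theorem integral_mul_deriv₂ (hg : IsProfile 0 M g) (t : ℝ) :
    ∫ s in (0 : ℝ)..t, _root_.deriv (_root_.deriv g) s * s = t * _root_.deriv g t - g t := by
  have h : ∀ x, HasDerivAt (fun s => s * _root_.deriv g s - g s)
      (_root_.deriv (_root_.deriv g) x * x) x := fun x => by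
    refine (((hasDerivAt_id x).fun_mul (hg.deriv.hasDerivAt x)).fun_sub (hg.hasDerivAt x)).congr_deriv ?_
    simp only [id_eq]; ring
  have := hg.deriv.deriv.continuous
  rw [intervalIntegral.integral_eq_sub_of_hasDerivAt (fun x _ => h x)
    (Continuous.intervalIntegrable (by fun_prop) _ _), hg.eq_zero_left]
  ring

/-- Controls are third derivatives so that their primitives against 1, s and s²/2 are explicit and
again compactly supported; the later integrations by parts then have no boundary terms. -/
theorem integral_mul_deriv₃ (hg : IsProfile 0 M g) (t : ℝ) :
    ∫ s in (0 : ℝ)..t, _root_.deriv (_root_.deriv (_root_.deriv g)) s * (s ^ 2 / 2)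
      = t ^ 2 / 2 * _root_.deriv (_root_.deriv g) t - t * _root_.deriv g t + g t := by
  have h : ∀ x, HasDerivAt (fun s => s ^ 2 / 2 * _root_.deriv (_root_.deriv g) s
      - s * _root_.deriv g s + g s)
      (_root_.deriv (_root_.deriv (_root_.deriv g)) x * (x ^ 2 / 2)) x := fun x => by
    refine (((((hasDerivAt_pow 2 x).div_const 2).fun_mul (hg.deriv.deriv.hasDerivAt x)).fun_sub
      ((hasDerivAt_id x).fun_mul (hg.deriv.hasDerivAt x))).fun_add (hg.hasDerivAt x)).congr_deriv ?_
    simp only [id_eq]; push_cast; ring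
  have := hg.deriv.deriv.deriv.continuous
  rw [intervalIntegral.integral_eq_sub_of_hasDerivAt (fun x _ => h x)
    (Continuous.intervalIntegrable (by fun_prop) _ _), hg.eq_zero_left]
  ring

end IsProfile

/-- The monomials `1`, `t`, `t²/2`. -/
noncomputable def taylorMonomial (i : Fin 3) (t : ℝ) : ℝ := ![1, t, t ^ 2 / 2] i

theorem continuous_taylorMonomial (i : Fin 3) : Continuous (taylorMonomial i) := by
  fin_cases i
  · exact continuous_const
  · exact continuous_id
  · exact (continuous_pow 2).div_const 2

/-- The iterated integrals `∫_0^M f'''(t) t^i/i! ∫_0^t g'''(s) s^j/j!`. -/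
noncomputable def profileMoment (M : ℝ) (f g : ℝ → ℝ) (i j : Fin 3) : ℝ :=
  ∫ t in (0 : ℝ)..M, deriv (deriv (deriv f)) t * taylorMonomial i t *
    ∫ s in (0 : ℝ)..t, deriv (deriv (deriv g)) s * taylorMonomial j s

/-- Insert the explicit inner integrals and integrate by parts. These are the only combinations that
matter: they multiply the three vectors c, D and e in `map_commInt_taylor`. -/
theorem profileMoment_identities {M : ℝ} {f g : ℝ → ℝ} (hf : IsProfile 0 M f)
    (hg : IsProfile 0 M g) :
    profileMoment M f g 1 0 - profileMoment M f g 0 1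
      = -∫ x in (0 : ℝ)..M, deriv (deriv f) x * deriv (deriv g) x ∧
    profileMoment M f g 2 0 - profileMoment M f g 0 2
      = -∫ x in (0 : ℝ)..M, x * (deriv (deriv f) x * deriv (deriv g) x) ∧
    profileMoment M f g 1 1 - profileMoment M f g 2 0 - profileMoment M f g 0 2
      = ∫ x in (0 : ℝ)..M, deriv (deriv f) x * deriv g x := by
  have j0 : ∀ t, ∫ s in (0 : ℝ)..t, deriv (deriv (deriv g)) s * taylorMonomial 0 s
      = deriv (deriv g) t := fun t => by
    simp only [taylorMonomial, Matrix.cons_val_zero, mul_one]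
    exact hg.deriv.deriv.integral_deriv t
  have j1 : ∀ t, ∫ s in (0 : ℝ)..t, deriv (deriv (deriv g)) s * taylorMonomial 1 s
      = t * deriv (deriv g) t - deriv g t := fun t => hg.deriv.integral_mul_deriv₂ t
  have j2 : ∀ t, ∫ s in (0 : ℝ)..t, deriv (deriv (deriv g)) s * taylorMonomial 2 s
      = t ^ 2 / 2 * deriv (deriv g) t - t * deriv g t + g t := fun t => hg.integral_mul_deriv₃ t
  have c0 := hg.continuous
  have c1 := hg.deriv.continuous
  have c2 := hg.deriv.deriv.continuous
  have c2f := hf.deriv.deriv.continuous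
  have c3 := hf.deriv.deriv.deriv.continuous
  have cm := continuous_taylorMonomial
  have m0 : ∀ t, taylorMonomial 0 t = 1 := fun t => rfl
  have m1 : ∀ t, taylorMonomial 1 t = t := fun t => rfl
  have m2 : ∀ t, taylorMonomial 2 t = t ^ 2 / 2 := fun t => rfl
  simp only [profileMoment, j0, j1, j2]
  refine ⟨?_, ?_, ?_⟩
  · rw [← intervalIntegral.integral_sub (Continuous.intervalIntegrable (by fun_prop) _ _)
      (Continuous.intervalIntegrable (by fun_prop) _ _), ← hf.deriv.deriv.by_parts hg.deriv]
    congr 1; ext t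
    rw [m0, m1]; ring
  · have h1 := hf.deriv.deriv.by_parts_mul hg.deriv
    have h2 := hf.deriv.deriv.by_parts hg
    rw [← intervalIntegral.integral_sub (Continuous.intervalIntegrable (by fun_prop) _ _)
      (Continuous.intervalIntegrable (by fun_prop) _ _)]
    have e : ∫ t in (0 : ℝ)..M, (deriv (deriv (deriv f)) t * taylorMonomial 2 t * deriv (deriv g) t
        - deriv (deriv (deriv f)) t * taylorMonomial 0 t
          * (t ^ 2 / 2 * deriv (deriv g) t - t * deriv g t + g t))
        = (∫ t in (0 : ℝ)..M, t * (deriv (deriv (deriv f)) t * deriv g t))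
          - ∫ t in (0 : ℝ)..M, deriv (deriv (deriv f)) t * g t := by
      rw [← intervalIntegral.integral_sub (Continuous.intervalIntegrable (by fun_prop) _ _)
        (Continuous.intervalIntegrable (by fun_prop) _ _)]
      congr 1; ext t
      rw [m0, m2]; ring
    rw [e, h1, h2]; ring
  · have h2 := hf.deriv.deriv.by_parts hg
    rw [← intervalIntegral.integral_sub (Continuous.intervalIntegrable (by fun_prop) _ _)
      (Continuous.intervalIntegrable (by fun_prop) _ _), ← intervalIntegral.integral_sub
      (Continuous.intervalIntegrable (by fun_prop) _ _)
      (Continuous.intervalIntegrable (by fun_prop) _ _)]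
    rw [← neg_eq_iff_eq_neg] at h2
    rw [← h2, ← intervalIntegral.integral_neg]
    congr 1; ext t
    rw [m0, m1, m2]; ring

variable [CompleteSpace 𝔸]

/-- The projected second order term of quadratic Taylor polynomials. -/
theorem map_commInt_taylor {F : Type*} [NormedAddCommGroup F] [NormedSpace ℝ F] (φ : 𝔸 →L[ℝ] F)
    {M : ℝ} {f g : ℝ → ℝ} (hf : IsProfile 0 M f) (hg : IsProfile 0 M g) {x y : Fin 3 → 𝔸}
    {c D e : F} (h00 : φ (x 0 * y 0 - y 0 * x 0) = 0) (h10 : φ (x 1 * y 0 - y 0 * x 1) = c)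
    (h01 : φ (x 0 * y 1 - y 1 * x 0) = -c) (h11 : φ (x 1 * y 1 - y 1 * x 1) = e)
    (h20 : φ (x 2 * y 0 - y 0 * x 2) = D - e) (h02 : φ (x 0 * y 2 - y 2 * x 0) = -D - e) :
    ∃ K : ℝ, ∀ δ : ℝ, 0 < δ → δ ≤ 1 →
      ‖(δ ^ 2)⁻¹ • φ (commInt M
          (fun t => deriv (deriv (deriv f)) t • ∑ i, taylorMonomial i (δ * t) • x i)
          (fun t => deriv (deriv (deriv g)) t • ∑ i, taylorMonomial i (δ * t) • y i))
        - (1 / 2 : ℝ) • (-(δ⁻¹ * ∫ x in (0 : ℝ)..M, deriv (deriv f) x * deriv (deriv g) x) • c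
          - (∫ x in (0 : ℝ)..M, x * (deriv (deriv f) x * deriv (deriv g) x)) • D
          + (∫ x in (0 : ℝ)..M, deriv (deriv f) x * deriv g x) • e)‖ ≤ K * δ := by
  obtain ⟨i1, i2, i3⟩ := profileMoment_identities hf hg
  set I := profileMoment M f g
  have c3 := hf.deriv.deriv.deriv.continuous
  have c3g := hg.deriv.deriv.deriv.continuous
  have cm := continuous_taylorMonomial
  -- The pair (i,j) of Taylor terms has weight δ^(i+j), divided by δ². Weight 0 drops out by `h00`,
  -- and weights 1 and 2 give the stated limit. Y and Y' collect weights 3 and 4.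
  set Y : F := (1 / 2 * I 1 2) • φ (x 1 * y 2 - y 2 * x 1)
    + (1 / 2 * I 2 1) • φ (x 2 * y 1 - y 1 * x 2)
  set Y' : F := (1 / 2 * I 2 2) • φ (x 2 * y 2 - y 2 * x 2)
  refine ⟨‖Y‖ + ‖Y'‖, fun δ hδ hδ1 => ?_⟩
  have hpoly : ∀ (f : ℝ → ℝ) (x : Fin 3 → 𝔸),
      (fun t => deriv (deriv (deriv f)) t • ∑ i, taylorMonomial i (δ * t) • x i)
      = fun t => linSum (fun i => (deriv (deriv (deriv f)) t * taylorMonomial i t) • x i)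
        ![1, δ, δ ^ 2] := by
    intro f x
    ext t
    simp only [linSum, Fin.sum_univ_three, taylorMonomial]
    simp
    module
  have h : φ (commInt M
          (fun t => deriv (deriv (deriv f)) t • ∑ i, taylorMonomial i (δ * t) • x i)
          (fun t => deriv (deriv (deriv g)) t • ∑ i, taylorMonomial i (δ * t) • y i))
      = ∑ i, ∑ j, (![1, δ, δ ^ 2] i * ![1, δ, δ ^ 2] j) •
          (1 / 2 * I i j) • φ (x i * y j - y j * x i) := by
    rw [hpoly, hpoly, commInt_linSum (fun i => by fun_prop) (fun i => by fun_prop), bilinSum, map_sum]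
    refine Finset.sum_congr rfl fun i _ => ?_
    rw [map_sum]
    refine Finset.sum_congr rfl fun j _ => ?_
    rw [map_smul, commInt_smul_const, map_smul]
    rfl
  have h' : (δ ^ 2)⁻¹ • φ (commInt M
          (fun t => deriv (deriv (deriv f)) t • ∑ i, taylorMonomial i (δ * t) • x i)
          (fun t => deriv (deriv (deriv g)) t • ∑ i, taylorMonomial i (δ * t) • y i))
        - (1 / 2 : ℝ) • (-(δ⁻¹ * ∫ x in (0 : ℝ)..M, deriv (deriv f) x * deriv (deriv g) x) • c
          - (∫ x in (0 : ℝ)..M, x * (deriv (deriv f) x * deriv (deriv g) x)) • D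
          + (∫ x in (0 : ℝ)..M, deriv (deriv f) x * deriv g x) • e) = δ • Y + δ ^ 2 • Y' := by
    rw [h, ← i3, show (∫ x in (0 : ℝ)..M, deriv (deriv f) x * deriv (deriv g) x)
      = -(I 1 0 - I 0 1) by rw [i1, neg_neg],
      show (∫ x in (0 : ℝ)..M, x * (deriv (deriv f) x * deriv (deriv g) x))
      = -(I 2 0 - I 0 2) by rw [i2, neg_neg]]
    simp only [Fin.sum_univ_three, h00, h10, h01, h11, h20, h02, Y, Y']
    simp
    match_scalars <;> field_simp <;> ring
  rw [h']
  refine (norm_add_le _ _).trans ?_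
  rw [norm_smul, norm_smul, Real.norm_of_nonneg hδ.le, Real.norm_of_nonneg (by positivity)]
  have : δ ^ 2 * ‖Y'‖ ≤ δ * ‖Y'‖ := by gcongr; nlinarith
  linarith

end ConcentratedControls

/-! ### Controls concentrated at time 0 -/

section ConcentratedControls

variable {𝔸 : Type*} [NormedRing 𝔸] [NormedAlgebra ℝ 𝔸]

/-- The control `δ⁻² f'''(t/δ)`. -/
noncomputable def concentrate (δ : ℝ) (f : ℝ → ℝ) (t : ℝ) : ℝ :=
  (δ ^ 2)⁻¹ * deriv (deriv (deriv f)) (t / δ)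

theorem commInt_smul_smul {T : ℝ} (r : ℝ) (g h : ℝ → 𝔸) :
    commInt T (fun t => r • g t) (fun t => r • h t) = r ^ 2 • commInt T g h := by
  have e : volterra (fun t => r • h t) 1 = fun t => r • volterra h 1 t := by
    ext t; simp [volterra]
  rw [commInt, commInt, e]
  simp only [volterra, smul_mul_assoc, mul_smul_comm, intervalIntegral.integral_smul]
  module

theorem continuous_concentrate {M δ : ℝ} {f : ℝ → ℝ} (hf : IsProfile 0 M f) :
    Continuous (concentrate δ f) := by
  have := hf.deriv.deriv.deriv.continuous
  unfold concentrate
  fun_prop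

/-- Uniform bound for a profile and a rescaled path with a Taylor expansion. -/
theorem exists_profile_smul_bounds {M T : ℝ} (hT : 0 < T) {f : ℝ → ℝ}
    (hf : IsProfile 0 M f) {b : ℝ → 𝔸} (hb : Continuous b) {x : Fin 3 → 𝔸} {C : ℝ}
    (hC : ∀ t ∈ Icc 0 T, ‖b t - ∑ i, taylorMonomial i t • x i‖ ≤ C * t ^ 3) :
    ∃ G ≥ (0 : ℝ), ∀ δ : ℝ, 0 < δ → δ ≤ 1 → δ * M ≤ T → ∀ t ∈ Icc 0 M,
      ‖deriv (deriv (deriv f)) t • b (δ * t)‖ ≤ G ∧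
      ‖deriv (deriv (deriv f)) t • ∑ i, taylorMonomial i (δ * t) • x i‖ ≤ G ∧
      ‖deriv (deriv (deriv f)) t • b (δ * t)
        - deriv (deriv (deriv f)) t • ∑ i, taylorMonomial i (δ * t) • x i‖ ≤ G * δ ^ 3 := by
  obtain ⟨c, hc⟩ := isCompact_Icc.exists_bound_of_continuousOn
    (hf.deriv.deriv.deriv.continuous.continuousOn (s := Icc 0 M))
  obtain ⟨β, hβ⟩ := isCompact_Icc.exists_bound_of_continuousOn (hb.continuousOn (s := Icc 0 T))
  have hC0 : 0 ≤ C := by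
    have := (norm_nonneg _).trans (hC T ⟨hT.le, le_rfl⟩)
    exact nonneg_of_mul_nonneg_left this (by positivity)
  have hβ0 : 0 ≤ β := (norm_nonneg _).trans (hβ 0 ⟨le_rfl, hT.le⟩)
  rcases lt_or_ge M 0 with hM | hM
  · exact ⟨0, le_rfl, fun δ _ _ _ t ht => absurd (ht.1.trans ht.2) (not_le.2 hM)⟩
  have hc0 : 0 ≤ c := (norm_nonneg _).trans (hc 0 ⟨le_rfl, hM⟩)
  refine ⟨c * β + c * (C * M ^ 3), by positivity, fun δ hδ hδ1 hδM t ht => ?_⟩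
  have hδt : δ * t ∈ Icc 0 T :=
    ⟨mul_nonneg hδ.le ht.1, (mul_le_mul_of_nonneg_left ht.2 hδ.le).trans hδM⟩
  have h1 := hc t ht
  have h2 := hβ _ hδt
  have a1 : ‖deriv (deriv (deriv f)) t • b (δ * t)‖ ≤ c * β := by
    rw [norm_smul]; gcongr
  have ht3 : t ^ 3 ≤ M ^ 3 := pow_le_pow_left₀ ht.1 ht.2 3
  have a2 : ‖deriv (deriv (deriv f)) t • b (δ * t)
        - deriv (deriv (deriv f)) t • ∑ i, taylorMonomial i (δ * t) • x i‖
        ≤ c * (C * M ^ 3) * δ ^ 3 := by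
    rw [← smul_sub, norm_smul]
    calc _ ≤ c * (C * (δ * t) ^ 3) := by
          have := hC _ hδt
          gcongr
      _ = c * (C * t ^ 3) * δ ^ 3 := by ring
      _ ≤ _ := by gcongr
  have hp : 0 ≤ c * (C * M ^ 3) := by positivity
  have hq : 0 ≤ c * β := by positivity
  refine ⟨by linarith, ?_, ?_⟩
  · have := norm_le_norm_add_norm_sub (deriv (deriv (deriv f)) t • b (δ * t))
      (deriv (deriv (deriv f)) t • ∑ i, taylorMonomial i (δ * t) • x i)
    have : c * (C * M ^ 3) * δ ^ 3 ≤ c * (C * M ^ 3) * 1 := by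
      gcongr; exact pow_le_one₀ hδ.le hδ1
    linarith
  · refine a2.trans ?_
    gcongr
    linarith

variable [CompleteSpace 𝔸]

/-- The projected second order term of controls concentrated at time `0`. -/
theorem exists_commInt_concentrate_bound {F : Type*} [NormedAddCommGroup F] [NormedSpace ℝ F]
    (φ : 𝔸 →L[ℝ] F) {M T : ℝ} (hM : 0 < M) (hT : 0 < T) {f g : ℝ → ℝ} (hf : IsProfile 0 M f)
    (hg : IsProfile 0 M g) {b b' : ℝ → 𝔸} (hb : Continuous b) (hb' : Continuous b')
    {x y : Fin 3 → 𝔸} {C C' : ℝ}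
    (hx : ∀ t ∈ Icc 0 T, ‖b t - ∑ i, taylorMonomial i t • x i‖ ≤ C * t ^ 3)
    (hy : ∀ t ∈ Icc 0 T, ‖b' t - ∑ i, taylorMonomial i t • y i‖ ≤ C' * t ^ 3)
    {c D e : F} (h00 : φ (x 0 * y 0 - y 0 * x 0) = 0) (h10 : φ (x 1 * y 0 - y 0 * x 1) = c)
    (h01 : φ (x 0 * y 1 - y 1 * x 0) = -c) (h11 : φ (x 1 * y 1 - y 1 * x 1) = e)
    (h20 : φ (x 2 * y 0 - y 0 * x 2) = D - e) (h02 : φ (x 0 * y 2 - y 2 * x 0) = -D - e) :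
    ∃ K : ℝ, ∀ δ : ℝ, 0 < δ → δ ≤ 1 → δ * M ≤ T →
      ‖φ (commInt T (fun t => concentrate δ f t • b t) (fun t => concentrate δ g t • b' t))
        - (1 / 2 : ℝ) • (-(δ⁻¹ * ∫ x in (0 : ℝ)..M, deriv (deriv f) x * deriv (deriv g) x) • c
          - (∫ x in (0 : ℝ)..M, x * (deriv (deriv f) x * deriv (deriv g) x)) • D
          + (∫ x in (0 : ℝ)..M, deriv (deriv f) x * deriv g x) • e)‖ ≤ K * δ := by
  obtain ⟨K, hK⟩ := map_commInt_taylor φ hf hg h00 h10 h01 h11 h20 h02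
  obtain ⟨G, hG, h1⟩ := exists_profile_smul_bounds hT hf hb hx
  obtain ⟨G', hG', h2⟩ := exists_profile_smul_bounds hT hg hb' hy
  have c3 := hf.deriv.deriv.deriv.continuous
  have c3g := hg.deriv.deriv.deriv.continuous
  have cm := continuous_taylorMonomial
  set L := ‖φ‖ * (2 * M ^ 2 * (G + G') * ‖(1 : 𝔸)‖ * (G + G'))
  refine ⟨K + L, fun δ hδ hδ1 hδM => ?_⟩
  -- The two amplitudes give δ⁻⁴ and the change of time in a double integral gives δ². The profile
  -- vanishes beyond M, so the upper limit T/δ may be replaced by M.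
  have scale : commInt T (fun t => concentrate δ f t • b t) (fun t => concentrate δ g t • b' t)
      = (δ ^ 2)⁻¹ • commInt M (fun t => deriv (deriv (deriv f)) t • b (δ * t))
          (fun t => deriv (deriv (deriv g)) t • b' (δ * t)) := by
    have e : ∀ (f : ℝ → ℝ) (b : ℝ → 𝔸), (fun t => concentrate δ f t • b t)
        = fun t => (δ ^ 2)⁻¹ • (fun s => deriv (deriv (deriv f)) s • b (δ * s)) (t / δ) := by
      intro f b
      ext t
      simp only [concentrate, mul_smul]
      rw [mul_div_cancel₀ t hδ.ne']
    have hMT : M ≤ T / δ := by rw [le_div_iff₀ hδ]; linarith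
    rw [e, e, commInt_smul_smul, commInt_comp_div (g := fun s => deriv (deriv (deriv f)) s • b (δ * s))
      (h := fun s => deriv (deriv (deriv g)) s • b' (δ * s)) hδ.ne', commInt_eq_of_eq_zero hMT (by fun_prop)
      (by fun_prop) (fun t ht => by
        rw [hf.deriv.deriv.deriv.eq_zero (x := t) (fun h => absurd h.2 (not_lt.2 ht.1)), zero_smul]),
      smul_smul]
    congr 1
    field_simp
  -- Replacing b and b' by their Taylor polynomials costs δ³, hence only δ after the factor δ⁻².
  have hd := norm_commInt_sub_le (G := G + G') (d := (G + G') * δ ^ 3) hM.le (by positivity)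
    (by positivity) (g := fun t => deriv (deriv (deriv f)) t • b (δ * t))
    (h := fun t => deriv (deriv (deriv g)) t • b' (δ * t))
    (g' := fun t => deriv (deriv (deriv f)) t • ∑ i, taylorMonomial i (δ * t) • x i)
    (h' := fun t => deriv (deriv (deriv g)) t • ∑ i, taylorMonomial i (δ * t) • y i)
    (by fun_prop) (by fun_prop) (by fun_prop) (by fun_prop)
    (fun t ht => (h1 δ hδ hδ1 hδM t ht).1.trans (by linarith))
    (fun t ht => (h2 δ hδ hδ1 hδM t ht).1.trans (by linarith))
    (fun t ht => (h1 δ hδ hδ1 hδM t ht).2.1.trans (by linarith))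
    (fun t ht => (h2 δ hδ hδ1 hδM t ht).2.1.trans (by linarith))
    (fun t ht => (h1 δ hδ hδ1 hδM t ht).2.2.trans (by gcongr; linarith))
    (fun t ht => (h2 δ hδ hδ1 hδM t ht).2.2.trans (by gcongr; linarith))
  rw [scale, map_smul]
  refine (norm_sub_le_norm_sub_add_norm_sub _ _ _).trans
    ((add_le_add ?_ (hK δ hδ hδ1)).trans_eq (by rw [add_comm K L, add_mul] : L * δ + K * δ = _))
  rw [← smul_sub, ← map_sub, norm_smul, norm_inv, Real.norm_of_nonneg (by positivity)]
  calc _ ≤ (δ ^ 2)⁻¹ * (‖φ‖ * (2 * M ^ 2 * (G + G') * ‖(1 : 𝔸)‖ * ((G + G') * δ ^ 3))) := by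
        gcongr
        exact (φ.le_opNorm _).trans (by gcongr)
    _ = L * δ := by
        simp only [L]; field_simp

end ConcentratedControls

/-! ### Consequences of the products of control matrices being zero -/

section BracketAlgebra

variable {m k : ℕ} {T : ℝ} {A : ℝ → Mat m}

theorem bracketSeq_one (B : Mat m) (t : ℝ) :
    bracketSeq T A B 1 t = B * A t - A t * B := by
  have : derivWithin (bracketSeq T A B 0) (Icc 0 T) t = 0 :=
    congrFun (derivWithin_const (Icc 0 T) B) t
  change derivWithin (bracketSeq T A B 0) (Icc 0 T) t + (B * A t - A t * B) = _
  rw [this, zero_add]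

theorem bracketSeq_two (hT : 0 < T) (hA : ContDiffOn ℝ ∞ A (Icc 0 T)) (B : Mat m) :
    bracketSeq T A B 2 0 = B * derivWithin A (Icc 0 T) 0 - derivWithin A (Icc 0 T) 0 * B
      + ((B * A 0 - A 0 * B) * A 0 - A 0 * (B * A 0 - A 0 * B)) := by
  have h0 : (0 : ℝ) ∈ Icc 0 T := ⟨le_rfl, hT.le⟩
  have hd : HasDerivWithinAt A (derivWithin A (Icc 0 T) 0) (Icc 0 T) 0 :=
    (hA.differentiableOn (by simp) 0 h0).hasDerivWithinAt
  have h1 : derivWithin (bracketSeq T A B 1) (Icc 0 T) 0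
      = B * derivWithin A (Icc 0 T) 0 - derivWithin A (Icc 0 T) 0 * B := by
    rw [show bracketSeq T A B 1 = fun t => B * A t - A t * B from
      funext fun t => bracketSeq_one B t]
    exact ((hd.const_mul B).sub (hd.mul_const B)).derivWithin (uniqueDiffOn_Icc hT 0 h0)
  change derivWithin (bracketSeq T A B 1) (Icc 0 T) 0
    + (bracketSeq T A B 1 0 * A 0 - A 0 * bracketSeq T A B 1 0) = _
  rw [h1, bracketSeq_one]

/-- This is the Leibniz rule at t = 0 for (S⁻¹BS)(S⁻¹B'S) = 0, in algebraic form. -/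
theorem bracketSeq_mul_one {B B' : Mat m} (h : B * B' = 0) :
    B * bracketSeq T A B' 1 0 = -(bracketSeq T A B 1 0 * B') := by
  rw [bracketSeq_one, bracketSeq_one]
  have e1 : B * (B' * A 0 - A 0 * B') = B * B' * A 0 - B * A 0 * B' := by noncomm_ring
  have e2 : (B * A 0 - A 0 * B) * B' = B * A 0 * B' - A 0 * (B * B') := by noncomm_ring
  rw [e1, e2, h]; noncomm_ring

/-- The second order Leibniz rule for the same vanishing product. It expresses [B, B'^2] through
[B^2, B'] and [B^1, B'^1], leaving a single free vector D beside e. -/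
theorem bracketSeq_mul_two (hT : 0 < T) (hA : ContDiffOn ℝ ∞ A (Icc 0 T)) {B B' : Mat m}
    (h : B * B' = 0) :
    B * bracketSeq T A B' 2 0 = -(bracketSeq T A B 2 0 * B')
      - (2 : ℝ) • (bracketSeq T A B 1 0 * bracketSeq T A B' 1 0) := by
  rw [bracketSeq_two hT hA, bracketSeq_two hT hA, bracketSeq_one, bracketSeq_one, two_smul,
    eq_sub_iff_add_eq, eq_neg_iff_add_eq_zero]
  generalize derivWithin A (Icc 0 T) 0 = A'
  generalize A 0 = A₀
  calc _ = B * B' * A' - A' * (B * B') + B * B' * A₀ * A₀ + A₀ * A₀ * (B * B')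
        - (A₀ * (B * B') * A₀ + A₀ * (B * B') * A₀) := by noncomm_ring
    _ = 0 := by rw [h]; noncomm_ring

/-- The second order term of two concentrated scalar controls, modulo the kernel of `φ`. -/
theorem exists_pair_bound (hT : 0 < T) (hA : ContDiffOn ℝ ∞ A (Icc 0 T))
    (hAS : ∀ t ∈ Icc 0 T, A t ∈ spTangent m) {F : Type*} [NormedAddCommGroup F] [NormedSpace ℝ F]
    (φ : Mat m →L[ℝ] F) {B B' : Mat m} (h : B * B' = 0) (h' : B' * B = 0) {M : ℝ} (hM : 0 < M)
    {f g : ℝ → ℝ} (hf : IsProfile 0 M f) (hg : IsProfile 0 M g) :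
    ∃ K : ℝ, ∀ δ : ℝ, 0 < δ → δ ≤ 1 → δ * M ≤ T →
      ‖φ (commInt T (fun t => concentrate δ f t • conjCtrl T A B t)
          (fun t => concentrate δ g t • conjCtrl T A B' t))
        - (1 / 2 : ℝ) • (-(δ⁻¹ * ∫ x in (0 : ℝ)..M, deriv (deriv f) x * deriv (deriv g) x) •
            φ (bracketSeq T A B 1 0 * B' - B' * bracketSeq T A B 1 0)
          - (∫ x in (0 : ℝ)..M, x * (deriv (deriv f) x * deriv (deriv g) x)) •
            (φ (bracketSeq T A B 2 0 * B' - B' * bracketSeq T A B 2 0)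
              + φ (bracketSeq T A B 1 0 * bracketSeq T A B' 1 0
                - bracketSeq T A B' 1 0 * bracketSeq T A B 1 0))
          + (∫ x in (0 : ℝ)..M, deriv (deriv f) x * deriv g x) •
            φ (bracketSeq T A B 1 0 * bracketSeq T A B' 1 0
                - bracketSeq T A B' 1 0 * bracketSeq T A B 1 0))‖ ≤ K * δ := by
  obtain ⟨C, hC⟩ := exists_conjCtrl_taylor hT hA hAS B
  obtain ⟨C', hC'⟩ := exists_conjCtrl_taylor hT hA hAS B'
  have hsum : ∀ (B : Mat m) (t : ℝ),
      ∑ i : Fin 3, taylorMonomial i t • (fun i : Fin 3 => bracketSeq T A B i 0) i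
      = B + t • bracketSeq T A B 1 0 + (t ^ 2 / 2) • bracketSeq T A B 2 0 := by
    intro B t
    rw [Fin.sum_univ_three]
    simp [taylorMonomial, bracketSeq]
  refine exists_commInt_concentrate_bound φ hM hT hf hg (continuous_conjCtrl hT.le hA.continuousOn B)
    (continuous_conjCtrl hT.le hA.continuousOn B') (x := fun i : Fin 3 => bracketSeq T A B i 0)
    (y := fun i : Fin 3 => bracketSeq T A B' i 0) (fun t ht => by rw [hsum]; exact hC t ht)
    (fun t ht => by rw [hsum]; exact hC' t ht) ?_ rfl ?_ rfl ?_ ?_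
  · change φ (B * B' - B' * B) = 0
    rw [h, h', sub_zero, map_zero]
  · change φ (B * bracketSeq T A B' 1 0 - bracketSeq T A B' 1 0 * B)
      = -φ (bracketSeq T A B 1 0 * B' - B' * bracketSeq T A B 1 0)
    rw [bracketSeq_mul_one h, ← map_neg]
    congr 1
    have := bracketSeq_mul_one (T := T) (A := A) h'
    rw [this]
    abel
  · change φ (bracketSeq T A B 2 0 * B' - B' * bracketSeq T A B 2 0) = _
    exact (add_sub_cancel_right _ _).symm
  · change φ (B * bracketSeq T A B' 2 0 - bracketSeq T A B' 2 0 * B) = _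
    have h1 := bracketSeq_mul_two hT hA h
    have h2 : bracketSeq T A B' 2 0 * B = -(B' * bracketSeq T A B 2 0)
        - (2 : ℝ) • (bracketSeq T A B' 1 0 * bracketSeq T A B 1 0) := by
      rw [bracketSeq_mul_two hT hA h']; abel
    rw [h1, h2, ← map_add, ← map_neg, ← map_sub]
    congr 1
    module

end BracketAlgebra

/-! ### Almost orthogonal families of concentrated controls -/

section Controls

variable {m k : ℕ} {T : ℝ}

/-- The matrices `∑ u_i(t) S(t)⁻¹ B_i S(t)`. -/
noncomputable def ctrlComb (T : ℝ) (A : ℝ → Mat m) (B : Fin k → Mat m)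
    (u : ℝ → EuclideanSpace ℝ (Fin k)) (t : ℝ) : Mat m := ∑ i, u t i • conjCtrl T A (B i) t

/-- Smooth controls with support in `(0,T)`. -/
def IsControl (T : ℝ) (u : ℝ → EuclideanSpace ℝ (Fin k)) : Prop :=
  ContDiff ℝ ∞ u ∧ tsupport u ⊆ Ioo 0 T

theorem IsControl.add {u v : ℝ → EuclideanSpace ℝ (Fin k)} (hu : IsControl T u)
    (hv : IsControl T v) : IsControl T (fun t => u t + v t) :=
  ⟨hu.1.add hv.1, (tsupport_add u v).trans (union_subset hu.2 hv.2)⟩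

theorem IsProfile.isControl {f : ℝ → ℝ} (hf : IsProfile 0 T f) (v : EuclideanSpace ℝ (Fin k)) :
    IsControl T (fun t => f t • v) :=
  ⟨hf.1.smul contDiff_const, (tsupport_smul_subset_left f fun _ => v).trans hf.2⟩

theorem IsProfile.concentrate {M δ : ℝ} {f : ℝ → ℝ} (hf : IsProfile 0 M f) (hδ : 0 < δ)
    (hδM : δ * M ≤ T) : IsProfile 0 T (concentrate δ f) := by
  have h3 := hf.deriv.deriv.deriv
  refine ⟨contDiff_const.mul (h3.1.comp (contDiff_id.div_const δ)), ?_⟩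
  have hsub : tsupport (_root_.concentrate δ f)
      ⊆ (fun t => t / δ) ⁻¹' tsupport (_root_.deriv (_root_.deriv (_root_.deriv f))) := by
    refine closure_minimal (fun t ht => subset_tsupport _ ?_)
      ((isClosed_tsupport _).preimage (by fun_prop))
    intro h0
    exact ht (by simp [_root_.concentrate, h0])
  intro t ht
  have := h3.2 (hsub ht)
  rw [mem_Ioo, lt_div_iff₀ hδ, div_lt_iff₀ hδ] at this
  exact ⟨by linarith [this.1], by nlinarith [this.2]⟩

theorem ctrlComb_single (A : ℝ → Mat m) (B : Fin k → Mat m) (a : Fin 2 → ℝ → ℝ) (i : Fin 2 → Fin k) :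
    ctrlComb T A B (fun t => a 0 t • EuclideanSpace.single (i 0) 1
        + a 1 t • EuclideanSpace.single (i 1) 1)
      = fun t => linSum (fun c : Fin 2 => a c t • conjCtrl T A (B (i c)) t) 1 := by
  ext1 t
  simp [ctrlComb, linSum, add_smul, Finset.sum_add_distrib, ite_smul]

theorem integral_eq_of_support {p q M : ℝ} (h0 : 0 ≤ p) (hM : q ≤ M) {F : ℝ → ℝ}
    (hF : ∀ x ∉ Ioo p q, F x = 0) : ∫ x in (0 : ℝ)..M, F x = ∫ x in p..q, F x := by
  rw [intervalIntegral.integral_eq_integral_of_support_subset,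
    intervalIntegral.integral_eq_integral_of_support_subset]
  · intro x hx
    by_contra hn
    exact hx (hF x fun h => hn ⟨h.1, h.2.le⟩)
  · intro x hx
    by_contra hn
    exact hx (hF x fun h => hn ⟨h0.trans_lt h.1, h.2.le.trans hM⟩)

theorem IsProfile.mul_eq_zero {n n' : ℕ} (hn : n ≠ n') {f g : ℝ → ℝ} (hf : IsProfile n (n + 1) f)
    (hg : IsProfile n' (n' + 1) g) (x : ℝ) : f x * g x = 0 := by
  by_cases hx : x ∈ Ioo (n : ℝ) (n + 1)
  · rw [hg.eq_zero, mul_zero]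
    intro hx'
    have h1 : (n : ℝ) < n' + 1 := hx.1.trans hx'.2
    have h2 : (n' : ℝ) < n + 1 := hx'.1.trans hx.2
    norm_cast at h1 h2
    omega
  · rw [hf.eq_zero hx, zero_mul]

/-- Families of concentrated controls whose second order terms are almost orthogonal. -/
theorem exists_concentrated_controls (hT : 0 < T) {A : ℝ → Mat m} (hA : ContDiffOn ℝ ∞ A (Icc 0 T))
    (hAS : ∀ t ∈ Icc 0 T, A t ∈ spTangent m) {B : Fin k → Mat m} (hBB : ∀ i j, B i * B j = 0)
    {F : Type*} [NormedAddCommGroup F] [NormedSpace ℝ F] (φ : Mat m →L[ℝ] F)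
    (hφ1 : ∀ i, φ (bracketSeq T A (B i) 1 0 * B i - B i * bracketSeq T A (B i) 1 0) = 0)
    (hφ2 : ∀ i, φ (bracketSeq T A (B i) 2 0 * B i - B i * bracketSeq T A (B i) 2 0) = 0)
    {β : Type*} [Fintype β] [DecidableEq β] (σ : β → Fin k × Fin k) {η : ℝ} (hη : 0 < η) :
    ∃ w : β → ℝ → EuclideanSpace ℝ (Fin k), (∀ b, IsControl T (w b)) ∧
      ∀ b b', ‖φ (commInt T (ctrlComb T A B (w b)) (ctrlComb T A B (w b')))
        - if b = b' then φ (bracketSeq T A (B (σ b).1) 1 0 * bracketSeq T A (B (σ b).2) 1 0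
            - bracketSeq T A (B (σ b).2) 1 0 * bracketSeq T A (B (σ b).1) 1 0) else 0‖ ≤ η := by
  classical
  set N : β → ℕ := fun b => (Fintype.equivFin β b : ℕ) with hN
  have hNi : ∀ b b', b ≠ b' → N b ≠ N b' := fun b b' h h' =>
    h ((Fintype.equivFin β).injective (Fin.ext h'))
  set M : ℝ := Fintype.card β + 1 with hMdef
  have hM : 0 < M := by positivity
  have hNM : ∀ b, (N b : ℝ) + 1 ≤ M := fun b => by
    have : (N b : ℝ) ≤ Fintype.card β := by exact_mod_cast (Fintype.equivFin β b).2.le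
    linarith
  -- Each index has its own unit window, so profiles of different indices have disjoint supports.
  -- Within a window, f drives the first component of σ b and h the second.
  choose f h hf hh hα hβ hγ using fun b => exists_profile_pair (lt_add_one (N b : ℝ))
  let G : β → Fin 2 → ℝ → ℝ := fun b => ![f b, h b]
  let I : β → Fin 2 → Fin k := fun b => ![(σ b).1, (σ b).2]
  have hG' : ∀ b r, IsProfile (N b) (N b + 1) (G b r) := fun b r => by
    fin_cases r
    · exact hf b
    · exact hh b
  have hG : ∀ b r, IsProfile 0 M (G b r) := fun b r =>
    (hG' b r).mono (Nat.cast_nonneg _) (hNM b)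
  set e : Fin k → Fin k → F := fun i l => φ (bracketSeq T A (B i) 1 0 * bracketSeq T A (B l) 1 0
            - bracketSeq T A (B l) 1 0 * bracketSeq T A (B i) 1 0) with he
  have hee : ∀ i l, e l i = -e i l := fun i l => by
    simp only [he]; rw [← map_neg, neg_sub]
  have he0 : ∀ i, e i i = 0 := fun i => by simp only [he, sub_self, map_zero]
  set γ : β → Fin 2 → β → Fin 2 → ℝ := fun b r b' r' =>
    ∫ x in (0 : ℝ)..M, deriv (deriv (G b r)) x * deriv (G b' r') x with hγdef
  have hwin : ∀ b {Φ : ℝ → ℝ}, (∀ x ∉ Ioo (N b : ℝ) (N b + 1), Φ x = 0) →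
      ∫ x in (0 : ℝ)..M, Φ x = ∫ x in (N b : ℝ)..(N b + 1), Φ x := fun b Φ hΦ =>
    integral_eq_of_support (Nat.cast_nonneg _) (hNM b) hΦ
  have hd0 : ∀ b x, x ∉ Ioo (N b : ℝ) (N b + 1) → deriv (deriv (f b)) x = 0 := fun b x hx =>
    (hf b).deriv.deriv.eq_zero hx
  have hα' : ∀ b, ∫ x in (0 : ℝ)..M, deriv (deriv (f b)) x * deriv (deriv (h b)) x = 0 := fun b =>
    (hwin b fun x hx => by rw [hd0 b x hx, zero_mul]).trans (hα b)
  have hβ' : ∀ b, ∫ x in (0 : ℝ)..M, x * (deriv (deriv (f b)) x * deriv (deriv (h b)) x) = 0 :=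
    fun b => (hwin b fun x hx => by rw [hd0 b x hx, zero_mul, mul_zero]).trans (hβ b)
  have hγ' : ∀ b, γ b 0 b 1 = 1 := fun b =>
    (hwin b fun x hx => by rw [show G b 0 = f b from rfl, hd0 b x hx, zero_mul]).trans (hγ b)
  have hγ'' : ∀ b, γ b 1 b 0 = -1 := fun b => by
    have h1 := (hG b 1).deriv.by_parts (hG b 0).deriv
    have h2 := hγ' b
    simp only [hγdef] at h2 ⊢
    rw [← h2]
    simp only [mul_comm] at h1 ⊢
    linarith
  have pair : ∀ b r b' r', ∃ K : ℝ, ∀ δ : ℝ, 0 < δ → δ ≤ 1 → δ * M ≤ T →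
      ‖φ (commInt T (fun t => concentrate δ (G b r) t • conjCtrl T A (B (I b r)) t)
          (fun t => concentrate δ (G b' r') t • conjCtrl T A (B (I b' r')) t))
        - (1 / 2 : ℝ) • (γ b r b' r' • e (I b r) (I b' r'))‖ ≤ K * δ := by
    intro b r b' r'
    obtain ⟨K, hK⟩ := exists_pair_bound hT hA hAS φ (hBB (I b r) (I b' r')) (hBB (I b' r') (I b r))
      hM (hG b r) (hG b' r')
    refine ⟨K, fun δ h1 h2 h3 => (hK δ h1 h2 h3).trans' (le_of_eq ?_)⟩
    congr 3
    -- The coefficients of δ⁻¹ and of D must vanish. For a profile against itself the integrals are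
    -- not zero, but φ kills the brackets with B_i. For the two profiles of one pair the moments
    -- vanish, and in all other cases the supports are disjoint.
    by_cases hrr : b = b' ∧ r = r'
    · obtain ⟨rfl, rfl⟩ := hrr
      rw [hφ1, hφ2, sub_self, map_zero, he0]
      simp
    · have hz : (∫ x in (0 : ℝ)..M, deriv (deriv (G b r)) x * deriv (deriv (G b' r')) x) = 0 ∧
          (∫ x in (0 : ℝ)..M, x * (deriv (deriv (G b r)) x * deriv (deriv (G b' r')) x)) = 0 := by
        by_cases hb : b = b'
        · subst hb
          have h1 := hα' b
          have h2 := hβ' b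
          fin_cases r <;> fin_cases r'
          · exact absurd ⟨rfl, rfl⟩ hrr
          · exact ⟨h1, h2⟩
          · simp only [mul_comm (deriv (deriv (f b)) _)] at h1 h2
            exact ⟨h1, h2⟩
          · exact absurd ⟨rfl, rfl⟩ hrr
        · have h0 := (hG' b r).deriv.deriv.mul_eq_zero (hNi b b' hb) (hG' b' r').deriv.deriv
          simp [h0]
      rw [hz.1, hz.2]
      simp [hγdef, he]
  choose K hK using pair
  set Ks : ℝ := 1 + ∑ b, ∑ r, ∑ b', ∑ r', |K b r b' r'| with hKs
  have hKs0 : 0 < Ks := by positivity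
  obtain ⟨δ, hδ, hδ1, hδM, hδK⟩ : ∃ δ : ℝ, 0 < δ ∧ δ ≤ 1 ∧ δ * M ≤ T ∧ Ks * δ ≤ η := by
    refine ⟨min 1 (min (T / M) (η / Ks)), by positivity, min_le_left _ _, ?_, ?_⟩
    · rw [← le_div_iff₀ hM]
      exact (min_le_right _ _).trans (min_le_left _ _)
    · rw [mul_comm, ← le_div_iff₀ hKs0]
      exact (min_le_right _ _).trans (min_le_right _ _)
  set g : β → Fin 2 → ℝ → Mat m := fun b r t => concentrate δ (G b r) t • conjCtrl T A (B (I b r)) t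
    with hg
  have hgc : ∀ b r, Continuous (g b r) := fun b r =>
    (continuous_concentrate (hG b r)).smul (continuous_conjCtrl hT.le hA.continuousOn _)
  refine ⟨fun b t => concentrate δ (G b 0) t • EuclideanSpace.single (I b 0) 1
    + concentrate δ (G b 1) t • EuclideanSpace.single (I b 1) 1, fun b =>
    (((hG b 0).concentrate hδ hδM).isControl _).add (((hG b 1).concentrate hδ hδM).isControl _),
    fun b b' => ?_⟩
  rw [ctrlComb_single A B (fun r => concentrate δ (G b r)) (I b),
    ctrlComb_single A B (fun r => concentrate δ (G b' r)) (I b'),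
    commInt_linSum (g := g b) (h := g b') (hgc b) (hgc b')]
  -- The cross terms (f,h) and (h,f) contribute equally, since both γ and e change sign under the
  -- exchange. Together they compensate the factor 1/2.
  have hlim : (if b = b' then e (σ b).1 (σ b).2 else 0)
      = ∑ r, ∑ r', (1 / 2 : ℝ) • (γ b r b' r' • e (I b r) (I b' r')) := by
    split_ifs with hb
    · subst hb
      simp only [Fin.sum_univ_two, he0, hγ', hγ'', smul_zero, zero_add, add_zero]
      rw [hee (I b 0) (I b 1)]
      change e (I b 0) (I b 1) = _
      module
    · have : ∀ r r', γ b r b' r' = 0 := fun r r' => by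
        have h0 := (hG' b r).deriv.deriv.mul_eq_zero (hNi b b' hb) (hG' b' r').deriv
        simp [hγdef, h0]
      simp [this]
  rw [hlim]
  simp only [bilinSum, Pi.one_apply, mul_one, one_smul, map_sum, ← Finset.sum_sub_distrib]
  calc _ ≤ ∑ r, ∑ r', |K b r b' r'| * δ := by
        refine (norm_sum_le _ _).trans (Finset.sum_le_sum fun r _ => (norm_sum_le _ _).trans
          (Finset.sum_le_sum fun r' _ => (hK b r b' r' δ hδ hδ1 hδM).trans ?_))
        exact mul_le_mul_of_nonneg_right (le_abs_self _) hδ.le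
    _ = (∑ r, ∑ r', |K b r b' r'|) * δ := by simp only [Finset.sum_mul]
    _ ≤ Ks * δ := by
        refine mul_le_mul_of_nonneg_right ?_ hδ.le
        have h1 : ∑ r, ∑ r', |K b r b' r'| ≤ ∑ r, ∑ b', ∑ r', |K b r b' r'| :=
          Finset.sum_le_sum fun r _ => Finset.single_le_sum
            (f := fun b' => ∑ r', |K b r b' r'|) (fun _ _ => by positivity) (Finset.mem_univ b')
        have h2 : ∑ r, ∑ b', ∑ r', |K b r b' r'| ≤ ∑ b, ∑ r, ∑ b', ∑ r', |K b r b' r'| :=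
          Finset.single_le_sum (f := fun b => ∑ r, ∑ b', ∑ r', |K b r b' r'|)
            (fun _ _ => by positivity) (Finset.mem_univ b)
        linarith
    _ ≤ η := hδK

end Controls

/-! ### Linear algebra: splitting off the directions reached at first order -/

section Splitting

variable {V : Type*} [NormedAddCommGroup V] [NormedSpace ℝ V] [FiniteDimensional ℝ V]
variable {ι J : Type*} [Fintype ι] [Fintype J]

/-- A projection along the span of a finite family. -/
theorem exists_projection_along (l : J → V) : ∃ (π : V →L[ℝ] V) (m : V →L[ℝ] (J → ℝ)),
    (∀ j, π (l j) = 0) ∧ ∀ y, linSum l (m y) = y - π y := by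
  set I := Submodule.span ℝ (range l) with hI
  obtain ⟨g, hg⟩ := I.subtype.exists_leftInverse_of_injective I.ker_subtype
  set Λ : (J → ℝ) →ₗ[ℝ] I := (Fintype.linearCombination ℝ l).codRestrict I fun u => by
    rw [hI, ← Fintype.range_linearCombination]; exact LinearMap.mem_range_self _ u with hΛ
  have hs : LinearMap.range Λ = ⊤ := by
    rw [LinearMap.range_eq_top]
    rintro ⟨y, hy⟩
    rw [hI, ← Fintype.range_linearCombination] at hy
    obtain ⟨u, hu⟩ := hy
    exact ⟨u, Subtype.ext hu⟩
  obtain ⟨h, hh⟩ := Λ.exists_rightInverse_of_surjective hs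
  refine ⟨LinearMap.toContinuousLinearMap (LinearMap.id - I.subtype ∘ₗ g),
    LinearMap.toContinuousLinearMap (h ∘ₗ g), fun j => ?_, fun y => ?_⟩
  · have := LinearMap.congr_fun hg ⟨l j, Submodule.subset_span ⟨j, rfl⟩⟩
    simp only [LinearMap.comp_apply, Submodule.subtype_apply, LinearMap.id_apply] at this
    simp [this]
  · have := congrArg Subtype.val (LinearMap.congr_fun hh (g y))
    simp only [LinearMap.comp_apply, LinearMap.id_apply, hΛ, LinearMap.codRestrict_apply] at this
    change Fintype.linearCombination ℝ l (h (g y)) = _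
    rw [this]
    simp

/-- This is a linear right inverse for the differential at the zero (1,…,1); the factor 2 is the
derivative of x² at 1. -/
theorem exists_coefficients (e : ι → V) (l : J → V)
    (h : ∀ y, y ∈ Submodule.span ℝ (range e ∪ range l)) :
    ∃ (a : V →L[ℝ] (ι → ℝ)) (m : V →L[ℝ] (J → ℝ)),
      ∀ y, (2 : ℝ) • ∑ i, a y i • e i + linSum l (m y) = y := by
  set Λ : ((ι → ℝ) × (J → ℝ)) →ₗ[ℝ] V := ((2 : ℝ) • Fintype.linearCombination ℝ e).coprod
    (Fintype.linearCombination ℝ l) with hΛ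
  have hs : LinearMap.range Λ = ⊤ := by
    refine eq_top_iff.2 fun y _ => (Submodule.span_le (p := LinearMap.range Λ)).2 ?_ (h y)
    rw [hΛ, LinearMap.range_coprod, LinearMap.range_smul _ _ two_ne_zero,
      Fintype.range_linearCombination, Fintype.range_linearCombination, ← Submodule.span_union]
    exact Submodule.subset_span
  obtain ⟨g, hg⟩ := Λ.exists_rightInverse_of_surjective hs
  refine ⟨LinearMap.toContinuousLinearMap (LinearMap.fst ℝ _ _ ∘ₗ g),
    LinearMap.toContinuousLinearMap (LinearMap.snd ℝ _ _ ∘ₗ g), fun y => ?_⟩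
  exact LinearMap.congr_fun hg y

end Splitting

/-! ### Finite combinations of controls and first order reachable directions -/

section Controls

variable {m k : ℕ} {T : ℝ}

/-- All controls used are combinations of one fixed finite family, so a bound on the coefficients is
a C² bound. -/
theorem exists_c2norm_le (hT : 0 < T) {E : Type*} [NormedAddCommGroup E] [NormedSpace ℝ E]
    {β : Type*} [Fintype β] {w : β → ℝ → E}
    (hw : ∀ c, ContDiff ℝ ∞ (w c)) : ∃ K ≥ (0 : ℝ), ∀ (ξ : β → ℝ)
      (h : ContDiffOn ℝ ∞ (fun t => linSum (fun c => w c t) ξ) (Icc 0 T)),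
      ‖(C2Path.ofSmooth (fun t => linSum (fun c => w c t) ξ) h : C2Path T E)‖ ≤ K * ‖ξ‖ := by
  set N : β → ℝ := fun c => ‖C2Path.jet (T := T) (C2Path.ofSmooth (w c) (hw c).contDiffOn)‖
  have hN : ∀ c, 0 ≤ N c := fun c => norm_nonneg _
  refine ⟨∑ c, N c, Finset.sum_nonneg fun c _ => hN c, fun ξ h => ?_⟩
  have hK : 0 ≤ (∑ c, N c) * ‖ξ‖ :=
    mul_nonneg (Finset.sum_nonneg fun c _ => hN c) (norm_nonneg _)
  change ‖C2Path.jet (T := T) (C2Path.ofSmooth (fun t => linSum (fun c => w c t) ξ) h)‖ ≤ _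
  rw [pi_norm_le_iff_of_nonneg hK]
  intro j
  rw [ContinuousMap.norm_le _ hK]
  rintro ⟨t, ht⟩
  have hu := uniqueDiffOn_Icc hT
  have hj : ∀ c, ContDiffWithinAt ℝ (j : ℕ) (w c) (Icc 0 T) t := fun c =>
    ((hw c).of_le (by exact_mod_cast le_top)).contDiffWithinAt
  have h1 : iteratedDerivWithin j (fun t => linSum (fun c => w c t) ξ) (Icc 0 T) t
      = ∑ c, ξ c • iteratedDerivWithin j (w c) (Icc 0 T) t := by
    simp only [linSum]
    rw [iteratedDerivWithin_fun_sum ht hu fun c _ => (hj c).const_smul (ξ c)]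
    refine Finset.sum_congr rfl fun c _ => ?_
    exact iteratedDerivWithin_fun_const_smul ht hu (ξ c) (hj c)
  change ‖iteratedDerivWithin j (fun t => linSum (fun c => w c t) ξ) (Icc 0 T) t‖ ≤ _
  rw [h1, Finset.sum_mul]
  refine (norm_sum_le _ _).trans (Finset.sum_le_sum fun c _ => ?_)
  rw [norm_smul, mul_comm]
  refine mul_le_mul ?_ (norm_le_pi_norm ξ c) (norm_nonneg _) (hN c)
  exact ((C2Path.ofSmooth (w c) (hw c).contDiffOn : C2Path T E).jet j).norm_coe_le_norm ⟨t, ht⟩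
    |>.trans (norm_le_pi_norm _ j)

theorem continuous_ctrlComb (hT : 0 ≤ T) {A : ℝ → Mat m} (hA : ContinuousOn A (Icc 0 T))
    (B : Fin k → Mat m) {u : ℝ → EuclideanSpace ℝ (Fin k)} (hu : Continuous u) :
    Continuous (ctrlComb T A B u) :=
  continuous_finsetSum _ fun i _ =>
    ((EuclideanSpace.proj i).continuous.comp hu).smul (continuous_conjCtrl hT hA (B i))

theorem ctrlComb_mem (A : ℝ → Mat m) {B : Fin k → Mat m} (hB : ∀ i, B i ∈ spTangent m)
    (u : ℝ → EuclideanSpace ℝ (Fin k)) (t : ℝ) : ctrlComb T A B u t ∈ spTangent m :=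
  Submodule.sum_mem _ fun i _ => Submodule.smul_mem _ _ (conjCtrl_mem (hB i) t)

theorem ctrlComb_linSum (A : ℝ → Mat m) (B : Fin k → Mat m) {β : Type*} [Fintype β]
    (w : β → ℝ → EuclideanSpace ℝ (Fin k)) (ξ : β → ℝ) :
    ctrlComb T A B (fun t => linSum (fun c => w c t) ξ)
      = fun t => linSum (fun c => ctrlComb T A B (w c) t) ξ := by
  ext1 t
  simp only [ctrlComb, linSum, WithLp.ofLp_sum, WithLp.ofLp_smul, Finset.sum_apply, Pi.smul_apply,
    smul_eq_mul, Finset.sum_smul, Finset.smul_sum, smul_smul]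
  exact Finset.sum_comm

theorem IsControl.linSum {β : Type*} [Fintype β] {w : β → ℝ → EuclideanSpace ℝ (Fin k)}
    (hw : ∀ c, IsControl T (w c)) (ξ : β → ℝ) : IsControl T (fun t => linSum (fun c => w c t) ξ) := by
  refine ⟨ContDiff.sum fun c _ => (hw c).1.const_smul _, ?_⟩
  have : tsupport (fun t => _root_.linSum (fun c => w c t) ξ) ⊆ ⋃ c, tsupport (w c) := by
    refine closure_minimal (fun t ht => ?_) (isClosed_iUnion_of_finite fun c => isClosed_tsupport _)
    by_contra hn
    simp only [mem_iUnion, not_exists] at hn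
    exact ht (Finset.sum_eq_zero fun c _ => by
      simp only [image_eq_zero_of_notMem_tsupport (hn c), smul_zero])
  exact this.trans (iUnion_subset fun c => (hw c).2)

/-- A linear map that kills the first order terms of all controls kills the conjugated control
matrices. -/
theorem map_conjCtrl_eq_zero (hT : 0 < T) {A : ℝ → Mat m} (hA : ContinuousOn A (Icc 0 T))
    (B : Fin k → Mat m) {F : Type*} [NormedAddCommGroup F] [NormedSpace ℝ F] [CompleteSpace F]
    (φ : Mat m →L[ℝ] F) (hφ : ∀ u, IsControl T u → φ (volterra (ctrlComb T A B u) 1 T) = 0)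
    (i : Fin k) {t : ℝ} (ht : t ∈ Icc 0 T) : φ (conjCtrl T A (B i) t) = 0 := by
  have hc : Continuous fun t => φ (conjCtrl T A (B i) t) :=
    φ.continuous.comp (continuous_conjCtrl hT.le hA (B i))
  -- Fundamental lemma of the calculus of variations, tested with the controls f·(i-th basis
  -- vector). Continuity then gives the value at every t, end points included.
  have hae := isOpen_Ioo.ae_eq_zero_of_integral_contDiff_smul_eq_zero (μ := volume) (U := Ioo 0 T)
    (hc.locallyIntegrable.locallyIntegrableOn _) (fun f hf _ hft => ?_)
  · have h2 : (fun t => φ (conjCtrl T A (B i) t)) =ᵐ[volume.restrict (Icc 0 T)] fun _ => 0 := by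
      rw [← restrict_Ioo_eq_restrict_Icc]
      exact (ae_restrict_iff' measurableSet_Ioo).2 hae
    exact Measure.eqOn_Icc_of_ae_eq volume hT.ne h2 hc.continuousOn continuousOn_const ht
  · have hp : IsProfile 0 T f := ⟨hf, hft⟩
    have h3 := hφ _ (hp.isControl (EuclideanSpace.single i 1))
    have h4 : ctrlComb T A B (fun t => f t • EuclideanSpace.single i 1)
        = fun t => f t • conjCtrl T A (B i) t := by
      ext1 t
      simp [ctrlComb, ite_smul]
    rw [h4, volterra_one_apply, ← φ.intervalIntegral_comp_comm
      ((hf.continuous.fun_smul (continuous_conjCtrl hT.le hA (B i))).intervalIntegrable _ _)] at h3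
    simp only [map_smul] at h3
    rw [← h3, intervalIntegral.integral_eq_integral_of_support_subset]
    intro x hx
    have : x ∈ Ioo 0 T := hft (subset_tsupport _ fun h0 => hx (by simp [h0]))
    exact ⟨this.1, this.2.le⟩

end Controls

/-! ### Local steering near the identity -/

section LocalSteering

variable {m k : ℕ} {T : ℝ}

theorem linearFlow_zero (m : ℕ) (hT : 0 ≤ T) : linearFlow T (0 : ℝ → Mat m) T = 1 := by
  have h := linearFlow_eq_volterra hT (M := (0 : ℝ → Mat m)) continuous_zero (t := T) ⟨hT, le_rfl⟩
  rw [← sub_eq_zero, h]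
  simp [volterra]

theorem norm_linearFlow_linSum_sub_one_le (hT : 0 ≤ T) {β : Type*} [Fintype β] {g : β → ℝ → Mat m}
    (hgc : ∀ c, Continuous (g c)) {G : ℝ} (hG : 0 ≤ G) (hg : ∀ c, ∀ t ∈ Icc 0 T, ‖g c t‖ ≤ G)
    {ξ : β → ℝ} (hξ : T * (Fintype.card β * G * ‖ξ‖) ≤ 1 / 2) :
    ‖linearFlow T (fun s => linSum (fun c => g c s) ξ) T - 1‖
      ≤ 4 * ‖(1 : Mat m)‖ * T * (Fintype.card β * G * ‖ξ‖) := by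
  have hM : ∀ t ∈ Icc 0 T, ‖linSum (fun c => g c t) ξ‖ ≤ Fintype.card β * G * ‖ξ‖ := fun t ht =>
    norm_linSum_le (fun c => hg c t ht) ξ
  have h0 : 0 ≤ Fintype.card β * G * ‖ξ‖ := by positivity
  have h := norm_linearFlow_sub_le hT (M := fun s => linSum (fun c => g c s) ξ)
    (continuous_finsetSum _ fun c _ => (hgc c).const_smul (ξ c)) (M' := 0)
    continuous_zero h0 h0 hξ hM (fun t _ => by simpa using h0) (fun t ht => by simpa using hM t ht)
    (t := T) ⟨hT, le_rfl⟩
  rwa [linearFlow_zero m hT] at h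

/-- Controls whose second order terms span the directions that are not reached at first order. -/
theorem exists_control_family (hT : 0 < T) {A : ℝ → Mat m} {B : Fin k → Mat m}
    (hA : ContDiffOn ℝ ∞ A (Icc 0 T)) (hAS : ∀ t ∈ Icc 0 T, A t ∈ spTangent m)
    (hBB : ∀ i j, B i * B j = 0)
    (hbracket : ∀ i, ∀ j ∈ ({1, 2} : Set ℕ),
      bracketSeq T A (B i) j 0 * B i - B i * bracketSeq T A (B i) j 0 ∈
        Submodule.span ℝ {Y | ∃ (r : Fin k) (s : ℕ), Y = bracketSeq T A (B r) s 0})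
    (hspan : Submodule.span ℝ
      ({Y | ∃ (i : Fin k) (j : ℕ), j ≤ 2 ∧ Y = bracketSeq T A (B i) j 0} ∪
        {Y | ∃ i l : Fin k, Y = bracketSeq T A (B i) 1 0 * bracketSeq T A (B l) 1 0
            - bracketSeq T A (B l) 1 0 * bracketSeq T A (B i) 1 0}) = spTangent m) :
    ∃ (β : Type) (_ : Fintype β) (w : β → ℝ → EuclideanSpace ℝ (Fin k)),
      (∀ c, IsControl T (w c)) ∧
      ∃ η > (0 : ℝ), ∃ μ > (0 : ℝ), ∃ C > (0 : ℝ), ∀ g : β → ℝ → Mat m,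
        (∀ c, Continuous (g c)) → (∀ c, ∀ t ∈ Icc 0 T, g c t ∈ spTangent m) →
        (∀ c, ∀ t ∈ Icc 0 T, ‖g c t - ctrlComb T A B (w c) t‖ ≤ η) →
        ∀ y : spTangent m, ‖y‖ ≤ μ → ∃ ξ : β → ℝ, ‖ξ‖ ≤ C * √‖y‖ ∧
          spProj m (linearFlow T (fun s => linSum (fun c => g c s) ξ) T - 1) = y := by
  classical
  set P := spProj m with hP
  set R : Set (spTangent m) := {y | ∃ u, IsControl T u ∧ P (volterra (ctrlComb T A B u) 1 T) = y}
    with hR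
  -- Finitely many controls already realize generators of the space of first order directions. Their
  -- first order terms are exactly the vectors l.
  obtain ⟨J, hJR, hJ⟩ := (Submodule.fg_span_iff_fg_span_finset_subset R).1
    (IsNoetherian.noetherian (Submodule.span ℝ R))
  choose v hv hvJ using fun j : J => hJR j.2
  set l : J → spTangent m := fun j => j with hl
  have hlJ : range l = (J : Set (spTangent m)) := Subtype.range_coe
  obtain ⟨π, m', hπl, hm'⟩ := exists_projection_along l
  have hπR : ∀ y ∈ R, π y = 0 := by
    intro y hy
    have h1 : y ∈ Submodule.span ℝ (J : Set (spTangent m)) := hJ ▸ Submodule.subset_span hy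
    have h2 : Submodule.span ℝ (J : Set (spTangent m)) ≤ LinearMap.ker (π : spTangent m →ₗ[ℝ] spTangent m) :=
      Submodule.span_le.2 fun y hy => hπl ⟨y, hy⟩
    exact h2 h1
  set φ : Mat m →L[ℝ] spTangent m := π.comp P with hφ
  have hφb : ∀ i j, φ (bracketSeq T A (B i) j 0) = 0 := fun i j =>
    map_bracketSeq_eq_zero hT hA hAS (B i) φ (fun t ht =>
      map_conjCtrl_eq_zero hT hA.continuousOn B φ (fun u hu => hπR _ ⟨u, hu, rfl⟩) i ht) j
  have hφc : ∀ i, ∀ j ∈ ({1, 2} : Set ℕ),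
      φ (bracketSeq T A (B i) j 0 * B i - B i * bracketSeq T A (B i) j 0) = 0 := fun i j hj => by
    have h2 : Submodule.span ℝ {Y | ∃ (r : Fin k) (s : ℕ), Y = bracketSeq T A (B r) s 0}
        ≤ LinearMap.ker (φ : Mat m →ₗ[ℝ] spTangent m) := Submodule.span_le.2 (by
      rintro _ ⟨i, j, rfl⟩
      exact hφb i j)
    exact h2 (hbracket i j hj)
  set e : Fin k × Fin k → spTangent m := fun i =>
    φ (bracketSeq T A (B i.1) 1 0 * bracketSeq T A (B i.2) 1 0
      - bracketSeq T A (B i.2) 1 0 * bracketSeq T A (B i.1) 1 0) with he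
  have hesum : ∑ i, e i = 0 := by
    have h1 : ∑ i, e i = ∑ i : Fin k × Fin k, e i.swap :=
      (Equiv.sum_comp (Equiv.prodComm (Fin k) (Fin k)) e).symm
    have h2 : ∀ i : Fin k × Fin k, e i.swap = -e i := fun i => by
      simp only [he, Prod.fst_swap, Prod.snd_swap]
      rw [← map_neg, neg_sub]
    simp only [h2, Finset.sum_neg_distrib] at h1
    have h3 : (2 : ℝ) • ∑ i, e i = 0 := by
      rw [two_smul]
      nth_rw 1 [h1]
      exact neg_add_cancel _
    exact (smul_eq_zero.1 h3).resolve_left two_ne_zero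
  have hcomplement : ∀ y, y - π y ∈ Submodule.span ℝ (range e ∪ range l) := fun y => by
    rw [← hm' y]
    exact Submodule.sum_mem _ fun j _ =>
      Submodule.smul_mem _ _ (Submodule.subset_span (Or.inr ⟨j, rfl⟩))
  -- Since y - π y lies in the span of l, the span hypothesis need only be checked after applying π:
  -- there the brackets B_i^j(0) vanish and the commutators become the vectors e.
  have hall : ∀ y, y ∈ Submodule.span ℝ (range e ∪ range l) := by
    have h2 : spTangent m ≤ (Submodule.span ℝ (range e ∪ range l)).comap (P : Mat m →ₗ[ℝ] _) := by
      refine hspan.ge.trans (Submodule.span_le.2 ?_)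
      rintro _ (⟨i, j, -, rfl⟩ | ⟨i, j, rfl⟩)
      · have h3 := hcomplement (P (bracketSeq T A (B i) j 0))
        have h4 : π (P (bracketSeq T A (B i) j 0)) = 0 := hφb i j
        rwa [h4, sub_zero] at h3
      · have h3 := hcomplement (P (bracketSeq T A (B i) 1 0 * bracketSeq T A (B j) 1 0
            - bracketSeq T A (B j) 1 0 * bracketSeq T A (B i) 1 0))
        have h4 : e (i, j) ∈ Submodule.span ℝ (range e ∪ range l) :=
          Submodule.subset_span (Or.inl ⟨_, rfl⟩)
        have h5 := Submodule.add_mem _ h3 h4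
        rwa [show e (i, j) = π (P _) from rfl, sub_add_cancel] at h5
    intro y
    have h3 := h2 y.2
    rwa [Submodule.mem_comap, ContinuousLinearMap.coe_coe, hP, spProj_coe] at h3
  obtain ⟨a, m₁, ham⟩ := exists_coefficients e l hall
  -- One copy more than the dimension, as needed to cancel the first order terms.
  let ν := Fin (Module.finrank ℝ (spTangent m) + 1)
  obtain ⟨η₀, hη₀, H⟩ := exists_flow_preimage (ν := ν) (P := P) (spProj_coe (m := m)) hT.le (by simp [ν])
    e hesum l π a m₁ m' ham hm'
  obtain ⟨w, hw, hwφ⟩ := exists_concentrated_controls hT hA hAS hBB φ (fun i => hφc i 1 (by simp))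
    (fun i => hφc i 2 (by simp)) (fun b : (Fin k × Fin k) × ν => b.1) hη₀
  refine ⟨_, inferInstance, Sum.elim w v, ?_, ?_⟩
  · rintro (b | j)
    · exact hw b
    · exact hv j
  · refine H (fun c => ctrlComb T A B (Sum.elim w v c)) ?_ hvJ hwφ
    rintro (b | j)
    · exact continuous_ctrlComb hT.le hA.continuousOn B (hw b).1.continuous
    · exact continuous_ctrlComb hT.le hA.continuousOn B (hv j).1.continuous

/-- Local controllability in time `T` near the identity, with constants that do not depend on the
system in a neighbourhood of a given one. -/
theorem exists_local_steering (hT : 0 < T) {A : ℝ → Mat m} {B : Fin k → Mat m}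
    (hA : ContDiffOn ℝ ∞ A (Icc 0 T)) (hAS : ∀ t ∈ Icc 0 T, A t ∈ spTangent m)
    (hBB : ∀ i j, B i * B j = 0)
    (hbracket : ∀ i, ∀ j ∈ ({1, 2} : Set ℕ),
      bracketSeq T A (B i) j 0 * B i - B i * bracketSeq T A (B i) j 0 ∈
        Submodule.span ℝ {Y | ∃ (r : Fin k) (s : ℕ), Y = bracketSeq T A (B r) s 0})
    (hspan : Submodule.span ℝ
      ({Y | ∃ (i : Fin k) (j : ℕ), j ≤ 2 ∧ Y = bracketSeq T A (B i) j 0} ∪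
        {Y | ∃ i l : Fin k, Y = bracketSeq T A (B i) 1 0 * bracketSeq T A (B l) 1 0
            - bracketSeq T A (B l) 1 0 * bracketSeq T A (B i) 1 0}) = spTangent m) :
    ∃ η > (0 : ℝ), ∃ μ > (0 : ℝ), ∃ K > (0 : ℝ), ∀ (A' : ℝ → Mat m) (B' : Fin k → Mat m),
      ContinuousOn A' (Icc 0 T) → (∀ i, B' i ∈ spTangent m) →
      (∀ t ∈ Icc 0 T, ‖A' t - A t‖ ≤ η) → (∀ i, ‖B' i - B i‖ ≤ η) →
      ∀ W ∈ Matrix.symplecticGroup (Fin m) ℝ, ‖W - 1‖ ≤ μ →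
        ∃ (u : ℝ → EuclideanSpace ℝ (Fin k)) (hu : ContDiff ℝ ∞ u), tsupport u ⊆ Ioo 0 T ∧
          linearFlow T (ctrlComb T A' B' u) T = W ∧
          ‖(C2Path.ofSmooth u hu.contDiffOn : C2Path T (EuclideanSpace ℝ (Fin k)))‖
            ≤ K * √‖W - 1‖ := by
  obtain ⟨β, _, w, hw, η, hη, μ, hμ, C, hC, H⟩ :=
    exists_control_family hT hA hAS hBB hbracket hspan
  obtain ⟨Kw, hKw, hwK⟩ := exists_c2norm_le hT fun c => (hw c).1
  obtain ⟨r, hr, hrinj⟩ := eq_of_spProj_eq m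
  obtain ⟨L, hL, hconj⟩ := exists_norm_conjCtrl_sub_le hT.le hA.continuousOn B
  obtain ⟨U, hU0, hU⟩ : ∃ U : ℝ, 0 ≤ U ∧ ∀ c, ∀ t ∈ Icc 0 T, ‖w c t‖ ≤ U := by
    choose U hU using fun c => isCompact_Icc.exists_bound_of_continuousOn
      ((hw c).1.continuous.continuousOn (s := Icc 0 T))
    exact ⟨‖U‖, norm_nonneg _, fun c t ht =>
      (hU c t ht).trans ((le_abs_self _).trans (norm_le_pi_norm U c))⟩
  have hgc : ∀ c, Continuous (ctrlComb T A B (w c)) := fun c =>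
    continuous_ctrlComb hT.le hA.continuousOn B (hw c).1.continuous
  obtain ⟨G, hG0, hG⟩ : ∃ G : ℝ, 0 ≤ G ∧ ∀ c, ∀ t ∈ Icc 0 T, ‖ctrlComb T A B (w c) t‖ ≤ G := by
    choose U hU using fun c => isCompact_Icc.exists_bound_of_continuousOn
      ((hgc c).continuousOn (s := Icc 0 T))
    exact ⟨‖U‖, norm_nonneg _, fun c t ht =>
      (hU c t ht).trans ((le_abs_self _).trans (norm_le_pi_norm U c))⟩
  set p := ‖spProj m‖ + 1 with hp
  have hp0 : 0 < p := by positivity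
  -- D times √‖W - 1‖ dominates the distance of the flow from 1. The bound ε on √‖W - 1‖ then yields
  -- both the smallness 1/2 required by the flow estimate and a distance below r, where the
  -- projection is injective.
  set D := (4 * ‖(1 : Mat m)‖ + 1) * T * (Fintype.card β * (G + η) * (C * √p)) with hD
  have hD0 : 0 ≤ D := by positivity
  set ε := min (1 / 2) (r / 2) / (D + 1) with hε
  have hε0 : 0 < ε := by positivity
  have hεD : D * ε ≤ min (1 / 2) (r / 2) := by
    rw [hε, mul_div_assoc', div_le_iff₀ (by positivity)]
    nlinarith [show 0 < min (1 / 2 : ℝ) (r / 2) by positivity]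
  set η' := min 1 (η / (k * U * L + 1)) with hη'
  have hη'0 : 0 < η' := by positivity
  have hη'k : k * U * L * η' ≤ η := by
    have h1 : η' ≤ η / (k * U * L + 1) := min_le_right _ _
    rw [le_div_iff₀ (by positivity)] at h1
    linarith
  refine ⟨η', hη'0, min (r / 2) (min (μ / p) (ε ^ 2)), by positivity, Kw * (C * √p) + 1,
    by positivity, fun A' B' hA' hB' hAA hBB' W hW hWμ => ?_⟩
  have hW1 : ‖W - 1‖ < r := by linarith [hWμ.trans (min_le_left _ _)]
  have hW2 : p * ‖W - 1‖ ≤ μ := by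
    have := hWμ.trans ((min_le_right _ _).trans (min_le_left _ _))
    rw [le_div_iff₀ hp0] at this
    linarith
  have hW3 : √‖W - 1‖ ≤ ε := by
    rw [Real.sqrt_le_left hε0.le]
    exact hWμ.trans ((min_le_right _ _).trans (min_le_right _ _))
  have hgc' : ∀ c, Continuous (ctrlComb T A' B' (w c)) := fun c =>
    continuous_ctrlComb hT.le hA' B' (hw c).1.continuous
  have hgS : ∀ c t, ctrlComb T A' B' (w c) t ∈ spTangent m := fun c t =>
    ctrlComb_mem A' hB' (w c) t
  have hgg : ∀ c, ∀ t ∈ Icc 0 T, ‖ctrlComb T A' B' (w c) t - ctrlComb T A B (w c) t‖ ≤ η := by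
    intro c t ht
    simp only [ctrlComb, ← Finset.sum_sub_distrib, ← smul_sub]
    have h1 : ∀ i ∈ Finset.univ, ‖w c t i • (conjCtrl T A' (B' i) t - conjCtrl T A (B i) t)‖
        ≤ U * (L * η') := fun i _ => by
      rw [norm_smul]
      exact mul_le_mul ((PiLp.norm_apply_le _ i).trans (hU c t ht))
        (hconj A' B' hA' η' hη'0.le (min_le_left _ _) hAA hBB' i t ht) (norm_nonneg _) hU0
    refine (norm_sum_le_of_le _ h1).trans ?_
    simp only [Finset.sum_const, Finset.card_univ, Fintype.card_fin, nsmul_eq_mul]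
    linarith
  have hy : ‖spProj m (W - 1)‖ ≤ p * ‖W - 1‖ := ((spProj m).le_opNorm _).trans (by gcongr; simp [hp])
  obtain ⟨ξ, hξ, hξW⟩ := H (fun c => ctrlComb T A' B' (w c)) hgc' (fun c t _ => hgS c t) hgg
    (spProj m (W - 1)) (hy.trans hW2)
  have hξ' : ‖ξ‖ ≤ C * √p * √‖W - 1‖ := by
    refine hξ.trans ?_
    rw [mul_assoc, ← Real.sqrt_mul hp0.le]
    gcongr
  have hu := IsControl.linSum hw ξ
  refine ⟨_, hu.1, hu.2, ?_, (hwK ξ hu.1.contDiffOn).trans ?_⟩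
  · have hDξ : (4 * ‖(1 : Mat m)‖ + 1) * T * (Fintype.card β * (G + η) * ‖ξ‖)
        ≤ min (1 / 2) (r / 2) := by
      refine le_trans ?_ hεD
      calc _ ≤ (4 * ‖(1 : Mat m)‖ + 1) * T * (Fintype.card β * (G + η) * (C * √p * ε)) := by
            gcongr
            exact hξ'.trans (by gcongr)
        _ = D * ε := by rw [hD]; ring
    have hn : 0 ≤ T * (Fintype.card β * (G + η) * ‖ξ‖) := by positivity
    have hn' : 0 ≤ ‖(1 : Mat m)‖ * (T * (Fintype.card β * (G + η) * ‖ξ‖)) := by positivity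
    have hl1 := hDξ.trans (min_le_left _ _)
    have hl2 := hDξ.trans (min_le_right _ _)
    have hZ := norm_linearFlow_linSum_sub_one_le hT.le hgc' (G := G + η) (by positivity)
      (fun c t ht => by
        have := norm_le_norm_sub_add (ctrlComb T A' B' (w c) t) (ctrlComb T A B (w c) t)
        linarith [hgg c t ht, hG c t ht]) (ξ := ξ) (by linarith)
    rw [ctrlComb_linSum]
    -- Only the projections have been matched so far; both matrices are symplectic and within r of
    -- 1, so they coincide.
    refine hrinj _ _ (linearFlow_mem_symplectic hT.le
      (continuous_finsetSum _ fun c _ => (hgc' c).const_smul (ξ c)) (fun t _ =>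
        Submodule.sum_mem _ fun c _ => Submodule.smul_mem _ _ (hgS c t)) ⟨hT.le, le_rfl⟩) hW ?_ hW1 hξW
    refine hZ.trans_lt ?_
    linarith
  · have h1 : 0 ≤ √‖W - 1‖ := Real.sqrt_nonneg _
    calc Kw * ‖ξ‖ ≤ Kw * (C * √p * √‖W - 1‖) := by gcongr
      _ ≤ _ := by linarith

end LocalSteering

/-! ### Uniformity over the compact family of systems -/

theorem proposition3 {m k : ℕ} {T : ℝ} (hT : 0 < T) {Θ : Type*}
    (A : Θ → ℝ → Mat m) (B : Θ → Fin k → Mat m)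
    (hA : ∀ θ, ContDiffOn ℝ ∞ (A θ) (Icc 0 T))
    (hAsymp : ∀ θ, ∀ t ∈ Icc 0 T, (Matrix.J (Fin m) ℝ * A θ t).IsSymm)
    (hBsymp : ∀ θ i, (Matrix.J (Fin m) ℝ * B θ i).IsSymm)
    (hBB : ∀ θ i j, B θ i * B θ j = 0)
    (hbracket : ∀ θ i, ∀ j ∈ ({1, 2} : Set ℕ),
      bracketSeq T (A θ) (B θ i) j 0 * B θ i - B θ i * bracketSeq T (A θ) (B θ i) j 0 ∈
        Submodule.span ℝ {Y | ∃ (r : Fin k) (s : ℕ), Y = bracketSeq T (A θ) (B θ r) s 0})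
    (hspan : ∀ θ, Submodule.span ℝ
      ({Y | ∃ (i : Fin k) (j : ℕ), j ≤ 2 ∧ Y = bracketSeq T (A θ) (B θ i) j 0} ∪
        {Y | ∃ i l : Fin k, Y =
          bracketSeq T (A θ) (B θ i) 1 0 * bracketSeq T (A θ) (B θ l) 1 0
            - bracketSeq T (A θ) (B θ l) 1 0 * bracketSeq T (A θ) (B θ i) 1 0}) = spTangent m)
    (hcompact : IsCompact (range fun θ =>
      ((C2Path.ofSmooth (A θ) (hA θ) : C2Path T (Mat m)), B θ)))
    (C : Set (Mat m)) (hCsymp : C ⊆ Matrix.symplecticGroup (Fin m) ℝ) (hC : IsCompact C) :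
    ∃ μ > (0 : ℝ), ∃ K > (0 : ℝ), ∀ θ, ∀ Xbar ∈ C,
      ∀ X ∈ Matrix.symplecticGroup (Fin m) ℝ,
        X ∈ Metric.ball (endPoint T (A θ) (B θ) Xbar 0) μ →
          ∃ (u : ℝ → EuclideanSpace ℝ (Fin k)) (hu : ContDiff ℝ ∞ u),
            tsupport u ⊆ Ioo 0 T ∧
            endPoint T (A θ) (B θ) Xbar u = X ∧
            ‖(C2Path.ofSmooth u hu.contDiffOn : C2Path T (EuclideanSpace ℝ (Fin k)))‖ ≤
              K * ‖X - endPoint T (A θ) (B θ) Xbar 0‖ ^ (1 / 2 : ℝ) := by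
  set Φ : Θ → C2Path T (Mat m) × (Fin k → Mat m) := fun θ =>
    (C2Path.ofSmooth (A θ) (hA θ), B θ) with hΦ
  -- This property passes to subsets and finite unions, so by compactness it needs proof only near
  -- each point. The bound N on S(T) is included in order to undo the change of variables uniformly.
  let p : Set (C2Path T (Mat m) × (Fin k → Mat m)) → Prop := fun U =>
    ∃ μ > (0 : ℝ), ∃ K > (0 : ℝ), ∃ N > (0 : ℝ), ∀ θ, Φ θ ∈ U → ‖fundSol T (A θ) T‖ ≤ N ∧
      ∀ W ∈ Matrix.symplecticGroup (Fin m) ℝ, ‖W - 1‖ ≤ μ →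
        ∃ (u : ℝ → EuclideanSpace ℝ (Fin k)) (hu : ContDiff ℝ ∞ u), tsupport u ⊆ Ioo 0 T ∧
          linearFlow T (ctrlComb T (A θ) (B θ) u) T = W ∧
          ‖(C2Path.ofSmooth u hu.contDiffOn : C2Path T (EuclideanSpace ℝ (Fin k)))‖
            ≤ K * √‖W - 1‖
  obtain ⟨μ, hμ, K, hK, N, hN, H⟩ : p (range Φ) := by
    refine hcompact.induction_on (p := p) ⟨1, one_pos, 1, one_pos, 1, one_pos, by simp⟩ ?_ ?_ ?_
    · rintro U V hUV ⟨μ, hμ, K, hK, N, hN, h⟩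
      exact ⟨μ, hμ, K, hK, N, hN, fun θ hθ => h θ (hUV hθ)⟩
    · rintro U V ⟨μ, hμ, K, hK, N, hN, h⟩ ⟨μ', hμ', K', hK', N', hN', h'⟩
      refine ⟨min μ μ', lt_min hμ hμ', max K K', lt_max_of_lt_left hK, max N N',
        lt_max_of_lt_left hN, fun θ hθ => ?_⟩
      rcases hθ with hθ | hθ
      · obtain ⟨h1, h2⟩ := h θ hθ
        refine ⟨h1.trans (le_max_left _ _), fun W hW hWμ => ?_⟩
        obtain ⟨u, hu, hs, he, hn⟩ := h2 W hW (hWμ.trans (min_le_left _ _))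
        exact ⟨u, hu, hs, he, hn.trans
          (mul_le_mul_of_nonneg_right (le_max_left _ _) (Real.sqrt_nonneg _))⟩
      · obtain ⟨h1, h2⟩ := h' θ hθ
        refine ⟨h1.trans (le_max_right _ _), fun W hW hWμ => ?_⟩
        obtain ⟨u, hu, hs, he, hn⟩ := h2 W hW (hWμ.trans (min_le_right _ _))
        exact ⟨u, hu, hs, he, hn.trans
          (mul_le_mul_of_nonneg_right (le_max_right _ _) (Real.sqrt_nonneg _))⟩
    · rintro _ ⟨θ₀, rfl⟩
      obtain ⟨η, hη, μ, hμ, K, hK, h⟩ := exists_local_steering hT (hA θ₀) (hAsymp θ₀) (hBB θ₀)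
        (hbracket θ₀) (hspan θ₀)
      obtain ⟨L, hL, hS⟩ := exists_norm_fundSol_sub_le hT.le (hA θ₀).continuousOn
      -- The bound 1 is for the Lipschitz estimate of the fundamental solution, η for the steering.
      -- Only the uniform distance of the A's enters, hence the component 0 of the jet.
      set r := min 1 η with hr
      have hr0 : 0 < r := lt_min one_pos hη
      have hjet : Continuous fun x : C2Path T (Mat m) × (Fin k → Mat m) => x.1.jet 0 :=
        (continuous_apply (0 : Fin 3)).comp
          ((continuous_induced_dom (f := C2Path.jet (T := T) (E := Mat m))).comp continuous_fst)
      refine ⟨{x | dist (x.1.jet 0) ((Φ θ₀).1.jet 0) < r ∧ dist x.2 (Φ θ₀).2 < r},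
        mem_nhdsWithin_of_mem_nhds ?_, μ, hμ, K, hK, ‖fundSol T (A θ₀) T‖ + L * r + 1,
        by positivity, fun θ hθ => ?_⟩
      · refine Filter.inter_mem ?_ ?_
        · exact (isOpen_lt (hjet.dist continuous_const) continuous_const).mem_nhds
            (by simpa using hr0)
        · exact (isOpen_lt (continuous_snd.dist continuous_const) continuous_const).mem_nhds
            (by simpa using hr0)
      · have h1 : ∀ t ∈ Icc 0 T, ‖A θ t - A θ₀ t‖ ≤ r := fun t ht => by
          have h2 := (ContinuousMap.dist_apply_le_dist (f := (Φ θ).1.jet 0) (g := (Φ θ₀).1.jet 0)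
            ⟨t, ht⟩).trans hθ.1.le
          rw [dist_eq_norm] at h2
          simpa [hΦ, C2Path.jet, C2Path.ofSmooth] using h2
        have h2 : ∀ i, ‖B θ i - B θ₀ i‖ ≤ r := fun i => by
          rw [← dist_eq_norm]
          exact (dist_le_pi_dist (B θ) (B θ₀) i).trans hθ.2.le
        refine ⟨?_, h (A θ) (B θ) (hA θ).continuousOn (hBsymp θ)
          (fun t ht => (h1 t ht).trans (min_le_right _ _))
          (fun i => (h2 i).trans (min_le_right _ _))⟩
        have h3 := hS (A θ) (hA θ).continuousOn r hr0.le (min_le_left _ _) h1 T ⟨hT.le, le_rfl⟩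
        have h4 := norm_le_norm_sub_add (fundSol T (A θ) T) (fundSol T (A θ₀) T)
        linarith
  obtain ⟨c, hc⟩ := hC.exists_bound_of_continuousOn continuousOn_id
  set s := ‖sympInv m‖ with hs
  -- The matrix to reach is W = S⁻¹ X X̄⁻¹, with W - 1 = S⁻¹(X - S X̄)X̄⁻¹. On the group the inverse
  -- is the linear map `sympInv`, whence the bounds sN and s|c|; the absolute value covers an empty
  -- C, for which c may be negative.
  set q := (s * N) * (s * |c|) + 1 with hq
  have hs0 : 0 ≤ s := norm_nonneg (sympInv m)
  have hq0 : 0 < q := by positivity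
  refine ⟨μ / q, by positivity, K * √q, by positivity, fun θ Xbar hXbar X hX hXμ => ?_⟩
  have hAc := (hA θ).continuousOn
  obtain ⟨hSN, hW⟩ := H θ ⟨θ, rfl⟩
  have hS := fundSol_mem hT.le hAc (hAsymp θ) (t := T) ⟨hT.le, le_rfl⟩
  have hX' := hCsymp hXbar
  have he : endPoint T (A θ) (B θ) Xbar 0 = fundSol T (A θ) T * Xbar :=
    endPoint_zero hT.le hAc (hAsymp θ)
  rw [he] at hXμ ⊢
  rw [Metric.mem_ball, dist_eq_norm, lt_div_iff₀ hq0] at hXμ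
  set S := fundSol T (A θ) T
  have hSX : S * (sympInv m S * X * sympInv m Xbar) * Xbar = X := by
    rw [mul_assoc, mul_assoc (sympInv m S * X), sympInv_mul_self hX', mul_one, ← mul_assoc,
      self_mul_sympInv hS, one_mul]
  have hW1 : sympInv m S * X * sympInv m Xbar - 1
      = sympInv m S * (X - S * Xbar) * sympInv m Xbar := by
    rw [mul_sub, sub_mul, ← mul_assoc (sympInv m S) S, sympInv_mul_self hS, one_mul,
      self_mul_sympInv hX']
  have hW2 : ‖sympInv m S * X * sympInv m Xbar - 1‖ ≤ q * ‖X - S * Xbar‖ := by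
    have h1 : ‖sympInv m S‖ ≤ s * N := ((sympInv m).le_opNorm S).trans (by gcongr)
    have h2 : ‖sympInv m Xbar‖ ≤ s * |c| := ((sympInv m).le_opNorm Xbar).trans (by
      gcongr
      exact (hc Xbar hXbar).trans (le_abs_self c))
    rw [hW1]
    calc _ ≤ ‖sympInv m S‖ * ‖X - S * Xbar‖ * ‖sympInv m Xbar‖ :=
          (norm_mul_le _ _).trans (by gcongr; exact norm_mul_le _ _)
      _ ≤ (s * N) * ‖X - S * Xbar‖ * (s * |c|) := by gcongr
      _ ≤ q * ‖X - S * Xbar‖ := by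
          rw [hq]
          nlinarith [norm_nonneg (X - S * Xbar)]
  obtain ⟨u, hu, hsupp, hflow, hnorm⟩ := hW (sympInv m S * X * sympInv m Xbar)
    (mul_mem (mul_mem (sympInv_mem hS) hX) (sympInv_mem hX')) (hW2.trans (by linarith))
  refine ⟨u, hu, hsupp, ?_, hnorm.trans ?_⟩
  · rw [endPoint_eq hT.le hAc (hAsymp θ) hu.continuous]
    exact (congrArg (fun Z => S * Z * Xbar) hflow).trans hSX
  · rw [← Real.sqrt_eq_rpow, mul_assoc K, ← Real.sqrt_mul hq0.le]
    gcongr
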